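/- Let $K$ be a field and $r\ge 1$. Modules are left modules, and in path algebras $qp$ means "$q$ after $p$". For a finite dimensional algebra $\Lambda$, $\operatorname{Fin\,dim}\Lambda$ denotes the supremum of the projective dimensions of all (not necessarily finitely generated) $\Lambda$-modules of finite projective dimension, and $\Omega^1(M)$ denotes the kernel of a projective cover of $M$. For $m\ge1$ let $Q^{(m)}$ be the following quiver. Its vertices are $a_0,\dots,a_m$, $b_{-1},b_0,\dots,b_m$, $c_{-1},c_0,\dots,c_{\min(m,2)}$, $d_0,\dots,d_r$, $u,v,w$. Its arrows, as far as the indices are at most $m$, are: a loop at each of $u,v,w,b_{-1},c_{-1}$; $d_i\to d_{i+1}$ $(0\le i<r)$; $\alpha_0:a_0\to c_0$, $\alpha_0':a_0\to u$, $\beta_0:b_0\to b_{-1}$, $\beta_0':b_0\to v$, $\gamma_0:c_0\to c_{-1}$, $\gamma_0':c_0\to w$; $\alpha_i:a_i\to a_{i-1}$ and $\beta_i:b_i\to b_{i-1}$ $(i\ge1)$; $\alpha_1':a_1\to d_0$, $\beta_1':b_1\to c_0$, $\gamma_1:c_1\to a_0$, $\gamma_1':c_1\to b_0$; $\alpha_2':a_2\to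 c_2$, $\beta_2':b_2\to c_1$, $\gamma_2:c_2\to c_1$, $\gamma_2':c_2\to b_1$; $\beta_3':b_3\to c_2$; $\alpha_i':a_i\to b_{i-1}$ $(i\ge3)$; $\beta_i':b_i\to a_{i-1}$ $(i\ge4)$. Let $\Lambda_m=KQ^{(m)}/I_m$, where $I_m$ is generated by those of the binomials $$\alpha_1\alpha_2-\gamma_1\gamma_2\alpha_2',\quad \gamma_1'\beta_2'-\beta_1\beta_2,\quad \beta_1'\gamma_2'-\alpha_0\gamma_1\gamma_2,\quad \gamma_2\alpha_2'\alpha_3-\beta_2'\alpha_3',\quad \beta_2\beta_3-\gamma_2'\beta_3',\quad \beta_3'\beta_4-\alpha_2'\alpha_3\beta_4',$$ $$\alpha_{i-1}'\alpha_i-\beta_{i-1}\alpha_i'\ (i\ge4),\qquad \beta_{i-1}'\beta_i-\alpha_{i-1}\beta_i'\ (i\ge5)$$ whose arrows lie in $Q^{(m)}$, together with all paths of positive length that are not initial subpaths of one of the following paths: the paths occurring in these binomials, the five loops, the arrows $d_i\to d_{i+1}$, and $\gamma_0\alpha_0$, $\alpha_0'$, $\beta_0$, $\beta_0'$, $\gamma_0$,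 $\gamma_0'$, $\alpha_0'\alpha_1$, $\alpha_1'$, $\beta_0\beta_1$, $\gamma_0'\beta_1'$, $\gamma_0\alpha_0\gamma_1$, $\beta_0'\gamma_1'$. For $k\le m$, every $\Lambda_k$-module is regarded as a $\Lambda_m$-module on which the vertices of $Q^{(m)}$ outside $Q^{(k)}$ act as $0$. For a right infinite word $q_0p_1^{-1}q_1p_2^{-1}q_2\cdots$ (where $p_i,q_i$ start in a common vertex $x_i$ for $i\ge1$, $q_0$ starts in $x_0$, and $q_i,p_{i+1}$ end in a common vertex), the corresponding generalized string module is generated by elements $z_i$ $(i\ge0)$ subject to the relations $e_{x_i}z_i=z_i$, $q_iz_i=p_{i+1}z_{i+1}$, and $\alpha z_0=0$ for every arrow $\alpha$ that starts in $x_0$ and is not the first arrow of $q_0$. Let $M_k$ be the generalized string module of the following word, which is periodic after its first syllable: - $k=1$: $\ \alpha_1\,\gamma_1^{-1}\gamma_1'\,\beta_1^{-1}\beta_1'\,(\alpha_0\gamma_1)^{-1}\gamma_1'\,\beta_1^{-1}\beta_1'\,(\alpha_0\gamma_1)^{-1}\cdots$ - $k=2$: $\ \gamma_2\alpha_2'\,(\beta_2')^{-1}\beta_2\,(\gamma_2')^{-1}\gamma_2\,(\beta_2')^{-1}\beta_2\,(\gamma_2')^{-1}\gamma_2\cdots$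 - $k=3$: $\ \alpha_3'\,\beta_3^{-1}\beta_3'\,(\alpha_2'\alpha_3)^{-1}\alpha_3'\,\beta_3^{-1}\beta_3'\,(\alpha_2'\alpha_3)^{-1}\alpha_3'\cdots$ - $k\ge4$: $\ \alpha_k'\,\beta_k^{-1}\beta_k'\,\alpha_k^{-1}\alpha_k'\,\beta_k^{-1}\beta_k'\,\alpha_k^{-1}\alpha_k'\cdots$ Then the following hold. 1. $\operatorname{Fin\,dim}\Lambda_m=r+m$ for $1\le m\le r+1$. In particular, $\operatorname{Fin\,dim}\Lambda_{r+1}=2r+1$. 2. For $1\le k\le m$, the projective dimension of $M_k$ over $\Lambda_m$ is $r+k$; in particular $\operatorname{p\,dim}M_1=r+1$. For $2\le k\le m$, $\Omega^1(M_k)\cong M_{k-1}$ over $\Lambda_m$. 3. For $m\ge2$ and every $\Lambda_m$-module $M$ of finite projective dimension, $\Omega^1(M)$ is a $\Lambda_{m-1}$-module, that is, it is annihilated by the idempotents $e_x$ of the vertices $x$ in $Q^{(m)}\setminus Q^{(m-1)}$ (namely $a_m$, $b_m$, and also $c_2$ if $m=2$). -/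

import Mathlib

universe u

open CategoryTheory

noncomputable section

/-! ### Path algebras of finite quivers -/

/-- The set of all paths of a quiver, with arbitrary start and end vertices. -/
abbrev QPath (V : Type) [Quiver.{0} V] : Type := Σ x y : V, Quiver.Path x y

/-- The path algebra `K V`: the vector space with basis the set of all paths. -/
def PathAlgebra (K : Type u) [Field K] (V : Type) [Quiver.{0} V] : Type u := QPath V →₀ K

namespace PathAlgebra

section Ring

variable (K : Type u) [Field K] {V : Type} [Quiver.{0} V]

instance : AddCommGroup (PathAlgebra K V) := inferInstanceAs (AddCommGroup (QPath V →₀ K))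

instance : Module K (PathAlgebra K V) := inferInstanceAs (Module K (QPath V →₀ K))

variable (V) in
/-- The basis of the path algebra that consists of the paths. -/
def basis : Module.Basis (QPath V) K (PathAlgebra K V) :=
  Module.Basis.ofRepr (LinearEquiv.refl K (QPath V →₀ K))

/-- The element of the path algebra given by a path `p` from `x` to `y`. -/
def ofPath {x y : V} (p : Quiver.Path x y) : PathAlgebra K V := basis K V ⟨x, y, p⟩

open Classical in
/-- The product `q * p`, read "`q` after `p`": the concatenated path if `q` starts where `p` ends,
and zero otherwise. -/
def mulPath (q p : QPath V) : PathAlgebra K V :=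
  if h : q.1 = p.2.1 then ofPath K (p.2.2.comp (q.2.2.cast h rfl)) else 0

variable (V) in
/-- The multiplication, as the bilinear extension of `mulPath`. -/
def mulLin : PathAlgebra K V →ₗ[K] PathAlgebra K V →ₗ[K] PathAlgebra K V :=
  (basis K V).constr K fun q => (basis K V).constr K fun p => mulPath K q p

theorem mulLin_basis (q p : QPath V) :
    mulLin K V (basis K V q) (basis K V p) = mulPath K q p := by
  simp only [mulLin, Module.Basis.constr_basis]

theorem mulLin_ofPath {x y z : V} (q : Quiver.Path y z) (p : Quiver.Path x y) :
    mulLin K V (ofPath K q) (ofPath K p) = ofPath K (p.comp q) := by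
  rw [ofPath, ofPath, mulLin_basis]
  simp [mulPath]

theorem mulLin_ofPath_ne {x y y' z : V} (q : Quiver.Path y' z) (p : Quiver.Path x y)
    (h : y' ≠ y) : mulLin K V (ofPath K q) (ofPath K p) = 0 := by
  rw [ofPath, ofPath, mulLin_basis]
  simp [mulPath, h]

theorem mulLin_assoc (a b c : PathAlgebra K V) :
    mulLin K V (mulLin K V a b) c = mulLin K V a (mulLin K V b c) := by
  have h3 : ∀ p q s : QPath V,
      mulLin K V (mulLin K V (basis K V p) (basis K V q)) (basis K V s) =
        mulLin K V (basis K V p) (mulLin K V (basis K V q) (basis K V s)) := by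
    rintro ⟨x₁, y₁, p⟩ ⟨x₂, y₂, q⟩ ⟨x₃, y₃, s⟩
    change mulLin K V (mulLin K V (ofPath K p) (ofPath K q)) (ofPath K s) =
      mulLin K V (ofPath K p) (mulLin K V (ofPath K q) (ofPath K s))
    by_cases h₁ : x₁ = y₂
    · subst h₁
      by_cases h₂ : x₂ = y₃
      · subst h₂
        simp only [mulLin_ofPath, Quiver.Path.comp_assoc]
      · rw [mulLin_ofPath, mulLin_ofPath_ne K _ _ h₂, mulLin_ofPath_ne K _ _ h₂, map_zero]
    · rw [mulLin_ofPath_ne K _ _ h₁]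
      by_cases h₂ : x₂ = y₃
      · subst h₂
        rw [mulLin_ofPath, mulLin_ofPath_ne K _ _ h₁, map_zero, LinearMap.zero_apply]
      · rw [mulLin_ofPath_ne K _ _ h₂, map_zero, map_zero, LinearMap.zero_apply]
  have h2 : ∀ (p q : QPath V) (c : PathAlgebra K V),
      mulLin K V (mulLin K V (basis K V p) (basis K V q)) c =
        mulLin K V (basis K V p) (mulLin K V (basis K V q) c) := fun p q c =>
    LinearMap.congr_fun (f := mulLin K V (mulLin K V (basis K V p) (basis K V q)))
      (g := mulLin K V (basis K V p) ∘ₗ mulLin K V (basis K V q))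
      ((basis K V).ext fun s => h3 p q s) c
  have h1 : ∀ (p : QPath V) (b c : PathAlgebra K V),
      mulLin K V (mulLin K V (basis K V p) b) c =
        mulLin K V (basis K V p) (mulLin K V b c) := fun p b c =>
    LinearMap.congr_fun (f := (mulLin K V).flip c ∘ₗ mulLin K V (basis K V p))
      (g := mulLin K V (basis K V p) ∘ₗ (mulLin K V).flip c)
      ((basis K V).ext fun q => h2 p q c) b
  exact LinearMap.congr_fun (f := (mulLin K V).flip c ∘ₗ (mulLin K V).flip b)
      (g := (mulLin K V).flip (mulLin K V b c))
      ((basis K V).ext fun p => h1 p b c) a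

variable [Fintype V]

variable (V) in
/-- The identity element, the sum of the trivial paths. -/
def oneElt : PathAlgebra K V := ∑ x : V, ofPath K (Quiver.Path.nil : Quiver.Path x x)

theorem oneElt_mul (a : PathAlgebra K V) : mulLin K V (oneElt K V) a = a := by
  refine LinearMap.congr_fun (f := mulLin K V (oneElt K V)) (g := LinearMap.id)
    ((basis K V).ext ?_) a
  rintro ⟨x, y, p⟩
  change mulLin K V (oneElt K V) (ofPath K p) = ofPath K p
  rw [oneElt, map_sum, LinearMap.sum_apply, Finset.sum_eq_single y]
  · rw [mulLin_ofPath, Quiver.Path.comp_nil]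
  · intro z _ hz
    exact mulLin_ofPath_ne K _ _ hz
  · simp

theorem mul_oneElt (a : PathAlgebra K V) : mulLin K V a (oneElt K V) = a := by
  refine LinearMap.congr_fun (f := (mulLin K V).flip (oneElt K V)) (g := LinearMap.id)
    ((basis K V).ext ?_) a
  rintro ⟨x, y, p⟩
  change mulLin K V (ofPath K p) (oneElt K V) = ofPath K p
  rw [oneElt, map_sum, Finset.sum_eq_single x]
  · rw [mulLin_ofPath, Quiver.Path.nil_comp]
  · intro z _ hz
    exact mulLin_ofPath_ne K _ _ (Ne.symm hz)
  · simp

instance : Ring (PathAlgebra K V) where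
  __ := (inferInstance : AddCommGroup (PathAlgebra K V))
  mul a b := mulLin K V a b
  one := oneElt K V
  left_distrib a b c := map_add (mulLin K V a) b c
  right_distrib a b c := LinearMap.map_add₂ (mulLin K V) a b c
  zero_mul a := LinearMap.map_zero₂ (mulLin K V) a
  mul_zero a := map_zero (mulLin K V a)
  mul_assoc := mulLin_assoc K
  one_mul := oneElt_mul K
  mul_one := mul_oneElt K

theorem mul_def (a b : PathAlgebra K V) : a * b = mulLin K V a b := rfl

instance : Algebra K (PathAlgebra K V) :=
  Algebra.ofModule (fun c a b => LinearMap.map_smul₂ (mulLin K V) c a b)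
    (fun c a b => map_smul (mulLin K V a) c b)

end Ring

end PathAlgebra

/-! ### The quivers -/

/-- The vertices of the `m`-th quiver. Besides `a_0, …, a_m`, `b_0, …, b_m` and those of
`c_0, c_1, c_2` whose index is at most `m`, there are `b_{-1}`, `c_{-1}`, `u`, `v`, `w` and
`d_0, …, d_r`. -/
inductive Vert (r m : ℕ) : Type
  | a (i : ℕ) (h : i ≤ m) : Vert r m
  | b (i : ℕ) (h : i ≤ m) : Vert r m
  | c (i : ℕ) (h : i ≤ m) (h' : i ≤ 2) : Vert r m
  | bneg : Vert r m
  | cneg : Vert r m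
  | u : Vert r m
  | v : Vert r m
  | w : Vert r m
  | d (i : ℕ) (h : i ≤ r) : Vert r m

namespace Vert

/-- The vertices `a_i`, `b_i`, `c_i` have level `i`, and all other vertices have level `0`. For
`m ≥ 2`, the vertices of level `m` are those that the `m`-th quiver has in addition to the
vertices of the `(m-1)`-st. -/
def level {r m : ℕ} : Vert r m → ℕ
  | a i _ => i
  | b i _ => i
  | c i _ _ => i
  | _ => 0

/-- An injective code for vertices, which shows that there are finitely many. -/
def code {r m : ℕ} : Vert r m → Fin 9 × Fin (r + m + 1)
  | a i h => (0, ⟨i, by omega⟩)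
  | b i h => (1, ⟨i, by omega⟩)
  | c i h _ => (2, ⟨i, by omega⟩)
  | bneg => (3, 0)
  | cneg => (4, 0)
  | u => (5, 0)
  | v => (6, 0)
  | w => (7, 0)
  | d i h => (8, ⟨i, by omega⟩)

theorem code_injective {r m : ℕ} : Function.Injective (code : Vert r m → _) := by
  intro x y h
  cases x <;> cases y <;> simp_all [code]

instance {r m : ℕ} : Fintype (Vert r m) :=
  have : Finite (Vert r m) := Finite.of_injective _ code_injective
  Fintype.ofFinite _

end Vert

/-- The arrows of the `m`-th quiver. A name ending in `'` is the primed arrow with the same letter;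
`δ i` is the arrow from `d_i` to `d_{i+1}`, and `loopX` is the loop at the vertex `X`. -/
inductive Arr (r m : ℕ) : Vert r m → Vert r m → Type
  | loopU : Arr r m .u .u
  | loopV : Arr r m .v .v
  | loopW : Arr r m .w .w
  | loopB : Arr r m .bneg .bneg
  | loopC : Arr r m .cneg .cneg
  | δ (i : ℕ) (h : i + 1 ≤ r) : Arr r m (.d i (by omega)) (.d (i + 1) h)
  | α0 : Arr r m (.a 0 (by omega)) (.c 0 (by omega) (by omega))
  | α0' : Arr r m (.a 0 (by omega)) .u
  | β0 : Arr r m (.b 0 (by omega)) .bneg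
  | β0' : Arr r m (.b 0 (by omega)) .v
  | γ0 : Arr r m (.c 0 (by omega) (by omega)) .cneg
  | γ0' : Arr r m (.c 0 (by omega) (by omega)) .w
  /-- `α_{i+1} : a_{i+1} → a_i` -/
  | α (i : ℕ) (h : i + 1 ≤ m) : Arr r m (.a (i + 1) h) (.a i (by omega))
  /-- `β_{i+1} : b_{i+1} → b_i` -/
  | β (i : ℕ) (h : i + 1 ≤ m) : Arr r m (.b (i + 1) h) (.b i (by omega))
  | α1' (h : 1 ≤ m) : Arr r m (.a 1 h) (.d 0 (by omega))
  | β1' (h : 1 ≤ m) : Arr r m (.b 1 h) (.c 0 (by omega) (by omega))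
  | γ1 (h : 1 ≤ m) : Arr r m (.c 1 h (by omega)) (.a 0 (by omega))
  | γ1' (h : 1 ≤ m) : Arr r m (.c 1 h (by omega)) (.b 0 (by omega))
  | α2' (h : 2 ≤ m) : Arr r m (.a 2 h) (.c 2 h (by omega))
  | β2' (h : 2 ≤ m) : Arr r m (.b 2 h) (.c 1 (by omega) (by omega))
  | γ2 (h : 2 ≤ m) : Arr r m (.c 2 h (by omega)) (.c 1 (by omega) (by omega))
  | γ2' (h : 2 ≤ m) : Arr r m (.c 2 h (by omega)) (.b 1 (by omega))
  | β3' (h : 3 ≤ m) : Arr r m (.b 3 h) (.c 2 (by omega) (by omega))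
  /-- `α'_{i+3} : a_{i+3} → b_{i+2}` -/
  | α' (i : ℕ) (h : i + 3 ≤ m) : Arr r m (.a (i + 3) h) (.b (i + 2) (by omega))
  /-- `β'_{i+4} : b_{i+4} → a_{i+3}` -/
  | β' (i : ℕ) (h : i + 4 ≤ m) : Arr r m (.b (i + 4) h) (.a (i + 3) (by omega))

instance (r m : ℕ) : Quiver.{0} (Vert r m) := ⟨Arr r m⟩

/-- An arrow, as a path of length one. -/
def Arr.path {r m : ℕ} {x y : Vert r m} (f : Arr r m x y) : Quiver.Path x y :=
  Quiver.Hom.toPath (V := Vert r m) f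

/-- `g ⊚ f` is the path "`g` after `f`". -/
notation:80 g:81 " ⊚ " f:80 => Quiver.Path.comp f g

/-! ### The relations -/

/-- The binomial relations: `Binomial p q` means that `p - q` is one of the binomial generators
of the ideal `I_m`. -/
inductive Binomial (r m : ℕ) : ∀ {x y : Vert r m}, Quiver.Path x y → Quiver.Path x y → Prop
  | a2 (h : 2 ≤ m) : Binomial r m ((Arr.α 0 (by omega)).path ⊚ (Arr.α 1 h).path)
      ((Arr.γ1 (by omega)).path ⊚ (Arr.γ2 h).path ⊚ (Arr.α2' h).path)
  | b2 (h : 2 ≤ m) : Binomial r m ((Arr.γ1' (by omega)).path ⊚ (Arr.β2' h).path)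
      ((Arr.β 0 (by omega)).path ⊚ (Arr.β 1 h).path)
  | c2 (h : 2 ≤ m) : Binomial r m ((Arr.β1' (by omega)).path ⊚ (Arr.γ2' h).path)
      (Arr.α0.path ⊚ (Arr.γ1 (by omega)).path ⊚ (Arr.γ2 h).path)
  | a3 (h : 3 ≤ m) : Binomial r m
      ((Arr.γ2 (by omega)).path ⊚ (Arr.α2' (by omega)).path ⊚ (Arr.α 2 h).path)
      ((Arr.β2' (by omega)).path ⊚ (Arr.α' 0 h).path)
  | b3 (h : 3 ≤ m) : Binomial r m ((Arr.β 1 (by omega)).path ⊚ (Arr.β 2 h).path)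
      ((Arr.γ2' (by omega)).path ⊚ (Arr.β3' h).path)
  | b4 (h : 4 ≤ m) : Binomial r m ((Arr.β3' (by omega)).path ⊚ (Arr.β 3 h).path)
      ((Arr.α2' (by omega)).path ⊚ (Arr.α 2 (by omega)).path ⊚ (Arr.β' 0 h).path)
  /-- `α'_{i+3} α_{i+4} - β_{i+3} α'_{i+4}` -/
  | a (i : ℕ) (h : i + 4 ≤ m) : Binomial r m
      ((Arr.α' i (by omega)).path ⊚ (Arr.α (i + 3) h).path)
      ((Arr.β (i + 2) (by omega)).path ⊚ (Arr.α' (i + 1) h).path)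
  /-- `β'_{i+4} β_{i+5} - α_{i+4} β'_{i+5}` -/
  | b (i : ℕ) (h : i + 5 ≤ m) : Binomial r m
      ((Arr.β' i (by omega)).path ⊚ (Arr.β (i + 4) h).path)
      ((Arr.α (i + 3) (by omega)).path ⊚ (Arr.β' (i + 1) h).path)

/-- The branches of the graphs of the indecomposable projective modules, read from the top down:
those of the projectives of the first algebra, and the paths that occur in binomial relations. -/
inductive Branch (r m : ℕ) : ∀ {x y : Vert r m}, Quiver.Path x y → Prop
  | loopU : Branch r m Arr.loopU.path
  | loopV : Branch r m Arr.loopV.path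
  | loopW : Branch r m Arr.loopW.path
  | loopB : Branch r m Arr.loopB.path
  | loopC : Branch r m Arr.loopC.path
  | d (i : ℕ) (h : i + 1 ≤ r) : Branch r m (Arr.δ i h).path
  | a0 : Branch r m (Arr.γ0.path ⊚ Arr.α0.path)
  | a0' : Branch r m Arr.α0'.path
  | b0 : Branch r m Arr.β0.path
  | b0' : Branch r m Arr.β0'.path
  | c0 : Branch r m Arr.γ0.path
  | c0' : Branch r m Arr.γ0'.path
  | a1 (h : 1 ≤ m) : Branch r m (Arr.α0'.path ⊚ (Arr.α 0 h).path)
  | a1' (h : 1 ≤ m) : Branch r m (Arr.α1' h).path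
  | b1 (h : 1 ≤ m) : Branch r m (Arr.β0.path ⊚ (Arr.β 0 h).path)
  | b1' (h : 1 ≤ m) : Branch r m (Arr.γ0'.path ⊚ (Arr.β1' h).path)
  | c1 (h : 1 ≤ m) : Branch r m (Arr.γ0.path ⊚ Arr.α0.path ⊚ (Arr.γ1 h).path)
  | c1' (h : 1 ≤ m) : Branch r m (Arr.β0'.path ⊚ (Arr.γ1' h).path)
  | left {x y : Vert r m} {p q : Quiver.Path x y} (h : Binomial r m p q) : Branch r m p
  | right {x y : Vert r m} {p q : Quiver.Path x y} (h : Binomial r m p q) : Branch r m q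

/-- The generators of the ideal `I_m`: the binomial relations, and all paths of positive length
that are not initial subpaths of a branch. -/
inductive Relation (K : Type u) [Field K] (r m : ℕ) :
    PathAlgebra K (Vert r m) → PathAlgebra K (Vert r m) → Prop
  | binomial {x y : Vert r m} {p q : Quiver.Path x y} (h : Binomial r m p q) :
      Relation K r m (PathAlgebra.ofPath K p) (PathAlgebra.ofPath K q)
  | monomial {x y : Vert r m} (p : Quiver.Path x y) (hp : 0 < p.length)
      (h : ∀ (z : Vert r m) (s : Quiver.Path y z), ¬ Branch r m (p.comp s)) :
      Relation K r m (PathAlgebra.ofPath K p) 0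

/-- The algebra `Λ_m`: the path algebra of the `m`-th quiver modulo the ideal `I_m`. -/
abbrev Lam (K : Type u) [Field K] (r m : ℕ) : Type u := RingQuot (Relation K r m)

namespace Lam

variable (K : Type u) [Field K] {r m : ℕ}

/-- The residue class of a path in `Λ_m`. -/
def path {x y : Vert r m} (p : Quiver.Path x y) : Lam K r m :=
  RingQuot.mkRingHom (Relation K r m) (PathAlgebra.ofPath K p)

/-- The primitive idempotent `e_x` of `Λ_m`. -/
def e (x : Vert r m) : Lam K r m := path K (Quiver.Path.nil : Quiver.Path x x)

end Lam

/-! ### Right infinite string modules -/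

/-- A right infinite zigzag of paths `q_0 p_1⁻¹ q_1 p_2⁻¹ q_2 ⋯`: for all `i`, the path `q_i`
starts in the vertex `top i`, the path `p_{i+1}` (called `p i` here) starts in `top (i + 1)`, and
both end in `bot i`. -/
structure RightWord (V : Type) [Quiver.{0} V] where
  top : ℕ → V
  bot : ℕ → V
  q : ∀ i, Quiver.Path (top i) (bot i)
  p : ∀ i, Quiver.Path (top (i + 1)) (bot i)

namespace RightWord

variable {r m : ℕ}

/-- The relations of the generalized string module of a right infinite word, in the free module
with basis `z_0, z_1, …`: the generator `z_i` is normed by the vertex `top i`, adjacent generators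
are glued by `q_i z_i = p_{i+1} z_{i+1}`, and every arrow that starts in `top 0` and is not the
first arrow of `q_0` annihilates `z_0`. -/
inductive StringRelation (K : Type u) [Field K] (W : RightWord (Vert r m)) :
    (ℕ →₀ Lam K r m) → Prop
  | normed (i : ℕ) :
      StringRelation K W (Finsupp.single i (Lam.e K (W.top i)) - Finsupp.single i 1)
  | glue (i : ℕ) : StringRelation K W
      (Finsupp.single i (Lam.path K (W.q i)) - Finsupp.single (i + 1) (Lam.path K (W.p i)))
  | trim {y : Vert r m} (f : Arr r m (W.top 0) y)
      (hf : ∀ s : Quiver.Path y (W.bot 0), W.q 0 ≠ f.path.comp s) :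
      StringRelation K W (Finsupp.single 0 (Lam.path K f.path))

/-- The generalized string module of a right infinite word, as a left `Λ_m`-module. -/
abbrev StringModule (K : Type u) [Field K] (W : RightWord (Vert r m)) : Type u :=
  (ℕ →₀ Lam K r m) ⧸ Submodule.span (Lam K r m) {z | StringRelation K W z}

/-- The top vertices of the word `q₀ p₁⁻¹ s₁ t₁⁻¹ s₂ t₂⁻¹ s₁ t₁⁻¹ s₂ t₂⁻¹ ⋯`. -/
def perTop {V : Type} (x y z : V) : ℕ → V
  | 0 => x
  | 1 => y
  | 2 => z
  | n + 3 => perTop x y z (n + 1)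

/-- The right periodic word `q₀ p₁⁻¹ s₁ t₁⁻¹ s₂ t₂⁻¹ s₁ t₁⁻¹ s₂ t₂⁻¹ ⋯`. -/
def periodic {V : Type} [Quiver.{0} V] {x y z f₀ f₁ f₂ : V}
    (q₀ : Quiver.Path x f₀) (p₁ : Quiver.Path y f₀)
    (s₁ : Quiver.Path y f₁) (t₁ : Quiver.Path z f₁)
    (s₂ : Quiver.Path z f₂) (t₂ : Quiver.Path y f₂) : RightWord V where
  top := perTop x y z
  bot := perTop f₀ f₁ f₂
  q := qs
  p := ps
where
  qs : ∀ i, Quiver.Path (perTop x y z i) (perTop f₀ f₁ f₂ i)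
    | 0 => q₀
    | 1 => s₁
    | 2 => s₂
    | n + 3 => qs (n + 1)
  ps : ∀ i, Quiver.Path (perTop x y z (i + 1)) (perTop f₀ f₁ f₂ i)
    | 0 => p₁
    | 1 => t₁
    | 2 => t₂
    | n + 3 => ps (n + 1)

end RightWord

/-- The word of the string module `M_k`, over the `m`-th quiver, for `1 ≤ k ≤ m`:
* `α_1 γ_1⁻¹ γ'_1 β_1⁻¹ β'_1 (α_0γ_1)⁻¹ γ'_1 β_1⁻¹ β'_1 (α_0γ_1)⁻¹ ⋯` for `k = 1`;
* `γ_2α'_2 β'_2⁻¹ β_2 γ'_2⁻¹ γ_2 β'_2⁻¹ β_2 γ'_2⁻¹ γ_2 β'_2⁻¹ ⋯` for `k = 2`;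
* `α'_3 β_3⁻¹ β'_3 (α'_2α_3)⁻¹ α'_3 β_3⁻¹ β'_3 (α'_2α_3)⁻¹ α'_3 β_3⁻¹ ⋯` for `k = 3`;
* `α'_k β_k⁻¹ β'_k α_k⁻¹ α'_k β_k⁻¹ β'_k α_k⁻¹ α'_k β_k⁻¹ ⋯` for `k ≥ 4`. -/
def stringWord (r m : ℕ) : ∀ k : ℕ, 1 ≤ k → k ≤ m → RightWord (Vert r m)
  | 1, _, h => RightWord.periodic (Arr.α 0 h).path (Arr.γ1 h).path
      (Arr.γ1' h).path (Arr.β 0 h).path (Arr.β1' h).path (Arr.α0.path ⊚ (Arr.γ1 h).path)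
  | 2, _, h => RightWord.periodic ((Arr.γ2 h).path ⊚ (Arr.α2' h).path) (Arr.β2' h).path
      (Arr.β 1 h).path (Arr.γ2' h).path (Arr.γ2 h).path (Arr.β2' h).path
  | 3, _, h => RightWord.periodic (Arr.α' 0 h).path (Arr.β 2 h).path
      (Arr.β3' h).path ((Arr.α2' (by omega)).path ⊚ (Arr.α 2 h).path)
      (Arr.α' 0 h).path (Arr.β 2 h).path
  | k + 4, _, h => RightWord.periodic (Arr.α' (k + 1) h).path (Arr.β (k + 3) h).path
      (Arr.β' k h).path (Arr.α (k + 3) h).path (Arr.α' (k + 1) h).path (Arr.β (k + 3) h).path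

/-- The right infinite generalized string module `M_k`, as a left module over `Λ_m`, for
`1 ≤ k ≤ m`. -/
abbrev StringM (K : Type u) [Field K] (r m k : ℕ) (hk : 1 ≤ k) (hkm : k ≤ m) : Type u :=
  (stringWord r m k hk hkm).StringModule K

/-! ### Syzygies and finitistic dimension -/

/-- A projective cover: a surjection from a projective module whose kernel is superfluous. -/
structure IsProjectiveCover {A : Type u} [Ring A] {P M : Type u} [AddCommGroup P] [Module A P]
    [AddCommGroup M] [Module A M] (f : P →ₗ[A] M) : Prop where
  projective : Module.Projective A P
  surjective : Function.Surjective f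
  superfluous : ∀ N : Submodule A P, N ⊔ LinearMap.ker f = ⊤ → N = ⊤

/-- `N` is isomorphic to the first syzygy `Ω¹(M)`, the kernel of a projective cover of `M`. -/
def IsFirstSyzygy (A : Type u) [Ring A] (N M : Type u) [AddCommGroup N] [Module A N]
    [AddCommGroup M] [Module A M] : Prop :=
  ∃ (P : ModuleCat.{u} A) (f : P →ₗ[A] M),
    IsProjectiveCover f ∧ Nonempty (N ≃ₗ[A] LinearMap.ker f)

/-- The left big finitistic dimension: the supremum of the projective dimensions of all left
modules of finite projective dimension. -/
def bigFinitisticDim (A : Type u) [Ring A] : WithBot ℕ∞ :=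
  ⨆ (M : ModuleCat.{u} A) (_ : projectiveDimension M ≠ ⊤), projectiveDimension M

end

/-!
The algebra `Λ_m` is almost an incidence algebra. Between two vertices there is at most one nonzero
class `arc x y` of paths without loops, and together with the classes `loop y` these elements form a
basis with the obvious multiplication (`Lam.eq_sum`, `Lam.arc_mul_arc`, `Lam.coeff_arc`). Everything
about `Λ_m` and its projective modules therefore reduces to the relation `Vert.Reaches`, which is a
table that can be checked by cases. Every module has a projective cover by a sum of modules
`Λ e_x` with kernel in the radical (`Lam.exists_cover`).

Projective dimensions are bounded in both directions by following linear equations. If all modules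
of projective dimension less than `n` satisfy "`s x = 0` implies `e x ∈ ρ N + τ N`", then, by
lifting to a free module, an analogous statement about the equation `ρ x = 0` holds for
projective dimension less than `n + 1` (`ResolvesLT.succ`).

* Upper bound. The equation given by a loop reproduces itself in this process, so it yields
  statements about all modules of finite projective dimension (`ResolvesFin.of_self`). Applied to
  the kernel of a projective cover, on which loops vanish because it lies in the radical, these show
  that the syzygy of a module of finite projective dimension whose vertices have level at most
  `l ≥ 1` has level less than `l` (`Lam.e_smul_ker_eq_zero`), and that for `l = 0` it lives on
  `d_1, …, d_r`, where the syzygies move along the arrows `d_i → d_{i+1}`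
  (`Lam.pdLT_of_support_d`). Hence the projective dimension is at most `r + l`
  (`Lam.pdLT_of_level_le`).
* Lower bound. Starting with the arrow `d_{r-1} → d_r`, the equations run against the arrows up to
  `a_1` and then along `α_2, …, α_k`. For projective dimension less than `r + k`, they say that an
  element at `a_k` annihilated by the trimmed arrow of `M_k` is a multiple of `α_{k+1}`
  (`Lam.resolvesLT_enter`). The generator `z_0` of `M_k` violates this.

The projective cover of a string module is the sum of the projective modules of its tops, and its
kernel is generated by the relations. Up to signs, these relations satisfy the relations of the
next string module, and a comparison of bases shows that they satisfy no others
(`Lam.SyzygyCondition.injective`); this identifies `Ω¹(M_k)` with `M_{k-1}`. In the case `k = 1`,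
the glueing relations generate a projective submodule of the syzygy, and the quotient lives on the
vertices `d_i`, so that `M_1` has finite projective dimension (`RightWord.IsLoopFree.pdLT_succ`).
-/

noncomputable section

/-! ### Paths of the quiver -/

section

namespace Vert

variable {r m : ℕ}

/-- `x.Reaches y` means that some path from `x` to `y` without loops does not lie in the ideal
`I_m`. The relation is written out as a table, so that statements about it can be decided by cases;
`LoopFree.isInitial`, `IsInitial.loopFree_or` and `Lam.coeff_arc` show that the table is right. -/
def Reaches : Vert r m → Vert r m → Prop
  | a i _, a j _ => j = i ∨ j + 1 = i ∨ (i = 2 ∧ j = 0)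
  | a i _, b j _ => (3 ≤ i ∧ j + 1 = i) ∨ (4 ≤ i ∧ j + 2 = i)
  | a i _, c j _ _ => (i = 0 ∧ j = 0) ∨ ((i = 2 ∨ i = 3) ∧ (j = 1 ∨ j = 2))
  | a i _, cneg => i = 0
  | a i _, u => i ≤ 1
  | a i _, d j _ => i = 1 ∧ j = 0
  | b i _, b j _ => j = i ∨ j + 1 = i ∨ (i = 2 ∧ j = 0) ∨ (i = 3 ∧ j = 1)
  | b i _, a j _ => 4 ≤ i ∧ (j + 1 = i ∨ j + 2 = i)
  | b i _, c j _ _ => (i = 1 ∧ j = 0) ∨ (i = 2 ∧ j = 1) ∨ ((i = 3 ∨ i = 4) ∧ j = 2)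
  | b i _, bneg => i ≤ 1
  | b i _, v => i = 0
  | b i _, w => i = 1
  | c i _ _, c j _ _ => j ≤ i
  | c i _ _, a j _ => 1 ≤ i ∧ j = 0
  | c i _ _, b j _ => 1 ≤ i ∧ j + 1 = i
  | c i _ _, cneg => i ≤ 1
  | c i _ _, w => i = 0
  | c i _ _, v => i = 1
  | d i _, d j _ => j = i ∨ j = i + 1
  | u, u => True
  | v, v => True
  | w, w => True
  | bneg, bneg => True
  | cneg, cneg => True
  | _, _ => False

theorem Reaches.refl (x : Vert r m) : Reaches x x := by
  cases x <;> simp [Reaches]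

/-- A height function on the vertices: every arrow other than a loop lowers it, but the paths
recorded by `Reaches` lower it by at most three. -/
def height : Vert r m → ℤ
  | a i _ => if i ≤ 1 then i + 2 else i + 3
  | b i _ => if i ≤ 1 then i + 1 else if i ≤ 3 then i + 2 else i + 3
  | c i _ _ => if i = 0 then 1 else i + 2
  | d i _ => 2 - i
  | _ => 0

end Vert

open Vert

variable {r m : ℕ}

theorem Arr.reaches {x y : Vert r m} (f : Arr r m x y) : x.Reaches y := by
  cases f <;> simp [Reaches]

theorem Arr.height_lt {x y : Vert r m} (f : Arr r m x y) (h : x ≠ y) : y.height < x.height := by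
  cases f <;> simp [height] at h ⊢ <;> grind

theorem Vert.Reaches.height_le {x y : Vert r m} (h : x.Reaches y) :
    x.height ≤ y.height + 3 := by
  cases x <;> cases y <;> simp only [Reaches, height] at h ⊢ <;> grind

/-- A path is initial if it is an initial subpath of a branch. -/
def IsInitial {x y : Vert r m} (p : Quiver.Path x y) : Prop :=
  ∃ (z : Vert r m) (s : Quiver.Path y z), Branch r m (p.comp s)

theorem Branch.isInitial {x y : Vert r m} {p : Quiver.Path x y} (h : Branch r m p) :
    IsInitial p := ⟨_, .nil, h⟩

theorem IsInitial.of_comp {x y z : Vert r m} {p : Quiver.Path x y} {s : Quiver.Path y z}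
    (h : IsInitial (p.comp s)) : IsInitial p := by
  obtain ⟨t, q, ht⟩ := h
  exact ⟨t, s.comp q, by rwa [← Quiver.Path.comp_assoc]⟩

/-- A path of three arrows is initial as soon as its ends are related by `Reaches`, and then so are
the ends of its subpaths. -/
theorem Arr.isInitial_comp_comp {x y z t : Vert r m} (f : Arr r m x y) (g : Arr r m y z)
    (k : Arr r m z t) (hf : x ≠ y) (hg : y ≠ z) (hk : z ≠ t) (h : x.Reaches t) :
    IsInitial ((f.path.comp g.path).comp k.path) ∧ x.Reaches z ∧ y.Reaches t := by
  cases f <;> cases g <;> cases k <;> simp [Reaches] at hf hg hk h ⊢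
  case δ.δ.δ => omega
  case α.α.α => omega
  case α.α2'.γ2 h1 h2 h3 => exact (Branch.left (.a3 h2)).isInitial
  case β.β.β => omega
  case γ1.α0.γ0 h1 => exact (Branch.c1 h1).isInitial
  case α2'.γ2.γ1 h1 h2 h3 => exact (Branch.right (.a2 h1)).isInitial
  case γ2.γ1.α0 h1 h2 => exact (Branch.right (.c2 h1)).isInitial
  case β'.α.α2' h1 h2 h3 => exact (Branch.right (.b4 h2)).isInitial

theorem Arr.isInitial_comp {x y z : Vert r m} (f : Arr r m x y) (g : Arr r m y z)
    (hf : x ≠ y) (hg : y ≠ z) (h : x.Reaches z) : IsInitial (f.path.comp g.path) := by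
  cases f <;> cases g <;> simp [Reaches] at hf hg h
  case δ.δ => omega
  case α0.γ0 => exact (Branch.a0).isInitial
  case α.α0' h1 => exact (Branch.a1 h1).isInitial
  case α.α i h1 h2 =>
    obtain rfl : i = 0 := by omega
    exact (Branch.left (.a2 h2)).isInitial
  case α.α2' h1 h2 => exact IsInitial.of_comp (Branch.left (.a3 h2)).isInitial
  case α.α' i h1 h2 => exact (Branch.left (.a i h2)).isInitial
  case β.β0 h1 => exact (Branch.b1 h1).isInitial
  case β.β i h1 h2 =>
    obtain rfl | rfl : i = 0 ∨ i = 1 := by omega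
    · exact (Branch.right (.b2 h2)).isInitial
    · exact (Branch.left (.b3 h2)).isInitial
  case β.β3' h1 h2 => exact (Branch.left (.b4 h2)).isInitial
  case β.β' i h1 h2 => exact (Branch.left (.b i h2)).isInitial
  case β1'.γ0' h1 => exact (Branch.b1' h1).isInitial
  case γ1.α0 h1 => exact IsInitial.of_comp (Branch.c1 h1).isInitial
  case γ1'.β0' h1 => exact (Branch.c1' h1).isInitial
  case α2'.γ2 h1 h2 => exact IsInitial.of_comp (Branch.right (.a2 h2)).isInitial
  case β2'.γ1' h1 h2 => exact (Branch.left (.b2 h1)).isInitial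
  case γ2.γ1 h1 h2 => exact IsInitial.of_comp (Branch.right (.c2 h1)).isInitial
  case γ2'.β1' h1 h2 => exact (Branch.left (.c2 h1)).isInitial
  case β3'.γ2' h1 h2 => exact (Branch.right (.b3 h1)).isInitial
  case α'.β i h1 h2 =>
    obtain ⟨i, rfl⟩ : ∃ j, i = j + 1 := ⟨i - 1, by omega⟩
    exact (Branch.right (.a i h1)).isInitial
  case α'.β2' h1 h2 => exact (Branch.right (.a3 h2)).isInitial
  case β'.α i h1 h2 =>
    obtain rfl | ⟨i, rfl⟩ : i = 0 ∨ ∃ j, i = j + 1 := by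
      rcases i with _ | i
      · exact .inl rfl
      · exact .inr ⟨i, rfl⟩
    · exact IsInitial.of_comp (Branch.right (.b4 h1)).isInitial
    · exact (Branch.right (.b i h1)).isInitial

theorem Arr.isInitial {x y : Vert r m} (f : Arr r m x y) : IsInitial f.path := by
  cases f with
  | loopU => exact Branch.loopU.isInitial
  | loopV => exact Branch.loopV.isInitial
  | loopW => exact Branch.loopW.isInitial
  | loopB => exact Branch.loopB.isInitial
  | loopC => exact Branch.loopC.isInitial
  | δ i h => exact (Branch.d i h).isInitial
  | α0 => exact IsInitial.of_comp Branch.a0.isInitial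
  | α0' => exact Branch.a0'.isInitial
  | β0 => exact Branch.b0.isInitial
  | β0' => exact Branch.b0'.isInitial
  | γ0 => exact Branch.c0.isInitial
  | γ0' => exact Branch.c0'.isInitial
  | α i h =>
    obtain rfl | rfl | rfl | ⟨i, rfl⟩ : i = 0 ∨ i = 1 ∨ i = 2 ∨ ∃ j, i = j + 3 := by
      by_cases h0 : i < 3
      · omega
      · exact .inr (.inr (.inr ⟨i - 3, by omega⟩))
    · exact IsInitial.of_comp (Branch.a1 h).isInitial
    · exact IsInitial.of_comp (Branch.left (.a2 h)).isInitial
    · exact IsInitial.of_comp (IsInitial.of_comp (Branch.left (.a3 h)).isInitial)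
    · exact IsInitial.of_comp (Branch.left (.a i h)).isInitial
  | β i h =>
    obtain rfl | rfl | rfl | rfl | ⟨i, rfl⟩ :
        i = 0 ∨ i = 1 ∨ i = 2 ∨ i = 3 ∨ ∃ j, i = j + 4 := by
      by_cases h0 : i < 4
      · omega
      · exact .inr (.inr (.inr (.inr ⟨i - 4, by omega⟩)))
    · exact IsInitial.of_comp (Branch.b1 h).isInitial
    · exact IsInitial.of_comp (Branch.right (.b2 h)).isInitial
    · exact IsInitial.of_comp (Branch.left (.b3 h)).isInitial
    · exact IsInitial.of_comp (Branch.left (.b4 h)).isInitial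
    · exact IsInitial.of_comp (Branch.left (.b i h)).isInitial
  | α1' h => exact (Branch.a1' h).isInitial
  | β1' h => exact IsInitial.of_comp (Branch.b1' h).isInitial
  | γ1 h => exact IsInitial.of_comp (IsInitial.of_comp (Branch.c1 h).isInitial)
  | γ1' h => exact IsInitial.of_comp (Branch.c1' h).isInitial
  | α2' h => exact IsInitial.of_comp (IsInitial.of_comp (Branch.right (.a2 h)).isInitial)
  | β2' h => exact IsInitial.of_comp (Branch.left (.b2 h)).isInitial
  | γ2 h => exact IsInitial.of_comp (IsInitial.of_comp (Branch.right (.c2 h)).isInitial)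
  | γ2' h => exact IsInitial.of_comp (Branch.left (.c2 h)).isInitial
  | β3' h => exact IsInitial.of_comp (Branch.right (.b3 h)).isInitial
  | α' i h =>
    obtain rfl | ⟨i, rfl⟩ : i = 0 ∨ ∃ j, i = j + 1 := by
      rcases i with _ | i
      · exact .inl rfl
      · exact .inr ⟨i, rfl⟩
    · exact IsInitial.of_comp (Branch.right (.a3 h)).isInitial
    · exact IsInitial.of_comp (Branch.right (.a i h)).isInitial
  | β' i h =>
    obtain rfl | ⟨i, rfl⟩ : i = 0 ∨ ∃ j, i = j + 1 := by
      rcases i with _ | i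
      · exact .inl rfl
      · exact .inr ⟨i, rfl⟩
    · exact IsInitial.of_comp (IsInitial.of_comp (Branch.right (.b4 h)).isInitial)
    · exact IsInitial.of_comp (Branch.right (.b i h)).isInitial

/-- A path is loop-free if none of its arrows is a loop. -/
def LoopFree {x : Vert r m} : ∀ {y : Vert r m}, Quiver.Path x y → Prop
  | _, .nil => True
  | _, .cons (b := y) (c := z) p _ => LoopFree p ∧ y ≠ z

theorem loopFree_comp {x y z : Vert r m} (p : Quiver.Path x y) (q : Quiver.Path y z) :
    LoopFree (p.comp q) ↔ LoopFree p ∧ LoopFree q := by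
  induction q with
  | nil => simp [LoopFree]
  | cons q f ih => simp [LoopFree, ih, and_assoc]

theorem Arr.loopFree_path {x y : Vert r m} (f : Arr r m x y) : LoopFree f.path ↔ x ≠ y := by
  simp [Arr.path, Quiver.Hom.toPath, LoopFree]

theorem LoopFree.height_add_length_le {x y : Vert r m} {p : Quiver.Path x y} (h : LoopFree p) :
    y.height + p.length ≤ x.height := by
  induction p with
  | nil => simp
  | cons p f ih =>
    have := ih h.1
    have := Arr.height_lt f h.2
    simp only [Quiver.Path.length_cons]
    push_cast
    omega

theorem LoopFree.length_le {x y : Vert r m} {p : Quiver.Path x y} (h : LoopFree p)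
    (hxy : x.Reaches y) : p.length ≤ 3 := by
  have := h.height_add_length_le
  have := hxy.height_le
  omega

theorem LoopFree.reaches_of_cons {x y z : Vert r m} {p : Quiver.Path x y} {f : y ⟶ z}
    (h : LoopFree (p.cons f)) (hxz : x.Reaches z) : x.Reaches y := by
  have hl := h.length_le hxz
  match p, h with
  | .nil, _ => exact .refl _
  | .cons .nil g, _ => exact Arr.reaches g
  | .cons (.cons .nil g) k, h => exact (Arr.isInitial_comp_comp g k f h.1.1.2 h.1.2 h.2 hxz).2.1
  | .cons (.cons (.cons p' g') g) k, h => simp at hl; omega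

theorem LoopFree.reaches_of_arrow_comp {x y z : Vert r m} {f : Arr r m x y}
    {p : Quiver.Path y z} (hf : x ≠ y) (h : LoopFree p) (hxz : x.Reaches z) : y.Reaches z := by
  have hl := LoopFree.length_le ((loopFree_comp _ p).2 ⟨f.loopFree_path.2 hf, h⟩) hxz
  match p, h with
  | .nil, _ => exact .refl _
  | .cons .nil g, _ => exact Arr.reaches g
  | .cons (.cons .nil g) k, h => exact (Arr.isInitial_comp_comp f g k hf h.1.2 h.2 hxz).2.2
  | .cons (.cons (.cons p' g') g) k, h => simp [Arr.path] at hl; omega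

theorem LoopFree.reaches_left {x y z : Vert r m} {p : Quiver.Path x y} {q : Quiver.Path y z}
    (h : LoopFree (p.comp q)) (hxz : x.Reaches z) : x.Reaches y := by
  induction q with
  | nil => exact hxz
  | cons q f ih => exact ih h.1 (LoopFree.reaches_of_cons h hxz)

theorem LoopFree.reaches_right {x y z : Vert r m} {p : Quiver.Path x y} {q : Quiver.Path y z}
    (h : LoopFree (p.comp q)) (hxz : x.Reaches z) : y.Reaches z := by
  induction p with
  | nil => exact hxz
  | @cons y t p f ih =>
    have h' := (loopFree_comp _ _).1 h
    refine LoopFree.reaches_of_arrow_comp (f := f) h'.1.2 h'.2 (ih (q := (Arr.path f).comp q) ?_)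
    rw [loopFree_comp, loopFree_comp, Arr.loopFree_path]
    exact ⟨h'.1.1, h'.1.2, h'.2⟩

/-- The loop-free paths between vertices related by `Reaches` survive the monomial relations. -/
theorem LoopFree.isInitial {x y : Vert r m} {p : Quiver.Path x y} (h : LoopFree p)
    (hxy : x.Reaches y) (hp : 0 < p.length) : IsInitial p := by
  have hl := h.length_le hxy
  match p, h with
  | .cons .nil g, _ => exact Arr.isInitial g
  | .cons (.cons .nil f) g, h => exact Arr.isInitial_comp f g h.1.2 h.2 hxy
  | .cons (.cons (.cons .nil f) g) k, h =>
    exact (Arr.isInitial_comp_comp f g k h.1.1.2 h.1.2 h.2 hxy).1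
  | .cons (.cons (.cons (.cons p' g') f) g) k, h => simp at hl; omega

theorem Binomial.loopFree {x y : Vert r m} {p q : Quiver.Path x y} (h : Binomial r m p q) :
    LoopFree p ∧ LoopFree q ∧ x.Reaches y ∧ p.length ≠ 1 ∧ q.length ≠ 1 := by
  cases h <;> simp [LoopFree, Arr.path, Quiver.Hom.toPath, Reaches]

theorem Branch.loopFree_or {x y : Vert r m} {p : Quiver.Path x y} (h : Branch r m p) :
    (LoopFree p ∧ x.Reaches y) ∨ p.length = 1 := by
  cases h with
  | left h => exact .inl ⟨h.loopFree.1, h.loopFree.2.2.1⟩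
  | right h => exact .inl ⟨h.loopFree.2.1, h.loopFree.2.2.1⟩
  | _ => simp [LoopFree, Arr.path, Quiver.Hom.toPath, Reaches]

/-- All longer paths other than those of `LoopFree.isInitial` are killed by the monomial
relations. -/
theorem IsInitial.loopFree_or {x y : Vert r m} {p : Quiver.Path x y} (h : IsInitial p) :
    (LoopFree p ∧ x.Reaches y) ∨ p.length ≤ 1 := by
  obtain ⟨z, s, hs⟩ := h
  rcases hs.loopFree_or with h | h
  · exact .inl ⟨((loopFree_comp _ _).1 h.1).1, h.1.reaches_left h.2⟩
  · rw [Quiver.Path.length_comp] at h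
    exact .inr (by omega)

end

/-! ### A basis of the algebra -/

section

open Vert

variable {r m : ℕ}

/-- Two different arrows into `y` through which nonzero paths from `x` to `y` factor are the last
arrows of the two paths in a binomial relation. -/
theorem Arr.eq_or_binomial {x s t y : Vert r m} (f : Arr r m s y) (g : Arr r m t y)
    (hs : s ≠ y) (ht : t ≠ y) (hxs : x.Reaches s) (hxt : x.Reaches t) (hxy : x.Reaches y) :
    (s = t ∧ HEq f g) ∨ ∃ (p : Quiver.Path x s) (q : Quiver.Path x t),
      Binomial r m (p.cons f) (q.cons g) ∨ Binomial r m (q.cons g) (p.cons f) := by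
  cases f <;> cases g <;> first | exact .inl ⟨rfl, HEq.rfl⟩ | skip
  all_goals cases x <;> simp [Reaches] at hs ht hxs hxt hxy
  all_goals try omega
  all_goals right
  case α0.β1'.c h i _ _ =>
    obtain rfl : i = 2 := by omega
    exact ⟨_, _, .inr (.c2 (show 2 ≤ m by omega))⟩
  case α.γ1.a _ _ i _ =>
    obtain rfl : i = 2 := by omega
    exact ⟨_, _, .inl (.a2 (by omega))⟩
  case α.β'.b i _ _ j _ =>
    obtain rfl : j = i + 5 := by omega
    exact ⟨_, _, .inr (.b _ (by omega))⟩
  case β.γ1'.b _ _ i _ =>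
    obtain rfl : i = 2 := by omega
    exact ⟨_, _, .inr (.b2 (by omega))⟩
  case β.γ2'.b _ _ i _ =>
    obtain rfl : i = 3 := by omega
    exact ⟨_, _, .inl (.b3 (by omega))⟩
  case β.α'.a i _ _ j _ =>
    obtain rfl : j = i + 4 := by omega
    exact ⟨_, _, .inr (.a _ (by omega))⟩
  case β1'.α0.c h i _ _ =>
    obtain rfl : i = 2 := by omega
    exact ⟨_, _, .inl (.c2 (show 2 ≤ m by omega))⟩
  case γ1.α.a _ _ i _ =>
    obtain rfl : i = 2 := by omega
    exact ⟨_, _, .inr (.a2 (by omega))⟩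
  case γ1'.β.b _ _ i _ =>
    obtain rfl : i = 2 := by omega
    exact ⟨_, _, .inl (.b2 (by omega))⟩
  case α2'.β3'.b _ _ i _ =>
    obtain rfl : i = 4 := by omega
    exact ⟨_, _, .inr (.b4 (by omega))⟩
  case β2'.γ2.a _ _ i _ =>
    obtain rfl : i = 3 := by omega
    exact ⟨_, _, .inr (.a3 (by omega))⟩
  case γ2.β2'.a _ _ i _ =>
    obtain rfl : i = 3 := by omega
    exact ⟨_, _, .inl (.a3 (by omega))⟩
  case γ2'.β.b _ _ i _ =>
    obtain rfl : i = 3 := by omega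
    exact ⟨_, _, .inr (.b3 (by omega))⟩
  case β3'.α2'.b _ _ i _ =>
    obtain rfl : i = 4 := by omega
    exact ⟨_, _, .inl (.b4 (by omega))⟩
  case α'.β.a i _ _ j _ =>
    obtain rfl : j = i + 4 := by omega
    exact ⟨_, _, .inl (.a _ (by omega))⟩
  case β'.α.b i _ _ j _ =>
    obtain rfl : j = i + 5 := by omega
    exact ⟨_, _, .inl (.b _ (by omega))⟩

theorem Arr.exists_loopFree {x y : Vert r m} (f : Arr r m x y) (h : x ≠ y) :
    ∃ p : Quiver.Path x y, LoopFree p := ⟨f.path, f.loopFree_path.2 h⟩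

theorem Arr.exists_loopFree_comp {x y z : Vert r m} (f : Arr r m x y) (g : Arr r m y z)
    (hf : x ≠ y) (hg : y ≠ z) : ∃ p : Quiver.Path x z, LoopFree p :=
  ⟨f.path.comp g.path, (loopFree_comp _ _).2 ⟨f.loopFree_path.2 hf, g.loopFree_path.2 hg⟩⟩

theorem Vert.Reaches.exists_loopFree {x y : Vert r m} (h : x.Reaches y) :
    ∃ p : Quiver.Path x y, LoopFree p := by
  cases x <;> cases y <;> simp only [Reaches] at h
  all_goals first | exact ⟨.nil, trivial⟩ | skip
  case a.a i hi j hj =>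
    obtain rfl | rfl | ⟨rfl, rfl⟩ := h
    · exact ⟨.nil, trivial⟩
    · exact (Arr.α j hi).exists_loopFree (by simp)
    · exact (Arr.α 1 hi).exists_loopFree_comp (Arr.α 0 (by omega)) (by simp) (by simp)
  case a.b i hi j hj =>
    obtain ⟨j, rfl⟩ : ∃ k, j = k + 2 := ⟨j - 2, by omega⟩
    obtain ⟨_, rfl⟩ | ⟨_, rfl⟩ := h
    · exact (Arr.α' j hi).exists_loopFree (by simp)
    · exact (Arr.α (j + 3) hi).exists_loopFree_comp (Arr.α' j (by omega)) (by simp) (by simp)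
  case a.c i hi j hj _ =>
    obtain ⟨rfl, rfl⟩ | ⟨rfl | rfl, rfl | rfl⟩ := h
    · exact Arr.α0.exists_loopFree (by simp)
    · exact (Arr.α2' hi).exists_loopFree_comp (Arr.γ2 hi) (by simp) (by simp)
    · exact (Arr.α2' hi).exists_loopFree (by simp)
    · exact (Arr.α' 0 hi).exists_loopFree_comp (Arr.β2' (by omega)) (by simp) (by simp)
    · exact (Arr.α 2 hi).exists_loopFree_comp (Arr.α2' (by omega)) (by simp) (by simp)
  case a.cneg i hi =>
    obtain rfl := h
    exact Arr.α0.exists_loopFree_comp Arr.γ0 (by simp) (by simp)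
  case a.u i hi =>
    obtain rfl | rfl : i = 0 ∨ i = 1 := by omega
    · exact Arr.α0'.exists_loopFree (by simp)
    · exact (Arr.α 0 hi).exists_loopFree_comp Arr.α0' (by simp) (by simp)
  case a.d i hi j hj =>
    obtain ⟨rfl, rfl⟩ := h
    exact (Arr.α1' hi).exists_loopFree (by simp)
  case b.a i hi j hj =>
    obtain ⟨h4, rfl | rfl⟩ := h
    · obtain ⟨j, rfl⟩ : ∃ k, j = k + 3 := ⟨j - 3, by omega⟩
      exact (Arr.β' j hi).exists_loopFree (by simp)
    · obtain ⟨j, rfl⟩ : ∃ k, j = k + 2 := ⟨j - 2, by omega⟩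
      exact (Arr.β' j hi).exists_loopFree_comp (Arr.α (j + 2) (by omega)) (by simp) (by simp)
  case b.b i hi j hj =>
    obtain rfl | rfl | ⟨rfl, rfl⟩ | ⟨rfl, rfl⟩ := h
    · exact ⟨.nil, trivial⟩
    · exact (Arr.β j hi).exists_loopFree (by simp)
    · exact (Arr.β 1 hi).exists_loopFree_comp (Arr.β 0 (by omega)) (by simp) (by simp)
    · exact (Arr.β 2 hi).exists_loopFree_comp (Arr.β 1 (by omega)) (by simp) (by simp)
  case b.c i hi j hj _ =>
    obtain ⟨rfl, rfl⟩ | ⟨rfl, rfl⟩ | ⟨rfl | rfl, rfl⟩ := h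
    · exact (Arr.β1' hi).exists_loopFree (by simp)
    · exact (Arr.β2' hi).exists_loopFree (by simp)
    · exact (Arr.β3' hi).exists_loopFree (by simp)
    · exact (Arr.β 3 hi).exists_loopFree_comp (Arr.β3' (by omega)) (by simp) (by simp)
  case b.bneg i hi =>
    obtain rfl | rfl : i = 0 ∨ i = 1 := by omega
    · exact Arr.β0.exists_loopFree (by simp)
    · exact (Arr.β 0 hi).exists_loopFree_comp Arr.β0 (by simp) (by simp)
  case b.v i hi =>
    obtain rfl := h
    exact Arr.β0'.exists_loopFree (by simp)
  case b.w i hi =>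
    obtain rfl := h
    exact (Arr.β1' hi).exists_loopFree_comp Arr.γ0' (by simp) (by simp)
  case c.a i hi _ j hj =>
    obtain ⟨h1, rfl⟩ := h
    obtain rfl | rfl : i = 1 ∨ i = 2 := by omega
    · exact (Arr.γ1 hi).exists_loopFree (by simp)
    · exact (Arr.γ2 hi).exists_loopFree_comp (Arr.γ1 (by omega)) (by simp) (by simp)
  case c.b i hi _ j hj =>
    obtain ⟨h1, rfl⟩ := h
    obtain rfl | rfl : j = 0 ∨ j = 1 := by omega
    · exact (Arr.γ1' hi).exists_loopFree (by simp)
    · exact (Arr.γ2' hi).exists_loopFree (by simp)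
  case c.c i hi _ j hj _ =>
    obtain rfl | hlt := h.eq_or_lt
    · exact ⟨.nil, trivial⟩
    obtain ⟨rfl, rfl⟩ | ⟨rfl, rfl⟩ | ⟨rfl, rfl⟩ :
        (i = 1 ∧ j = 0) ∨ (i = 2 ∧ j = 0) ∨ (i = 2 ∧ j = 1) := by omega
    · exact (Arr.γ1 hi).exists_loopFree_comp Arr.α0 (by simp) (by simp)
    · exact (Arr.γ2' hi).exists_loopFree_comp (Arr.β1' (by omega)) (by simp) (by simp)
    · exact (Arr.γ2 hi).exists_loopFree (by simp)
  case c.cneg i hi _ =>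
    obtain rfl | rfl : i = 0 ∨ i = 1 := by omega
    · exact Arr.γ0.exists_loopFree (by simp)
    · obtain ⟨p, hp⟩ := (Arr.γ1 hi).exists_loopFree_comp Arr.α0 (by simp) (by simp)
      exact ⟨p.comp Arr.γ0.path, (loopFree_comp _ _).2 ⟨hp, Arr.γ0.loopFree_path.2 (by simp)⟩⟩
  case c.v i hi _ =>
    obtain rfl := h
    exact (Arr.γ1' hi).exists_loopFree_comp Arr.β0' (by simp) (by simp)
  case c.w i hi _ =>
    obtain rfl := h
    exact Arr.γ0'.exists_loopFree (by simp)
  case d.d i hi j hj =>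
    obtain rfl | rfl := h
    · exact ⟨.nil, trivial⟩
    · exact (Arr.δ i hj).exists_loopFree (by simp)

/-- A linear functional on an algebra that respects the two-sided ideal generated by a relation
induces a functional on the quotient ring. -/
theorem RingQuot.exists_linearMap {K A : Type*} [Field K] [Ring A] [Algebra K A]
    {s : A → A → Prop} (c : A →ₗ[K] K)
    (h : ∀ a b, s a b → ∀ u v, c (u * a * v) = c (u * b * v)) :
    ∃ c' : RingQuot s →ₗ[K] K, ∀ a, c' (RingQuot.mkRingHom s a) = c a := by
  have hrel : ∀ a b, RingQuot.Rel s a b → ∀ u v, c (u * a * v) = c (u * b * v) := by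
    intro a b hab
    induction hab with
    | of hab => exact h _ _ hab
    | add_left _ ih => intro u v; simp only [mul_add, add_mul, map_add, ih]
    | mul_left _ ih =>
      intro u v
      simpa only [mul_assoc] using ih u (_ * v)
    | mul_right _ ih =>
      intro u v
      simpa only [mul_assoc] using ih (u * _) v
  let c' : RingQuot s → K := fun x => Quot.lift c
    (fun a b hab => by simpa using hrel a b hab 1 1) x.toQuot
  have hc' : ∀ a, c' (RingQuot.mkAlgHom K s a) = c a := by
    intro a
    simp only [RingQuot.mkAlgHom_def, RingQuot.mkRingHom_def]
    rfl
  refine ⟨{ toFun := c', map_add' := ?_, map_smul' := ?_ }, ?_⟩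
  · intro x y
    obtain ⟨a, rfl⟩ := RingQuot.mkAlgHom_surjective K s x
    obtain ⟨b, rfl⟩ := RingQuot.mkAlgHom_surjective K s y
    rw [← map_add, hc', hc', hc', map_add]
  · intro k x
    obtain ⟨a, rfl⟩ := RingQuot.mkAlgHom_surjective K s x
    rw [← map_smul, hc', hc', map_smul, RingHom.id_apply]
  · intro a
    rw [← RingQuot.mkAlgHom_coe K s]
    exact hc' a

namespace Lam

variable (K : Type u) [Field K]

theorem path_nil (x : Vert r m) : path K (.nil : Quiver.Path x x) = e K x := rfl

theorem path_comp {x y z : Vert r m} (p : Quiver.Path x y) (q : Quiver.Path y z) :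
    path K (p.comp q) = path K q * path K p := by
  rw [path, path, path, ← map_mul, PathAlgebra.mul_def, PathAlgebra.mulLin_ofPath]

theorem path_cons {x y z : Vert r m} (p : Quiver.Path x y) (f : Arr r m y z) :
    path K (p.cons f) = path K f.path * path K p := path_comp K p f.path

theorem path_mul_path_of_ne {x y y' z : Vert r m} (p : Quiver.Path x y) (q : Quiver.Path y' z)
    (h : y' ≠ y) : path K q * path K p = 0 := by
  rw [path, path, ← map_mul, PathAlgebra.mul_def, PathAlgebra.mulLin_ofPath_ne K _ _ h, map_zero]

theorem path_eq_of_binomial {x y : Vert r m} {p q : Quiver.Path x y} (h : Binomial r m p q) :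
    path K p = path K q := RingQuot.mkRingHom_rel (.binomial h)

theorem path_eq_zero {x y : Vert r m} {p : Quiver.Path x y}
    (h : ¬ (LoopFree p ∧ x.Reaches y)) (h1 : p.length ≠ 1) : path K p = 0 := by
  have hp : 0 < p.length := by
    rcases p with _ | _
    · exact absurd ⟨trivial, .refl _⟩ h
    · simp
  rw [path, RingQuot.mkRingHom_rel (Relation.monomial p hp ?_), map_zero]
  intro z s hs
  rcases IsInitial.loopFree_or (p := p) ⟨z, s, hs⟩ with h' | h'
  · exact h h'
  · omega

/-- Parallel loop-free paths agree in `Λ_m` as soon as they are not excluded by `Reaches`. -/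
theorem path_eq_path {x y : Vert r m} {p q : Quiver.Path x y} (hp : LoopFree p) (hq : LoopFree q)
    (hxy : x.Reaches y) : path K p = path K q := by
  -- Induction on the drop in height: if the last arrows differ, they are the last arrows of the two
  -- paths in a binomial relation, to which `p` and `q` are equal by induction.
  suffices H : ∀ (n : ℕ) (y : Vert r m) (p q : Quiver.Path x y), LoopFree p → LoopFree q →
      x.Reaches y → x.height ≤ y.height + n → path K p = path K q from
    H 3 y p q hp hq hxy hxy.height_le
  clear hp hq hxy p q y
  intro n
  induction n with
  | zero =>
    intro y p q hp hq hxy hn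
    have hp' := hp.height_add_length_le
    have hq' := hq.height_add_length_le
    cases p with
    | nil =>
      cases q with
      | nil => rfl
      | cons q f => simp at hq'; omega
    | cons p f => simp at hp' hn; omega
  | succ n ih =>
    intro y p q hp hq hxy hn
    cases p with
    | nil =>
      have hq' := hq.height_add_length_le
      cases q with
      | nil => rfl
      | cons q f => simp at hq'; omega
    | @cons s _ p f =>
      cases q with
      | nil =>
        have hp' := hp.height_add_length_le
        simp at hp'
        omega
      | @cons t _ q g =>
        have hxs := hp.reaches_of_cons hxy
        have hxt := hq.reaches_of_cons hxy
        have hsy := Arr.height_lt f hp.2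
        have hty := Arr.height_lt g hq.2
        rw [path_cons, path_cons]
        obtain ⟨rfl, h⟩ | ⟨p₀, q₀, h⟩ := Arr.eq_or_binomial f g hp.2 hq.2 hxs hxt hxy
        · obtain rfl := eq_of_heq h
          rw [ih s p q hp.1 hq.1 hxs (by push_cast at hn; omega)]
        · have hl : LoopFree p₀ ∧ LoopFree q₀ := by
            rcases h with h | h
            · exact ⟨h.loopFree.1.1, h.loopFree.2.1.1⟩
            · exact ⟨h.loopFree.2.1.1, h.loopFree.1.1⟩
          rw [ih s p p₀ hp.1 hl.1 hxs (by push_cast at hn; omega),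
            ih t q q₀ hq.1 hl.2 hxt (by push_cast at hn; omega), ← path_cons, ← path_cons]
          rcases h with h | h
          · exact path_eq_of_binomial K h
          · exact (path_eq_of_binomial K h).symm

open Classical in
/-- The residue class of any loop-free path from `x` to `y`, or zero if these paths lie in `I_m`. -/
def arc (x y : Vert r m) : Lam K r m :=
  if h : x.Reaches y then path K h.exists_loopFree.choose else 0

variable {K}

theorem arc_of_not {x y : Vert r m} (h : ¬ x.Reaches y) : arc K x y = 0 := dif_neg h

theorem path_eq_arc {x y : Vert r m} {p : Quiver.Path x y} (hp : LoopFree p) :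
    path K p = arc K x y := by
  by_cases h : x.Reaches y
  · rw [arc, dif_pos h]
    exact path_eq_path K hp h.exists_loopFree.choose_spec h
  · rw [arc_of_not h]
    by_cases h1 : p.length = 1
    · exfalso
      match p, h1 with
      | .cons .nil f, _ => exact h (Arr.reaches f)
    · exact path_eq_zero K (fun h' => h h'.2) h1

theorem arc_self (x : Vert r m) : arc K x x = e K x := by
  exact (path_eq_arc (p := (.nil : Quiver.Path x x)) (by simp [LoopFree])).symm

theorem arc_mul_arc {x y z : Vert r m} (hxy : x.Reaches y) (hyz : y.Reaches z) :
    arc K y z * arc K x y = arc K x z := by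
  obtain ⟨p, hp⟩ := hxy.exists_loopFree
  obtain ⟨q, hq⟩ := hyz.exists_loopFree
  rw [← path_eq_arc hp, ← path_eq_arc hq, ← path_comp, path_eq_arc]
  exact (loopFree_comp _ _).2 ⟨hp, hq⟩

theorem arc_mul_arc_of_ne {x y y' z : Vert r m} (h : y' ≠ y) :
    arc K y' z * arc K x y = 0 := by
  by_cases hxy : x.Reaches y
  · by_cases hyz : y'.Reaches z
    · obtain ⟨p, hp⟩ := hxy.exists_loopFree
      obtain ⟨q, hq⟩ := hyz.exists_loopFree
      rw [← path_eq_arc hp, ← path_eq_arc hq, path_mul_path_of_ne K _ _ h]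
    · rw [arc_of_not hyz, zero_mul]
  · rw [arc_of_not hxy, mul_zero]

theorem path_arrow_eq_arc {x y : Vert r m} (f : Arr r m x y) (h : x ≠ y) :
    path K f.path = arc K x y := path_eq_arc (f.loopFree_path.2 h)

variable (K) in
/-- The residue class of the loop at `y`, or zero if there is none. -/
def loop : Vert r m → Lam K r m
  | .u => path K Arr.loopU.path
  | .v => path K Arr.loopV.path
  | .w => path K Arr.loopW.path
  | .bneg => path K Arr.loopB.path
  | .cneg => path K Arr.loopC.path
  | _ => 0

theorem path_arrow_eq_loop {x y : Vert r m} (f : Arr r m x y) (h : x = y) :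
    path K f.path = loop K y := by
  cases f <;> simp at h <;> rfl

theorem loop_eq_zero_or (y : Vert r m) :
    loop K y = 0 ∨ ∃ f : Arr r m y y, loop K y = path K f.path := by
  cases y <;> first | exact .inl rfl | exact .inr ⟨_, rfl⟩

theorem loop_mul_arc_of_ne {x y y' : Vert r m} (h : x ≠ y) : loop K y * arc K x y' = 0 := by
  by_cases hxy : x.Reaches y'
  · obtain h0 | ⟨f, hf⟩ := loop_eq_zero_or (K := K) y
    · rw [h0, zero_mul]
    · obtain ⟨p, hp⟩ := hxy.exists_loopFree
      rw [hf, ← path_eq_arc hp]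
      by_cases hy : y = y'
      · subst hy
        rw [← path_comp, path_eq_zero]
        · intro h'
          exact f.loopFree_path.1 ((loopFree_comp _ _).1 h'.1).2 rfl
        · have : p.length ≠ 0 := fun h0 => h (Quiver.Path.eq_of_length_zero p h0)
          simp [Arr.path, this]
      · exact path_mul_path_of_ne K _ _ hy
  · rw [arc_of_not hxy, mul_zero]

theorem arc_mul_loop_of_ne {y z : Vert r m} (h : y ≠ z) (y' : Vert r m) :
    arc K y' z * loop K y = 0 := by
  by_cases hyz : y'.Reaches z
  · obtain h0 | ⟨f, hf⟩ := loop_eq_zero_or (K := K) y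
    · rw [h0, mul_zero]
    · obtain ⟨p, hp⟩ := hyz.exists_loopFree
      rw [hf, ← path_eq_arc hp]
      by_cases hy : y' = y
      · subst hy
        rw [← path_comp, path_eq_zero]
        · intro h'
          exact f.loopFree_path.1 ((loopFree_comp _ _).1 h'.1).1 rfl
        · have : p.length ≠ 0 := fun h0 => h (Quiver.Path.eq_of_length_zero p h0)
          simp [Arr.path, this]
      · exact path_mul_path_of_ne K _ _ hy
  · rw [arc_of_not hyz, zero_mul]

theorem e_mul_loop (y : Vert r m) : e K y * loop K y = loop K y := by
  obtain h0 | ⟨f, hf⟩ := loop_eq_zero_or (K := K) y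
  · rw [h0, mul_zero]
  · rw [hf, ← path_nil, ← path_comp, Quiver.Path.comp_nil]

theorem loop_mul_e (y : Vert r m) : loop K y * e K y = loop K y := by
  obtain h0 | ⟨f, hf⟩ := loop_eq_zero_or (K := K) y
  · rw [h0, zero_mul]
  · rw [hf, ← path_nil, ← path_comp, Quiver.Path.nil_comp]

theorem loop_mul_loop (x y : Vert r m) : loop K x * loop K y = 0 := by
  obtain h0 | ⟨f, hf⟩ := loop_eq_zero_or (K := K) x
  · rw [h0, zero_mul]
  obtain h0 | ⟨g, hg⟩ := loop_eq_zero_or (K := K) y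
  · rw [h0, mul_zero]
  rw [hf, hg]
  by_cases hxy : x = y
  · subst hxy
    rw [← path_comp, path_eq_zero]
    · intro h'
      exact f.loopFree_path.1 ((loopFree_comp _ _).1 h'.1).2 rfl
    · simp [Arr.path]
  · exact path_mul_path_of_ne K _ _ hxy

/-- Every path represents some `arc x y`, some `loop y`, or zero. -/
theorem path_eq (K : Type u) [Field K] {x y : Vert r m} (p : Quiver.Path x y) :
    (LoopFree p ∧ x.Reaches y ∧ path K p = arc K x y) ∨
    (p.length = 1 ∧ x = y ∧ path K p = loop K y) ∨
    (¬ (LoopFree p ∧ x.Reaches y) ∧ p.length ≠ 1 ∧ path K p = 0) := by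
  by_cases h : LoopFree p ∧ x.Reaches y
  · exact .inl ⟨h.1, h.2, path_eq_arc h.1⟩
  by_cases h1 : p.length = 1
  · right; left
    match p, h1 with
    | .cons .nil f, _ =>
      have hxy : x = y := by
        by_contra hne
        exact h ⟨(Arr.loopFree_path f).2 hne, Arr.reaches f⟩
      exact ⟨rfl, hxy, path_arrow_eq_loop f hxy⟩
  · exact .inr (.inr ⟨h, h1, path_eq_zero K h h1⟩)

/-- A linear functional on the path algebra that counts the paths with a certain property induces
one on `Λ_m` if that property is insensitive to the two paths in a binomial relation and excludes
all paths with a subpath that is not an initial subpath of a branch. -/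
theorem exists_functional (P : ∀ {x y : Vert r m}, Quiver.Path x y → Prop)
    (hbin : ∀ {x y x' y' : Vert r m} (v : Quiver.Path x' x) (p q : Quiver.Path x y)
      (u : Quiver.Path y y'), Binomial r m p q →
      (P ((v.comp p).comp u) ↔ P ((v.comp q).comp u)))
    (hmon : ∀ {x y x' y' : Vert r m} (v : Quiver.Path x' x) (p : Quiver.Path x y)
      (u : Quiver.Path y y'), 0 < p.length → P ((v.comp p).comp u) → IsInitial p) :
    ∃ c : Lam K r m →ₗ[K] K, ∀ {x y : Vert r m} (p : Quiver.Path x y),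
      (P p → c (path K p) = 1) ∧ (¬ P p → c (path K p) = 0) := by
  classical
  let c : PathAlgebra K (Vert r m) →ₗ[K] K :=
    (PathAlgebra.basis K (Vert r m)).constr K fun s => if P s.2.2 then 1 else 0
  have hc : ∀ {x y : Vert r m} (p : Quiver.Path x y),
      c (PathAlgebra.ofPath K p) = if P p then 1 else 0 := fun p =>
    Module.Basis.constr_basis _ _ _ _
  suffices hrel : ∀ a b, Relation K r m a b → ∀ u v, c (u * a * v) = c (u * b * v) by
    obtain ⟨c', hc'⟩ := RingQuot.exists_linearMap c hrel
    refine ⟨c', fun p => ?_⟩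
    rw [path, hc', hc]
    exact ⟨fun h => if_pos h, fun h => if_neg h⟩
  intro a b hab
  suffices H : ∀ s t : QPath (Vert r m),
      c (PathAlgebra.ofPath K s.2.2 * a * PathAlgebra.ofPath K t.2.2) =
        c (PathAlgebra.ofPath K s.2.2 * b * PathAlgebra.ofPath K t.2.2) by
    have H1 : ∀ (s : QPath (Vert r m)) (v : PathAlgebra K (Vert r m)),
        c (PathAlgebra.ofPath K s.2.2 * a * v) = c (PathAlgebra.ofPath K s.2.2 * b * v) := by
      intro s v
      exact LinearMap.congr_fun
        (f := c ∘ₗ LinearMap.mulLeft K (PathAlgebra.ofPath K s.2.2 * a))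
        (g := c ∘ₗ LinearMap.mulLeft K (PathAlgebra.ofPath K s.2.2 * b))
        ((PathAlgebra.basis K _).ext fun t => H s t) v
    intro u v
    exact LinearMap.congr_fun
      (f := c ∘ₗ LinearMap.mulRight K v ∘ₗ LinearMap.mulRight K a)
      (g := c ∘ₗ LinearMap.mulRight K v ∘ₗ LinearMap.mulRight K b)
      ((PathAlgebra.basis K _).ext fun s => H1 s v) u
  rintro ⟨y', z, u⟩ ⟨t, x', v⟩
  have hmul : ∀ {x y : Vert r m} (p : Quiver.Path x y), c (PathAlgebra.ofPath K u *
      PathAlgebra.ofPath K p * PathAlgebra.ofPath K v) =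
      if h : x' = x ∧ y = y' then (if P ((v.comp (p.cast h.1.symm h.2)).comp u) then 1 else 0)
      else 0 := by
    intro x y p
    by_cases hx : x' = x
    · subst hx
      by_cases hy : y = y'
      · subst hy
        simp only [PathAlgebra.mul_def, PathAlgebra.mulLin_ofPath, hc, true_and, dite_true,
          Quiver.Path.cast_rfl_rfl, Quiver.Path.comp_assoc]
      · rw [dif_neg (fun h => hy h.2), PathAlgebra.mul_def K (PathAlgebra.ofPath K u),
          PathAlgebra.mulLin_ofPath_ne K _ _ (Ne.symm hy), zero_mul, map_zero]
    · rw [dif_neg (fun h => hx h.1), mul_assoc, PathAlgebra.mul_def K (PathAlgebra.ofPath K p),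
        PathAlgebra.mulLin_ofPath_ne K _ _ (Ne.symm hx), mul_zero, map_zero]
  cases hab with
  | @binomial x y p q h =>
    rw [hmul, hmul]
    split_ifs with h1 h2 h3 h3
    all_goals first | rfl | skip
    all_goals
      obtain ⟨rfl, rfl⟩ := h1
      simp only [Quiver.Path.cast_rfl_rfl] at h2 h3
      have := hbin v p q u h
      tauto
  | @monomial x y p hp h =>
    rw [hmul]
    simp only [mul_zero, zero_mul, map_zero]
    split_ifs with h1 h2
    · obtain ⟨rfl, rfl⟩ := h1
      simp only [Quiver.Path.cast_rfl_rfl] at h2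
      obtain ⟨z, s, hs⟩ := hmon v p u hp h2
      exact absurd hs (h z s)
    · rfl
    · rfl

theorem exists_coeff (K : Type u) [Field K] (x y : Vert r m) :
    ∃ c : Lam K r m →ₗ[K] K, ∀ {x' y' : Vert r m} (p : Quiver.Path x' y'),
      ((x' = x ∧ y' = y ∧ LoopFree p ∧ x.Reaches y) → c (path K p) = 1) ∧
      (¬ (x' = x ∧ y' = y ∧ LoopFree p ∧ x.Reaches y) → c (path K p) = 0) := by
  refine exists_functional (fun {x' y'} p => x' = x ∧ y' = y ∧ LoopFree p ∧ x.Reaches y) ?_ ?_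
  · intro x y x' y' v p q u h
    simp [loopFree_comp, h.loopFree.1, h.loopFree.2.1]
  · rintro x y x' y' v p u hp ⟨rfl, rfl, h, hxy⟩
    exact LoopFree.isInitial ((loopFree_comp _ _).1 ((loopFree_comp _ _).1 h).1).2
      (LoopFree.reaches_right ((loopFree_comp _ _).1 h).1 (h.reaches_left hxy)) hp

theorem exists_loopCoeff (K : Type u) [Field K] (y : Vert r m) :
    ∃ c : Lam K r m →ₗ[K] K, ∀ {x' y' : Vert r m} (p : Quiver.Path x' y'),
      ((x' = y ∧ y' = y ∧ p.length = 1) → c (path K p) = 1) ∧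
      (¬ (x' = y ∧ y' = y ∧ p.length = 1) → c (path K p) = 0) := by
  refine exists_functional (fun {x' y'} p => x' = y ∧ y' = y ∧ p.length = 1) ?_ ?_
  · intro x y x' y' v p q u h
    obtain ⟨h1, h2, h3, h4, h5⟩ := h.loopFree
    have hp : p.length ≠ 0 := by
      intro h0
      have := Quiver.Path.eq_of_length_zero p h0
      subst this
      cases h
    have hq : q.length ≠ 0 := by
      intro h0
      have := Quiver.Path.eq_of_length_zero q h0
      subst this
      cases h
    simp only [Quiver.Path.length_comp]
    constructor <;> rintro ⟨-, -, h⟩ <;> omega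
  · rintro x y x' y' v p u hp ⟨rfl, rfl, h⟩
    simp only [Quiver.Path.length_comp] at h
    have h1 : p.length = 1 := by omega
    match p, h1 with
    | .cons .nil f, _ => exact Arr.isInitial f

variable (K) in
/-- The coefficient at the basis element `arc x y`; it is zero if `arc x y` is zero. -/
def coeff (x y : Vert r m) : Lam K r m →ₗ[K] K := (exists_coeff K x y).choose

variable (K) in
/-- The coefficient at the basis element `loop y`; it is zero if there is no loop at `y`. -/
def loopCoeff (y : Vert r m) : Lam K r m →ₗ[K] K := (exists_loopCoeff K y).choose

theorem coeff_arc {x y : Vert r m} (h : x.Reaches y) : coeff K x y (arc K x y) = 1 := by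
  obtain ⟨p, hp⟩ := h.exists_loopFree
  rw [← path_eq_arc hp]
  exact ((exists_coeff K x y).choose_spec p).1 ⟨rfl, rfl, hp, h⟩

theorem coeff_arc_of_ne {x y x' y' : Vert r m} (h : x' ≠ x ∨ y' ≠ y) :
    coeff K x y (arc K x' y') = 0 := by
  by_cases hr : x'.Reaches y'
  · obtain ⟨p, hp⟩ := hr.exists_loopFree
    rw [← path_eq_arc hp]
    exact ((exists_coeff K x y).choose_spec p).2 (by tauto)
  · rw [arc_of_not hr, map_zero]

theorem coeff_loop (x y z : Vert r m) : coeff K x y (loop K z) = 0 := by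
  obtain h0 | ⟨f, hf⟩ := loop_eq_zero_or (K := K) z
  · rw [h0, map_zero]
  · rw [hf]
    refine ((exists_coeff K x y).choose_spec f.path).2 ?_
    rintro ⟨-, -, h, -⟩
    exact f.loopFree_path.1 h rfl

theorem loopCoeff_arc (x y z : Vert r m) : loopCoeff K z (arc K x y) = 0 := by
  by_cases hr : x.Reaches y
  · obtain ⟨p, hp⟩ := hr.exists_loopFree
    rw [← path_eq_arc hp]
    refine ((exists_loopCoeff K z).choose_spec p).2 ?_
    rintro ⟨rfl, rfl, h⟩
    have := hp.height_add_length_le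
    omega
  · rw [arc_of_not hr, map_zero]

theorem loopCoeff_loop {y z : Vert r m} (h : y ≠ z) : loopCoeff K z (loop K y) = 0 := by
  obtain h0 | ⟨f, hf⟩ := loop_eq_zero_or (K := K) y
  · rw [h0, map_zero]
  · rw [hf]
    exact ((exists_loopCoeff K z).choose_spec f.path).2 (by tauto)

theorem loopCoeff_loop_smul (y : Vert r m) : loopCoeff K y (loop K y) • loop K y = loop K y := by
  obtain h0 | ⟨f, hf⟩ := loop_eq_zero_or (K := K) y
  · rw [h0, smul_zero]
  · have : loopCoeff K y (path K f.path) = 1 :=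
      ((exists_loopCoeff K y).choose_spec f.path).1 ⟨rfl, rfl, rfl⟩
    rw [hf, this, one_smul]

/-- Induction over the elements of `Λ_m`, which are combinations of the classes `arc x y` and
`loop y`. -/
theorem induction_on {P : Lam K r m → Prop} (a : Lam K r m) (hadd : ∀ a b, P a → P b → P (a + b))
    (hsmul : ∀ (c : K) a, P a → P (c • a)) (harc : ∀ x y, P (arc K x y))
    (hloop : ∀ y, P (loop K y)) (hzero : P 0) : P a := by
  have hpath : ∀ {x y : Vert r m} (p : Quiver.Path x y), P (path K p) := by
    intro x y p
    obtain ⟨-, -, h⟩ | ⟨-, -, h⟩ | ⟨-, -, h⟩ := path_eq K p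
    · exact h ▸ harc x y
    · exact h ▸ hloop y
    · exact h ▸ hzero
  obtain ⟨b, rfl⟩ := RingQuot.mkAlgHom_surjective K (Relation K r m) a
  induction (PathAlgebra.basis K (Vert r m)).mem_span b using Submodule.span_induction with
  | zero => simpa using hzero
  | add a b _ _ ha hb => rw [map_add]; exact hadd _ _ ha hb
  | smul c a _ ha => rw [map_smul]; exact hsmul c _ ha
  | mem a h =>
    obtain ⟨s, rfl⟩ := h
    have := hpath s.2.2
    rw [path, ← RingQuot.mkAlgHom_coe K] at this
    exact this

theorem eq_sum (a : Lam K r m) :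
    a = ∑ x, ∑ y, coeff K x y a • arc K x y + ∑ y, loopCoeff K y a • loop K y := by
  classical
  induction a using induction_on with
  | hadd a b ha hb =>
    conv_lhs => rw [ha, hb]
    simp only [map_add, add_smul, Finset.sum_add_distrib]
    abel
  | hsmul c a ha =>
    conv_lhs => rw [ha]
    simp only [map_smul, smul_eq_mul, mul_smul, Finset.smul_sum, smul_add]
  | harc x y =>
    rw [Finset.sum_eq_single x, Finset.sum_eq_single y]
    · by_cases h : x.Reaches y
      · simp [coeff_arc h, loopCoeff_arc]
      · simp [arc_of_not h]
    · intro y' _ hy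
      rw [coeff_arc_of_ne (.inr hy.symm), zero_smul]
    · simp
    · intro x' _ hx
      exact Finset.sum_eq_zero fun y' _ => by rw [coeff_arc_of_ne (.inl hx.symm), zero_smul]
    · simp
  | hloop y =>
    rw [Finset.sum_eq_single (f := fun z => loopCoeff K z (loop K y) • loop K z) y]
    · simp [coeff_loop, loopCoeff_loop_smul]
    · intro z _ hz
      rw [loopCoeff_loop hz.symm, zero_smul]
    · simp
  | hzero => simp

end Lam

end

/-! ### Projective dimension and solutions of linear equations -/

section

open Vert

section Homological

variable (A : Type u) [Ring A]

/-- The `A`-module `N` has projective dimension less than `n`. -/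
abbrev PdLT (N : Type u) [AddCommGroup N] [Module A N] (n : ℕ) : Prop :=
  HasProjectiveDimensionLT (ModuleCat.of A N) n

variable {A} {N P : Type u} [AddCommGroup N] [Module A N] [AddCommGroup P] [Module A P]

theorem PdLT.mono {n n' : ℕ} (h : PdLT A N n) (hn : n ≤ n') : PdLT A N n' :=
  hasProjectiveDimensionLT_of_ge _ n n' hn

theorem pdLT_one_iff : PdLT A N 1 ↔ Module.Projective A N := by
  rw [IsProjective.iff_projective, projective_iff_hasProjectiveDimensionLT_one]

theorem PdLT.of_equiv (e : N ≃ₗ[A] P) {n : ℕ} (h : PdLT A N n) : PdLT A P n :=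
  hasProjectiveDimensionLT_of_iso (X := ModuleCat.of A N) (X' := ModuleCat.of A P) e.toModuleIso n

theorem pdLT_zero [Subsingleton N] : PdLT A N 0 :=
  (ModuleCat.isZero_of_subsingleton (ModuleCat.of A N)).hasProjectiveDimensionLT_zero

theorem pdLT_ker_iff [Module.Projective A P] {f : P →ₗ[A] N} (hf : Function.Surjective f) (n : ℕ) :
    PdLT A N (n + 2) ↔ PdLT A (LinearMap.ker f) (n + 1) :=
  (LinearMap.shortExact_shortComplexKer hf).hasProjectiveDimensionLT_X₃_iff n
    ((IsProjective.iff_projective P).1 inferInstance)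

theorem PdLT.of_ker [Module.Projective A P] {f : P →ₗ[A] N} (hf : Function.Surjective f) {n : ℕ}
    (h : PdLT A (LinearMap.ker f) n) : PdLT A N (n + 1) :=
  (LinearMap.shortExact_shortComplexKer hf).hasProjectiveDimensionLT_X₃ n h
    (PdLT.mono (pdLT_one_iff.2 inferInstance) (by omega))

theorem PdLT.of_quotient (S : Submodule A N) {n : ℕ} (h : PdLT A S n) (h' : PdLT A (N ⧸ S) n) :
    PdLT A N n := by
  have hs := LinearMap.shortExact_shortComplexKer (f := S.mkQ) S.mkQ_surjective
  refine hs.hasProjectiveDimensionLT_X₂ n ?_ h'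
  exact PdLT.of_equiv (LinearEquiv.ofEq _ _ S.ker_mkQ.symm) h

/-- In the module `N`, the solutions `x` of the equation `s x = 0` satisfy `e x ∈ ρ N + τ N`. In
applications `e` is an idempotent with `s e = s` and `e ρ = ρ`, `e τ = τ`. -/
def Resolves (N : Type u) [AddCommGroup N] [Module A N] (s e ρ τ : A) : Prop :=
  ∀ x : N, s • x = 0 → ∃ n n' : N, e • x = ρ • n + τ • n'

theorem Resolves.finsupp {s e ρ τ : A} (h : Resolves A s e ρ τ) (ι : Type u) :
    Resolves (ι →₀ A) s e ρ τ := by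
  classical
  intro F hF
  have hF' : ∀ i, s * F i = 0 := fun i => by simpa using DFunLike.congr_fun hF i
  choose n n' hn using fun i => h (F i) (hF' i)
  refine ⟨Finsupp.onFinset F.support (fun i => if F i = 0 then 0 else n i) ?_,
    Finsupp.onFinset F.support (fun i => if F i = 0 then 0 else n' i) ?_, ?_⟩
  · intro i hi
    by_contra h0
    simp_all
  · intro i hi
    by_contra h0
    simp_all
  · ext i
    simp only [Finsupp.smul_apply, Finsupp.add_apply, Finsupp.onFinset_apply]
    split_ifs with h0
    · simp [h0]
    · exact hn i

theorem Resolves.of_projective {s e ρ τ : A} (h : Resolves A s e ρ τ) [Module.Projective A N] :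
    Resolves N s e ρ τ := by
  obtain ⟨i, hi⟩ := Module.projective_def'.1 (inferInstance : Module.Projective A N)
  intro x hx
  obtain ⟨n, n', hn⟩ := h.finsupp N (i x) (by rw [← map_smul, hx, map_zero])
  have hi' : ∀ x, Finsupp.linearCombination A id (i x) = x := fun x => LinearMap.congr_fun hi x
  refine ⟨Finsupp.linearCombination A id n, Finsupp.linearCombination A id n', ?_⟩
  rw [← map_smul, ← map_smul, ← map_add, ← hn, map_smul, hi']

/-- Dimension shifting: a solution `x` of `ρ x = 0` in `N` is lifted to a free cover. There,
`ρ x` is a solution of `s y = 0` in the syzygy, and a correction of the lift by an element of the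
syzygy solves `ρ x = 0` in the free module. -/
theorem Resolves.of_syzygy {s e ρ τ e' κ κ' : A}
    (hN : Resolves (LinearMap.ker (Finsupp.linearCombination A (id : N → N))) s e ρ τ)
    (hs : s * ρ = 0) (he : e * ρ = ρ) (hρτ : ∀ a b : A, ρ * a = τ * b → ρ * a = 0)
    (hA : Resolves A ρ e' κ κ') : Resolves N ρ e' κ κ' := by
  intro x hx
  have h1 : ρ • Finsupp.single x (1 : A) ∈
      LinearMap.ker (Finsupp.linearCombination A (id : N → N)) := by
    rw [LinearMap.mem_ker, map_smul, Finsupp.linearCombination_single, one_smul, id, hx]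
  obtain ⟨n, n', hn⟩ := hN ⟨_, h1⟩ (by
    ext1
    simp only [Submodule.coe_smul, smul_smul, hs, zero_smul, Submodule.coe_zero])
  have hn' := congrArg Subtype.val hn
  simp only [Submodule.coe_smul, Submodule.coe_add, smul_smul, he] at hn'
  have h2 : ρ • (Finsupp.single x (1 : A) - n.1) = τ • n'.1 := by
    rw [smul_sub, hn', add_sub_cancel_left]
  have h3 : ρ • (Finsupp.single x (1 : A) - n.1) = 0 := by
    ext i
    exact hρτ _ _ (DFunLike.congr_fun h2 i)
  obtain ⟨k, k', hk⟩ := hA.finsupp N _ h3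
  have h4 := congrArg (Finsupp.linearCombination A (id : N → N)) hk
  rw [map_smul, map_sub, LinearMap.mem_ker.1 n.2, sub_zero, Finsupp.linearCombination_single,
    one_smul, map_add, map_smul, map_smul] at h4
  exact ⟨_, _, h4⟩

theorem PdLT.ker_linearCombination {n : ℕ} (h : PdLT A N (n + 2)) :
    PdLT A (LinearMap.ker (Finsupp.linearCombination A (id : N → N))) (n + 1) :=
  (pdLT_ker_iff (fun x => ⟨Finsupp.single x 1, by
    rw [Finsupp.linearCombination_single, one_smul, id]⟩) n).1 h

variable (A) in
/-- All `A`-modules of projective dimension less than `n` satisfy `Resolves`. -/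
def ResolvesLT (n : ℕ) (s e ρ τ : A) : Prop :=
  ∀ (N : Type u) [AddCommGroup N] [Module A N], PdLT A N n → Resolves N s e ρ τ

theorem ResolvesLT.one {s e ρ τ : A} (h : Resolves A s e ρ τ) : ResolvesLT A 1 s e ρ τ := by
  intro N _ _ hN
  have := pdLT_one_iff.1 hN
  exact h.of_projective

theorem ResolvesLT.succ {n : ℕ} {s e ρ τ e' κ κ' : A} (h : ResolvesLT A (n + 1) s e ρ τ)
    (hs : s * ρ = 0) (he : e * ρ = ρ) (hρτ : ∀ a b : A, ρ * a = τ * b → ρ * a = 0)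
    (hA : Resolves A ρ e' κ κ') : ResolvesLT A (n + 2) ρ e' κ κ' := by
  intro N _ _ hN
  exact Resolves.of_syzygy (h _ hN.ker_linearCombination) hs he hρτ hA

variable (A) in
/-- All `A`-modules of finite projective dimension satisfy `Resolves`. -/
def ResolvesFin (s e ρ τ : A) : Prop := ∀ n, ResolvesLT A (n + 1) s e ρ τ

theorem ResolvesFin.next {s e ρ τ e' κ κ' : A} (h : ResolvesFin A s e ρ τ)
    (hs : s * ρ = 0) (he : e * ρ = ρ) (hρτ : ∀ a b : A, ρ * a = τ * b → ρ * a = 0)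
    (hA : Resolves A ρ e' κ κ') : ResolvesFin A ρ e' κ κ' := by
  intro n N _ _ hN
  exact ((h n).succ hs he hρτ hA) N (hN.mono (by omega))

/-- Equations that reproduce themselves under dimension shifting. -/
theorem ResolvesFin.of_self {ρ e τ : A} (hs : ρ * ρ = 0) (he : e * ρ = ρ)
    (hρτ : ∀ a b : A, ρ * a = τ * b → ρ * a = 0) (hA : Resolves A ρ e ρ τ) :
    ResolvesFin A ρ e ρ τ := by
  intro n
  induction n with
  | zero => exact ResolvesLT.one hA
  | succ n ih => exact ih.succ hs he hρτ hA

end Homological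

end

/-! ### Products of basis elements -/

section

open Vert

variable {r m : ℕ}

theorem Vert.Reaches.height_lt {x y : Vert r m} (h : x.Reaches y) (hne : x ≠ y) :
    y.height < x.height := by
  obtain ⟨p, hp⟩ := h.exists_loopFree
  have := hp.height_add_length_le
  have : p.length ≠ 0 := fun h0 => hne (Quiver.Path.eq_of_length_zero p h0)
  omega

theorem Vert.height_le (x : Vert r m) : x.height ≤ m + 3 := by
  cases x <;> simp only [height] <;> grind

namespace Lam

variable {K : Type u} [Field K]

theorem e_mul_arc (x y : Vert r m) : e K y * arc K x y = arc K x y := by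
  by_cases h : x.Reaches y
  · rw [← arc_self, arc_mul_arc h (.refl y)]
  · rw [arc_of_not h, mul_zero]

theorem arc_mul_e (x y : Vert r m) : arc K x y * e K x = arc K x y := by
  by_cases h : x.Reaches y
  · rw [← arc_self, arc_mul_arc (.refl x) h]
  · rw [arc_of_not h, zero_mul]

theorem arc_mul_e_of_ne {x x' : Vert r m} (h : x ≠ x') (y : Vert r m) :
    arc K x y * e K x' = 0 := by
  rw [← arc_self, arc_mul_arc_of_ne h]

theorem loop_mul_e_of_ne {x y : Vert r m} (h : y ≠ x) : loop K y * e K x = 0 := by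
  rw [← arc_self, loop_mul_arc_of_ne h.symm]

theorem e_mul_loop_of_ne {x y : Vert r m} (h : y ≠ x) : e K x * loop K y = 0 := by
  rw [← arc_self, arc_mul_loop_of_ne h]

theorem e_mul_e (x : Vert r m) : e K x * e K x = e K x := by
  rw [← arc_self, arc_mul_arc (.refl x) (.refl x)]

theorem e_mul_arc_of_ne {x y y' : Vert r m} (h : y ≠ y') : e K y' * arc K x y = 0 := by
  rw [← arc_self, arc_mul_arc_of_ne h.symm]

theorem sum_e : ∑ x, e K x = (1 : Lam K r m) := by
  rw [← map_one (RingQuot.mkRingHom (Relation K r m))]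
  change _ = RingQuot.mkRingHom (Relation K r m) (PathAlgebra.oneElt K (Vert r m))
  rw [PathAlgebra.oneElt, map_sum]
  rfl

theorem coeff_of_not {x y : Vert r m} (h : ¬ x.Reaches y) (a : Lam K r m) : coeff K x y a = 0 := by
  induction a using induction_on with
  | hadd a b ha hb => rw [map_add, ha, hb, add_zero]
  | hsmul c a ha => rw [map_smul, ha, smul_zero]
  | harc x' y' =>
    by_cases h' : x' = x ∧ y' = y
    · rw [h'.1, h'.2, arc_of_not h, map_zero]
    · exact coeff_arc_of_ne (by tauto)
  | hloop z => exact coeff_loop _ _ _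
  | hzero => exact map_zero _

theorem coeff_mul_e_of_ne {x x' : Vert r m} (h : x ≠ x') (y : Vert r m) (a : Lam K r m) :
    coeff K x y (a * e K x') = 0 := by
  induction a using induction_on with
  | hadd a b ha hb => rw [add_mul, map_add, ha, hb, add_zero]
  | hsmul c a ha => rw [smul_mul_assoc, map_smul, ha, smul_zero]
  | harc z y' =>
    by_cases h' : z = x'
    · rw [h', arc_mul_e, coeff_arc_of_ne (.inl h.symm)]
    · rw [arc_mul_e_of_ne h', map_zero]
  | hloop z =>
    by_cases h' : z = x'
    · rw [h', loop_mul_e, coeff_loop]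
    · rw [loop_mul_e_of_ne h', map_zero]
  | hzero => rw [zero_mul, map_zero]

theorem loopCoeff_mul_e_of_ne {x x' : Vert r m} (h : x ≠ x') (a : Lam K r m) :
    loopCoeff K x (a * e K x') = 0 := by
  induction a using induction_on with
  | hadd a b ha hb => rw [add_mul, map_add, ha, hb, add_zero]
  | hsmul c a ha => rw [smul_mul_assoc, map_smul, ha, smul_zero]
  | harc z y' =>
    by_cases h' : z = x'
    · rw [h', arc_mul_e, loopCoeff_arc]
    · rw [arc_mul_e_of_ne h', map_zero]
  | hloop z =>
    by_cases h' : z = x'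
    · rw [h', loop_mul_e, loopCoeff_loop h.symm]
    · rw [loop_mul_e_of_ne h', map_zero]
  | hzero => rw [zero_mul, map_zero]

theorem e_mul_eq (y : Vert r m) (a : Lam K r m) :
    e K y * a = ∑ x, coeff K x y a • arc K x y + loopCoeff K y a • loop K y := by
  classical
  conv_lhs => rw [eq_sum a]
  simp only [mul_add, Finset.mul_sum, mul_smul_comm]
  congr 1
  · refine Finset.sum_congr rfl fun x _ => ?_
    rw [Finset.sum_eq_single y]
    · rw [e_mul_arc]
    · intro z _ hz
      rw [e_mul_arc_of_ne hz, smul_zero]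
    · simp
  · rw [Finset.sum_eq_single y]
    · rw [e_mul_loop]
    · intro z _ hz
      rw [e_mul_loop_of_ne hz, smul_zero]
    · simp

theorem coeff_arc_mul {x y z : Vert r m} (hxz : x.Reaches z) (hyz : y.Reaches z) (hne : y ≠ z)
    (a : Lam K r m) : coeff K x z (arc K y z * a) = coeff K x y a := by
  induction a using induction_on with
  | hadd a b ha hb => rw [mul_add, map_add, ha, hb, map_add]
  | hsmul c a ha => rw [mul_smul_comm, map_smul, ha, map_smul]
  | harc x' y' =>
    by_cases hy : y = y'
    · subst hy
      by_cases hr : x'.Reaches y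
      · rw [arc_mul_arc hr hyz]
        by_cases hx : x' = x
        · subst hx
          rw [coeff_arc hxz, coeff_arc hr]
        · rw [coeff_arc_of_ne (.inl hx), coeff_arc_of_ne (.inl hx)]
      · rw [arc_of_not hr, mul_zero, map_zero, map_zero]
    · rw [arc_mul_arc_of_ne hy, map_zero, coeff_arc_of_ne (.inr (Ne.symm hy))]
  | hloop y' =>
    rw [coeff_loop]
    by_cases hz : y' = z
    · subst hz
      rw [← arc_mul_e, mul_assoc, e_mul_loop_of_ne hne.symm, mul_zero, map_zero]
    · rw [arc_mul_loop_of_ne hz, map_zero]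
  | hzero => rw [mul_zero, map_zero, map_zero]

theorem loop_mul_eq (y : Vert r m) (a : Lam K r m) :
    loop K y * a = coeff K y y a • loop K y := by
  induction a using induction_on with
  | hadd a b ha hb => rw [mul_add, ha, hb, map_add, add_smul]
  | hsmul c a ha => rw [mul_smul_comm, ha, map_smul, smul_eq_mul, mul_smul]
  | harc x y' =>
    by_cases hx : x = y
    · subst hx
      by_cases hy : y' = x
      · subst hy
        rw [coeff_arc (.refl _), arc_self, loop_mul_e, one_smul]
      · rw [coeff_arc_of_ne (.inr hy), zero_smul, ← loop_mul_e, ← arc_self, mul_assoc,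
          arc_mul_arc_of_ne (Ne.symm hy), mul_zero]
    · rw [loop_mul_arc_of_ne hx, coeff_arc_of_ne (.inl hx), zero_smul]
  | hloop z => rw [loop_mul_loop, coeff_loop, zero_smul]
  | hzero => rw [mul_zero, map_zero, zero_smul]

theorem coeff_e_mul_of_ne {y z : Vert r m} (h : z ≠ y) (x : Vert r m) (a : Lam K r m) :
    coeff K x y (e K z * a) = 0 := by
  rw [e_mul_eq, map_add, map_smul, coeff_loop, smul_zero, add_zero, map_sum]
  refine Finset.sum_eq_zero fun t _ => ?_
  rw [map_smul, coeff_arc_of_ne (.inr h), smul_zero]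

theorem coeff_mul_arc {x y z : Vert r m} (hxy : x.Reaches y) (hxz : x.Reaches z)
    (a : Lam K r m) : coeff K x z (a * arc K x y) = coeff K y z a := by
  induction a using induction_on with
  | hadd a b ha hb => rw [add_mul, map_add, ha, hb, map_add]
  | hsmul c a ha => rw [smul_mul_assoc, map_smul, ha, map_smul]
  | harc x' z' =>
    by_cases hx : x' = y
    · subst hx
      by_cases hr : x'.Reaches z'
      · rw [arc_mul_arc hxy hr]
        by_cases hz : z' = z
        · subst hz
          rw [coeff_arc hxz, coeff_arc hr]
        · rw [coeff_arc_of_ne (.inr hz), coeff_arc_of_ne (.inr hz)]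
      · rw [arc_of_not hr, zero_mul, map_zero, map_zero]
    · rw [arc_mul_arc_of_ne hx, map_zero, coeff_arc_of_ne (.inl hx)]
  | hloop z' =>
    rw [coeff_loop]
    by_cases hx : x = z'
    · subst hx
      by_cases hy : y = x
      · rw [hy, arc_self, loop_mul_e, coeff_loop]
      · rw [← loop_mul_e, mul_assoc, e_mul_arc_of_ne hy, mul_zero, map_zero]
    · rw [loop_mul_arc_of_ne hx, map_zero]
  | hzero => rw [zero_mul, map_zero, map_zero]

theorem e_mul_mul_e {x y : Vert r m} (h : ¬ x.Reaches y) (a : Lam K r m) :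
    e K y * a * e K x = 0 := by
  rw [mul_assoc, e_mul_eq, Finset.sum_eq_zero, zero_add, loopCoeff_mul_e_of_ne, zero_smul]
  · rintro rfl
    exact h (.refl _)
  · intro z _
    by_cases hz : z = x
    · rw [hz, arc_of_not h, smul_zero]
    · rw [coeff_mul_e_of_ne hz, zero_smul]

/-- An element of `Λ e_x` vanishes if its coefficients at the paths from `x` vanish and there is
no loop at `x`. -/
theorem eq_zero_of_coeff {x : Vert r m} {a : Lam K r m} (ha : a * e K x = a)
    (hloop : loop K x = 0) (h : ∀ y, x.Reaches y → coeff K x y a = 0) : a = 0 := by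
  rw [eq_sum a, Finset.sum_eq_zero, Finset.sum_eq_zero, add_zero]
  · intro y _
    by_cases hy : y = x
    · rw [hy, hloop, smul_zero]
    · rw [← ha, loopCoeff_mul_e_of_ne hy, zero_smul]
  · intro x' _
    refine Finset.sum_eq_zero fun y _ => ?_
    by_cases hx : x' = x
    · subst hx
      by_cases hy : x'.Reaches y
      · rw [h y hy, zero_smul]
      · rw [arc_of_not hy, smul_zero]
    · rw [← ha, coeff_mul_e_of_ne hx, zero_smul]

/-! ### Linear equations in the algebra -/

/-- If every vertex that reaches `y` reaches `z` or `t`, the solutions of `arc y z * a = 0` in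
`e_y Λ` are multiples of `arc t y`: a path to `y` that does not extend to `z` passes through `t`. -/
theorem resolves_arc {t y z : Vert r m} (hty : t.Reaches y) (hyz : y.Reaches z) (hne : y ≠ z)
    (hl : loop K y = 0) (h : ∀ x : Vert r m, x.Reaches y → x.Reaches z ∨ x.Reaches t)
    (τ : Lam K r m) :
    Resolves (Lam K r m) (arc K y z) (e K y) (arc K t y) τ := by
  intro a ha
  refine ⟨∑ x, coeff K x y a • arc K x t, 0, ?_⟩
  rw [smul_zero, add_zero, smul_eq_mul, smul_eq_mul, e_mul_eq, hl, smul_zero, add_zero,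
    Finset.mul_sum]
  refine Finset.sum_congr rfl fun x _ => ?_
  rw [mul_smul_comm]
  by_cases hxy : x.Reaches y
  · by_cases hxz : x.Reaches z
    · rw [← coeff_arc_mul hxz hyz hne, ← smul_eq_mul, ha, map_zero, zero_smul, zero_smul]
    · rw [arc_mul_arc ((h x hxy).resolve_left hxz) hty]
  · rw [coeff_of_not hxy, zero_smul, zero_smul]

theorem resolves_arc_zero {y z : Vert r m} (hyz : y.Reaches z) (hne : y ≠ z)
    (hl : loop K y = 0) (h : ∀ x : Vert r m, x.Reaches y → x.Reaches z) (κ τ : Lam K r m) :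
    Resolves (Lam K r m) (arc K y z) (e K y) κ τ := by
  intro a ha
  refine ⟨0, 0, ?_⟩
  rw [smul_zero, smul_zero, add_zero, smul_eq_mul, e_mul_eq, hl, smul_zero, add_zero]
  refine Finset.sum_eq_zero fun x _ => ?_
  by_cases hxy : x.Reaches y
  · rw [← coeff_arc_mul (h x hxy) hyz hne, ← smul_eq_mul, ha, map_zero, zero_smul]
  · rw [coeff_of_not hxy, zero_smul]

/-- The loop and the paths from `t` generate right ideals that meet in zero. -/
theorem loop_mul_eq_zero_of_eq {t y : Vert r m} (hne : t ≠ y) (a b : Lam K r m)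
    (h : loop K y * a = arc K t y * b) : loop K y * a = 0 := by
  have h0 : loopCoeff K y (arc K t y * b) = 0 := by
    clear h
    induction b using induction_on with
    | hadd a b ha hb => rw [mul_add, map_add, ha, hb, add_zero]
    | hsmul c a ha => rw [mul_smul_comm, map_smul, ha, smul_zero]
    | harc x z =>
      by_cases hz : t = z
      · subst hz
        by_cases hx : x.Reaches t
        · by_cases hy : t.Reaches y
          · rw [arc_mul_arc hx hy, loopCoeff_arc]
          · rw [arc_of_not hy, zero_mul, map_zero]
        · rw [arc_of_not hx, mul_zero, map_zero]
      · rw [arc_mul_arc_of_ne hz, map_zero]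
    | hloop z =>
      by_cases hz : z = y
      · subst hz
        rw [← arc_mul_e, mul_assoc, e_mul_loop_of_ne hne.symm, mul_zero, map_zero]
      · rw [arc_mul_loop_of_ne hz, map_zero]
    | hzero => rw [mul_zero, map_zero]
  rw [← h, loop_mul_eq, map_smul, smul_eq_mul] at h0
  rw [loop_mul_eq, ← loopCoeff_loop_smul, smul_smul, h0, zero_smul]

/-- The solutions of `loop y * a = 0` in `e_y Λ` are generated by the loop and by the paths that
end with the arrow from `t`. -/
theorem resolves_loop {t y : Vert r m} (hty : t.Reaches y) (hl : loop K y ≠ 0)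
    (h : ∀ x, x ≠ y → x.Reaches y → x.Reaches t) :
    Resolves (Lam K r m) (loop K y) (e K y) (loop K y) (arc K t y) := by
  classical
  intro a ha
  rw [smul_eq_mul, loop_mul_eq] at ha
  have hc := (smul_eq_zero.1 ha).resolve_right hl
  refine ⟨loopCoeff K y a • 1, ∑ x, coeff K x y a • arc K x t, ?_⟩
  rw [smul_eq_mul, smul_eq_mul, smul_eq_mul, e_mul_eq, mul_smul_comm, mul_one, add_comm,
    Finset.mul_sum]
  congr 1
  refine Finset.sum_congr rfl fun x _ => ?_
  rw [mul_smul_comm]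
  by_cases hxy : x.Reaches y
  · by_cases hx : x = y
    · subst hx
      rw [hc, zero_smul, zero_smul]
    · rw [arc_mul_arc (h x hx hxy) hty]
  · rw [coeff_of_not hxy, zero_smul, zero_smul]

/-- Since the loop at `y` annihilates the radical, the equation given by a loop reproduces itself
under dimension shifting. -/
theorem resolvesFin_loop {t y : Vert r m} (hty : t.Reaches y) (hne : t ≠ y) (hl : loop K y ≠ 0)
    (h : ∀ x, x ≠ y → x.Reaches y → x.Reaches t) :
    ResolvesFin (Lam K r m) (loop K y) (e K y) (loop K y) (arc K t y) :=
  ResolvesFin.of_self (loop_mul_loop _ _) (e_mul_loop _) (loop_mul_eq_zero_of_eq hne)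
    (resolves_loop hty hl h)

theorem loop_ne_zero {y : Vert r m} (f : Arr r m y y) : loop K y ≠ 0 := by
  intro h0
  have h1 : loopCoeff K y (path K f.path) = 1 :=
    ((exists_loopCoeff K y).choose_spec f.path).1 ⟨rfl, rfl, rfl⟩
  rw [path_arrow_eq_loop f rfl, h0, map_zero] at h1
  exact zero_ne_one h1

end Lam

end

/-! ### The radical -/

section

open Vert

variable {r m : ℕ} {K : Type u} [Field K]

namespace Lam

section Rad

variable (M : Type w) [AddCommGroup M] [Module (Lam K r m) M] [Module K M]

variable (r m K) in
/-- The radical `J M`, as a vector space: the span of all products with `arc x y` for `x ≠ y` and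
with the loops. -/
def rad : Submodule K M :=
  Submodule.span K ({n | ∃ x y : Vert r m, ∃ n' : M, x ≠ y ∧ n = arc K x y • n'} ∪
    {n | ∃ y : Vert r m, ∃ n' : M, n = loop K y • n'})

variable {M}

theorem arc_smul_mem_rad {x y : Vert r m} (h : x ≠ y) (n : M) :
    arc K x y • n ∈ rad r m K M := Submodule.subset_span (Or.inl ⟨x, y, n, h, rfl⟩)

theorem loop_smul_mem_rad (y : Vert r m) (n : M) :
    loop K y • n ∈ rad r m K M := Submodule.subset_span (Or.inr ⟨y, n, rfl⟩)

variable [IsScalarTower K (Lam K r m) M]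

/-- Modulo the radical, an element of `Λ_m` acts through the coefficients of the idempotents. -/
theorem smul_sub_mem_rad (a : Lam K r m) (n : M) :
    a • n - ∑ x, coeff K x x a • e K x • n ∈ rad r m K M := by
  classical
  induction a using induction_on with
  | hadd a b ha hb =>
    convert add_mem ha hb using 1
    simp only [map_add, add_smul, Finset.sum_add_distrib]
    abel
  | hsmul c a ha =>
    convert Submodule.smul_mem _ c ha using 1
    simp only [map_smul, smul_eq_mul, mul_smul, smul_sub, Finset.smul_sum, smul_assoc]
  | harc x y =>
    by_cases h : x = y
    · subst h
      rw [Finset.sum_eq_single x]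
      · rw [coeff_arc (.refl x), one_smul, arc_self, sub_self]
        exact zero_mem _
      · intro z _ hz
        rw [coeff_arc_of_ne (.inl hz.symm), zero_smul]
      · simp
    · rw [Finset.sum_eq_zero, sub_zero]
      · exact arc_smul_mem_rad h n
      · intro z _
        rw [coeff_arc_of_ne, zero_smul]
        by_contra! h'
        exact h (h'.1.trans h'.2.symm)
  | hloop y =>
    simp only [coeff_loop, zero_smul, Finset.sum_const_zero, sub_zero]
    exact loop_smul_mem_rad y n
  | hzero => simp

theorem smul_mem_rad {a : Lam K r m} (h : ∀ x, coeff K x x a = 0) (n : M) :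
    a • n ∈ rad r m K M := by
  have := smul_sub_mem_rad a n
  rwa [Finset.sum_eq_zero fun x _ => by rw [h x, zero_smul], sub_zero] at this

theorem smul_rad (a : Lam K r m) {n : M} (hn : n ∈ rad r m K M) : a • n ∈ rad r m K M := by
  have he : ∀ z : Vert r m, e K z • n ∈ rad r m K M := by
    intro z
    induction hn using Submodule.span_induction with
    | zero => rw [smul_zero]; exact zero_mem _
    | add a b _ _ ha hb => rw [smul_add]; exact add_mem ha hb
    | smul c a _ ha => rw [smul_comm]; exact Submodule.smul_mem _ _ ha
    | mem a ha =>
      rcases ha with ⟨x, y, n, hxy, rfl⟩ | ⟨y, n, rfl⟩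
      · by_cases hz : y = z
        · subst hz
          rw [smul_smul, e_mul_arc]
          exact arc_smul_mem_rad hxy n
        · rw [smul_smul, e_mul_arc_of_ne hz, zero_smul]
          exact zero_mem _
      · by_cases hz : y = z
        · subst hz
          rw [smul_smul, e_mul_loop]
          exact loop_smul_mem_rad y n
        · rw [smul_smul, e_mul_loop_of_ne hz, zero_smul]
          exact zero_mem _
  have h1 := smul_sub_mem_rad a n
  have h2 : ∑ x, coeff K x x a • e K x • n ∈ rad r m K M :=
    Submodule.sum_mem _ fun x _ => Submodule.smul_mem _ _ (he x)
  have h3 := add_mem h1 h2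
  rwa [sub_add_cancel] at h3

/-- A loop annihilates the radical, since no initial path of length two ends with a loop. -/
theorem loop_smul_rad (y : Vert r m) {n : M} (hn : n ∈ rad r m K M) : loop K y • n = 0 := by
  induction hn using Submodule.span_induction with
  | zero => rw [smul_zero]
  | add a b _ _ ha hb => rw [smul_add, ha, hb, add_zero]
  | smul c a _ ha => rw [smul_comm, ha, smul_zero]
  | mem a ha =>
    rcases ha with ⟨x, z, n, hxz, rfl⟩ | ⟨z, n, rfl⟩
    · rw [smul_smul, loop_mul_eq, coeff_arc_of_ne, zero_smul, zero_smul]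
      by_contra! h'
      exact hxz (h'.1.trans h'.2.symm)
    · rw [smul_smul, loop_mul_loop, zero_smul]

/-- Nakayama's lemma: a submodule `N` with `N + J M = M` is equal to `M`. -/
theorem eq_top_of_sub_mem_rad (N : Submodule (Lam K r m) M)
    (h : ∀ x : M, ∃ n ∈ N, x - n ∈ rad r m K M) : N = ⊤ := by
  have hK : ∀ (c : K) {x : M}, x ∈ N → c • x ∈ N := fun c x hx => by
    rw [← smul_one_smul (Lam K r m) c x]
    exact N.smul_mem _ hx
  have hl : ∀ (y : Vert r m) (x : M), loop K y • x ∈ N := by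
    intro y x
    obtain ⟨n, hn, hx⟩ := h x
    have := loop_smul_rad y hx
    rw [smul_sub, sub_eq_zero] at this
    rw [this]
    exact N.smul_mem _ hn
  -- By descending induction on the height of `y`, the part of `M` at `y` lies in `N`.
  have he : ∀ (k : ℕ) (y : Vert r m), (m + 3 - y.height).toNat = k →
      ∀ x : M, e K y • x ∈ N := by
    intro k
    induction k using Nat.strong_induction_on with
    | _ k ih =>
      intro y hy x
      obtain ⟨n, hn, hx⟩ := h x
      suffices H : ∀ j ∈ rad r m K M, e K y • j ∈ N by
        have := N.add_mem (H _ hx) (N.smul_mem (e K y) hn)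
        rwa [← smul_add, sub_add_cancel] at this
      intro j hj
      induction hj using Submodule.span_induction with
      | zero => rw [smul_zero]; exact N.zero_mem
      | add a b _ _ ha hb => rw [smul_add]; exact N.add_mem ha hb
      | smul c a _ ha =>
        rw [smul_comm]
        exact hK c ha
      | mem a ha =>
        rcases ha with ⟨z, t, n, hzt, rfl⟩ | ⟨z, n, rfl⟩
        · by_cases ht : t = y
          · subst ht
            by_cases hr : z.Reaches t
            · have h1 := hr.height_lt hzt
              have h2 := z.height_le
              rw [smul_smul, e_mul_arc, ← arc_mul_e, mul_smul]
              exact N.smul_mem _ (ih _ (by omega) z rfl n)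
            · rw [arc_of_not hr, zero_smul, smul_zero]
              exact N.zero_mem
          · rw [smul_smul, e_mul_arc_of_ne ht, zero_smul]
            exact N.zero_mem
        · exact N.smul_mem _ (hl z n)
  rw [eq_top_iff]
  intro x _
  rw [← one_smul (Lam K r m) x, ← sum_e, Finset.sum_smul]
  exact N.sum_mem fun y _ => he _ y rfl x

end Rad

/-! ### Projective covers -/

section ProjSum

variable {B : Type w} (v : B → Vert r m)

variable (K) in
/-- The elements of the free module with coordinates in `Λ e_{v b}`. -/
def projSubmodule : Submodule (Lam K r m) (B →₀ Lam K r m) where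
  carrier := {F | ∀ b, F b * e K (v b) = F b}
  add_mem' := fun {F G} hF hG b => by
    rw [Finsupp.add_apply, add_mul, hF b, hG b]
  zero_mem' := fun b => by simp
  smul_mem' := fun a F hF b => by
    rw [Finsupp.smul_apply, smul_eq_mul, mul_assoc, hF b]

variable (K) in
/-- The projective module `⨁ Λ e_{v b}`, realised inside the free module with basis `B`. It is a
type of its own, with instances found without unfolding it, rather than a coerced submodule. -/
def ProjSum : Type (max w u) := projSubmodule K v

instance : AddCommGroup (ProjSum K v) := inferInstanceAs (AddCommGroup (projSubmodule K v))

instance : Module (Lam K r m) (ProjSum K v) :=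
  inferInstanceAs (Module (Lam K r m) (projSubmodule K v))

instance : Module K (ProjSum K v) := inferInstanceAs (Module K (projSubmodule K v))

instance : IsScalarTower K (Lam K r m) (ProjSum K v) :=
  inferInstanceAs (IsScalarTower K (Lam K r m) (projSubmodule K v))

variable {v}

namespace ProjSum

variable (K v) in
/-- The inclusion into the free module. -/
def incl : ProjSum K v →ₗ[Lam K r m] (B →₀ Lam K r m) := (projSubmodule K v).subtype

theorem coe_add (F G : ProjSum K v) : (F + G).1 = F.1 + G.1 := rfl

theorem coe_zero : (0 : ProjSum K v).1 = 0 := rfl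

theorem coe_smul (a : Lam K r m) (F : ProjSum K v) : (a • F).1 = a • F.1 := rfl

theorem coe_ksmul (a : K) (F : ProjSum K v) : (a • F).1 = a • F.1 := rfl

theorem coe_sub (F G : ProjSum K v) : (F - G).1 = F.1 - G.1 := rfl

theorem ext {F G : ProjSum K v} (h : ∀ b, F.1 b = G.1 b) : F = G :=
  Subtype.ext (Finsupp.ext h)

end ProjSum

theorem single_mem_projSubmodule {b : B} {a : Lam K r m} (h : a * e K (v b) = a) :
    Finsupp.single b a ∈ projSubmodule K v := by
  classical
  intro b'
  by_cases hb : b = b'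
  · subst hb
    rw [Finsupp.single_eq_same, h]
  · rw [Finsupp.single_eq_of_ne' hb, zero_mul]

variable (K v) in
/-- The generators `e_{v b}` of `projSum`. -/
def projGen (b : B) : ProjSum K v :=
  ⟨Finsupp.single b (e K (v b)), single_mem_projSubmodule (e_mul_e _)⟩

theorem projSum_eq_sum (F : ProjSum K v) : F = F.1.sum fun b a => a • projGen K v b := by
  have h1 : ProjSum.incl K v (F.1.sum fun b a => a • projGen K v b) =
      F.1.sum fun b a => Finsupp.single b a := by
    rw [Finsupp.sum, Finsupp.sum, map_sum]
    refine Finset.sum_congr rfl fun b _ => ?_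
    rw [map_smul]
    change _ • Finsupp.single b _ = _
    rw [Finsupp.smul_single, smul_eq_mul, F.2 b]
  rw [Finsupp.sum_single] at h1
  exact (Subtype.ext h1).symm

variable (K v) in
/-- The projection of the free module onto `projSum`. -/
def projRetract : (B →₀ Lam K r m) →ₗ[Lam K r m] ProjSum K v :=
  Finsupp.linearCombination _ (projGen K v)

theorem projRetract_coe (F : ProjSum K v) : projRetract K v F.1 = F :=
  (projSum_eq_sum F).symm

theorem projRetract_single (b : B) (a : Lam K r m) :
    projRetract K v (Finsupp.single b a) = a • projGen K v b :=
  Finsupp.linearCombination_single _ _ _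

instance : Module.Projective (Lam K r m) (ProjSum K v) :=
  Module.Projective.of_split (ProjSum.incl K v) (projRetract K v)
    (LinearMap.ext projRetract_coe)

/-- All coordinates lie in the radical of `Λ_m`, the span of the paths of positive length. -/
def InRad (F : B →₀ Lam K r m) : Prop := ∀ b x, coeff K x x (F b) = 0

theorem coeff_projSum_of_ne (F : ProjSum K v) {b : B} {x : Vert r m} (h : x ≠ v b)
    (y : Vert r m) : coeff K x y (F.1 b) = 0 := by
  rw [← F.2 b, coeff_mul_e_of_ne h]

theorem mem_rad_of_inRad {F : ProjSum K v} (h : InRad F.1) : F ∈ rad r m K (ProjSum K v) := by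
  rw [projSum_eq_sum F]
  refine Submodule.sum_mem _ fun b _ => ?_
  exact smul_mem_rad (h b) _

/-- The radical of a projective module vanishes at a vertex that is not reached from another vertex
of the top and, if it belongs to the top itself, carries no loop. -/
theorem e_smul_eq_zero {F : ProjSum K v} (h : InRad F.1) {y : Vert r m}
    (h1 : ∀ b, v b ≠ y → ¬ (v b).Reaches y) (h2 : ∀ b, v b = y → loop K y = 0) :
    e K y • F = 0 := by
  refine ProjSum.ext fun b => ?_
  rw [ProjSum.coe_smul, Finsupp.smul_apply, smul_eq_mul, e_mul_eq, ProjSum.coe_zero,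
    Finsupp.zero_apply, Finset.sum_eq_zero, zero_add]
  · by_cases hb : v b = y
    · rw [h2 b hb, smul_zero]
    · rw [← F.2 b, loopCoeff_mul_e_of_ne (Ne.symm hb), zero_smul]
  · intro x _
    by_cases hx : x = v b
    · subst hx
      by_cases hb : v b = y
      · rw [hb, h b, zero_smul]
      · rw [arc_of_not (h1 b hb), smul_zero]
    · rw [coeff_projSum_of_ne F hx, zero_smul]

theorem arc_smul_eq_zero {F : ProjSum K v} (h : InRad F.1) {y z : Vert r m}
    (hne : y ≠ z) (h1 : ∀ b, v b ≠ y → (v b).Reaches y → ¬ (v b).Reaches z) :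
    arc K y z • F = 0 := by
  by_cases hyz : y.Reaches z
  swap
  · rw [arc_of_not hyz, zero_smul]
  refine ProjSum.ext fun b => ?_
  rw [ProjSum.coe_smul, Finsupp.smul_apply, smul_eq_mul, ← arc_mul_e, mul_assoc, e_mul_eq,
    ProjSum.coe_zero, Finsupp.zero_apply, mul_add, mul_smul_comm, arc_mul_loop_of_ne hne,
    smul_zero, add_zero, Finset.mul_sum, Finset.sum_eq_zero]
  intro x _
  rw [mul_smul_comm]
  by_cases hx : x = v b
  · subst hx
    by_cases hb : v b = y
    · rw [hb, h b, zero_smul]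
    · by_cases hr : (v b).Reaches y
      · rw [arc_mul_arc hr hyz, arc_of_not (h1 b hb hr), smul_zero]
      · rw [arc_of_not hr, mul_zero, smul_zero]
  · rw [coeff_projSum_of_ne F hx, zero_smul]

theorem loop_smul_eq_zero {F : ProjSum K v} (h : InRad F.1) (y : Vert r m) :
    loop K y • F = 0 := by
  refine ProjSum.ext fun b => ?_
  rw [ProjSum.coe_smul, Finsupp.smul_apply, smul_eq_mul, loop_mul_eq, h b, zero_smul,
    ProjSum.coe_zero, Finsupp.zero_apply]

end ProjSum

theorem isProjectiveCover_of_le_rad {P M : Type u} [AddCommGroup P] [Module (Lam K r m) P]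
    [Module K P] [IsScalarTower K (Lam K r m) P] [Module.Projective (Lam K r m) P]
    [AddCommGroup M] [Module (Lam K r m) M] {f : P →ₗ[Lam K r m] M} (hf : Function.Surjective f)
    (h : ∀ x, f x = 0 → x ∈ rad r m K P) : IsProjectiveCover f where
  projective := inferInstance
  surjective := hf
  superfluous := by
    intro N hN
    refine eq_top_of_sub_mem_rad N fun x => ?_
    obtain ⟨n, hn, k, hk, hx⟩ := Submodule.mem_sup.1 (hN ▸ Submodule.mem_top : x ∈ N ⊔ _)
    refine ⟨n, hn, ?_⟩
    rw [← hx, add_sub_cancel_left]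
    exact h k hk

/-- Every module has a projective cover by a direct sum of modules `Λ e_x` with `e_x M ≠ 0`. -/
theorem exists_cover (M : Type u) [AddCommGroup M] [Module (Lam K r m) M] :
    ∃ (B : Type u) (v : B → Vert r m) (f : ProjSum K v →ₗ[Lam K r m] M),
      Function.Surjective f ∧ (∀ F, f F = 0 → InRad F.1) ∧ ∀ b, ∃ n : M, e K (v b) • n ≠ 0 := by
  classical
  let _ : Module K M := Module.compHom M (algebraMap K (Lam K r m))
  have _ : IsScalarTower K (Lam K r m) M := ⟨fun k a n => by
    change _ = algebraMap K (Lam K r m) k • a • n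
    rw [smul_smul, Algebra.smul_def]⟩
  -- A set of elements of the spaces `e_x M` that induces a basis of `M / J M`.
  let S : Set (M ⧸ rad r m K M) :=
    {q | ∃ (x : Vert r m) (n : M), e K x • n = n ∧ (rad r m K M).mkQ n = q}
  obtain ⟨B, hBS, hspan, hli⟩ := exists_linearIndependent K S
  choose v g hvg hgq using fun b : B => hBS b.2
  have hgq' : ∀ b : B, (rad r m K M).mkQ (g b) = b := hgq
  let f : ProjSum K v →ₗ[Lam K r m] M :=
    (Finsupp.linearCombination (Lam K r m) g) ∘ₗ (ProjSum.incl K v)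
  have hf : ∀ F : ProjSum K v, f F = ∑ b ∈ F.1.support, F.1 b • g b := fun F => rfl
  have hfgen : ∀ b, f (projGen K v b) = g b := by
    intro b
    change Finsupp.linearCombination (Lam K r m) g (Finsupp.single b _) = _
    rw [Finsupp.linearCombination_single, hvg]
  refine ⟨B, v, f, ?_, ?_, ?_⟩
  · rw [← LinearMap.range_eq_top]
    refine eq_top_of_sub_mem_rad _ fun x => ?_
    have hx : (rad r m K M).mkQ x ∈ Submodule.span K B := by
      rw [hspan, ← one_smul (Lam K r m) x, ← sum_e, Finset.sum_smul, map_sum]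
      refine Submodule.sum_mem _ fun y _ => Submodule.subset_span ⟨y, e K y • x, ?_, rfl⟩
      rw [smul_smul, e_mul_e]
    have key : ∀ q ∈ Submodule.span K B,
        ∃ n ∈ LinearMap.range f, (rad r m K M).mkQ n = q := by
      intro q hq
      induction hq using Submodule.span_induction with
      | zero => exact ⟨0, zero_mem _, map_zero _⟩
      | add a b _ _ ha hb =>
        obtain ⟨n, hn, rfl⟩ := ha
        obtain ⟨n', hn', rfl⟩ := hb
        exact ⟨n + n', add_mem hn hn', map_add _ _ _⟩
      | smul c a _ ha =>
        obtain ⟨n, hn, rfl⟩ := ha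
        refine ⟨c • n, ?_, map_smul _ _ _⟩
        rw [← smul_one_smul (Lam K r m) c n]
        exact Submodule.smul_mem _ _ hn
      | mem a ha => exact ⟨g ⟨a, ha⟩, ⟨projGen K v ⟨a, ha⟩, hfgen _⟩, hgq' ⟨a, ha⟩⟩
    obtain ⟨n, hn, hnx⟩ := key _ hx
    refine ⟨n, hn, ?_⟩
    rw [← Submodule.Quotient.mk_eq_zero, Submodule.Quotient.mk_sub, sub_eq_zero]
    exact hnx.symm
  · intro F hF b x
    by_cases hx : x = v b
    swap
    · exact coeff_projSum_of_ne F hx x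
    subst hx
    by_cases hb : b ∈ F.1.support
    swap
    · rw [Finsupp.notMem_support_iff.1 hb, map_zero]
    refine linearIndependent_iff'.1 hli F.1.support
      (fun b => coeff K (v b) (v b) (F.1 b)) ?_ b hb
    have h1 : ∀ b : B, (rad r m K M).mkQ (F.1 b • g b) =
        coeff K (v b) (v b) (F.1 b) • (b : M ⧸ rad r m K M) := by
      intro b
      have h2 := smul_sub_mem_rad (F.1 b) (g b)
      rw [Finset.sum_eq_single (v b), hvg] at h2
      · rw [← hgq' b, ← map_smul, ← sub_eq_zero, ← map_sub]
        exact (Submodule.Quotient.mk_eq_zero _).2 h2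
      · intro y _ hy
        rw [coeff_projSum_of_ne F hy, zero_smul]
      · simp
    rw [← map_zero (rad r m K M).mkQ, ← hF, hf, map_sum]
    exact Finset.sum_congr rfl fun b _ => (h1 b).symm
  · intro b
    refine ⟨g b, ?_⟩
    rw [hvg]
    intro h0
    have := hli.ne_zero b
    rw [← hgq' b, h0, map_zero] at this
    exact this rfl

end Lam

end

/-! ### Upper bounds for projective dimensions -/

section

open Vert

variable {r m : ℕ} {K : Type u} [Field K]

namespace Lam

section Upper

variable {N : Type u} [AddCommGroup N] [Module (Lam K r m) N]

theorem subsingleton_of_e_smul (h : ∀ (y : Vert r m) (n : N), e K y • n = 0) :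
    Subsingleton N := by
  refine ⟨fun a b => ?_⟩
  have h0 : ∀ n : N, n = 0 := fun n => by
    rw [← one_smul (Lam K r m) n, ← sum_e, Finset.sum_smul, Finset.sum_eq_zero fun y _ => h y n]
  rw [h0 a, h0 b]

theorem arc_smul_of_e {x : Vert r m} (y : Vert r m) {n : N} (h : e K x • n = 0) :
    arc K x y • n = 0 := by
  rw [← arc_mul_e, mul_smul, h, smul_zero]

/-- A module that lives on the vertices `d_i, …, d_r` has a projective resolution of length
`r - i`, since its syzygy lives on `d_{i+1}, …, d_r`. -/
theorem pdLT_of_support_d (k i : ℕ) (hk : i + k = r + 1)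
    (h : ∀ y : Vert r m, (∀ j hj, i ≤ j → y ≠ .d j hj) → ∀ n : N, e K y • n = 0) :
    PdLT (Lam K r m) N k := by
  induction k generalizing i N with
  | zero =>
    have : Subsingleton N := subsingleton_of_e_smul (K := K) fun y n =>
      h y (fun j hj hij => by omega) n
    exact pdLT_zero
  | succ k ih =>
    obtain ⟨B, v, f, hf, hrad, hv⟩ := exists_cover (K := K) (r := r) (m := m) N
    refine PdLT.of_ker hf (ih (i + 1) (by omega) ?_)
    rintro y hy ⟨F, hF⟩
    ext1
    have hvd : ∀ b, ∃ j hj, i ≤ j ∧ v b = .d j hj := by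
      intro b
      by_contra! h'
      obtain ⟨n, hn⟩ := hv b
      exact hn (h _ h' n)
    refine e_smul_eq_zero (hrad F hF) (fun b hb hr => ?_) (fun b hb => ?_)
    · obtain ⟨j, hj, hij, hd⟩ := hvd b
      rw [hd] at hb hr
      cases y <;> simp [Reaches] at hr hb
      rename_i j' hj'
      exact hy j' hj' (by omega) rfl
    · obtain ⟨j, hj, hij, hd⟩ := hvd b
      rw [← hb, hd]
      rfl

end Upper

/-- If `y` carries a loop and is entered from `s`, the equation given by the loop at `y` is followed
by the one given by the arrow from `s` to `y`. -/
theorem resolvesFin_arc_loop {t s y : Vert r m} (hsy : s.Reaches y) (hne : s ≠ y)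
    (hl : loop K y ≠ 0) (h : ∀ x, x ≠ y → x.Reaches y → x.Reaches s) (hts : t.Reaches s)
    (hls : loop K s = 0) (h' : ∀ x : Vert r m, x.Reaches s → x.Reaches y ∨ x.Reaches t) :
    ResolvesFin (Lam K r m) (arc K s y) (e K s) (arc K t s) 0 := by
  refine ResolvesFin.next (s := loop K y) (e := e K y) (τ := loop K y) ?_
    (loop_mul_arc_of_ne hne) (e_mul_arc _ _) ?_ (resolves_arc hts hsy hne hls h' 0)
  · intro n N _ _ hN x hx
    obtain ⟨a, b, hab⟩ := resolvesFin_loop hsy hne hl h n N hN x hx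
    exact ⟨b, a, by rw [hab, add_comm]⟩
  · intro a b hab
    rw [hab]
    exact loop_mul_eq_zero_of_eq hne b a hab.symm

/-- The equation given by `arc t z` is followed by the one given by `arc s t` if the composition
vanishes. -/
theorem resolvesFin_arc_arc {q s t z : Vert r m}
    (H : ResolvesFin (Lam K r m) (arc K t z) (e K t) (arc K s t) 0)
    (hst : s.Reaches t) (htz : t.Reaches z) (hsz : ¬ s.Reaches z)
    (hne : s ≠ t) (hqs : q.Reaches s) (hls : loop K s = 0)
    (h' : ∀ x : Vert r m, x.Reaches s → x.Reaches t ∨ x.Reaches q) :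
    ResolvesFin (Lam K r m) (arc K s t) (e K s) (arc K q s) 0 := by
  refine H.next ?_ (e_mul_arc _ _) ?_ (resolves_arc hqs hst hne hls h' 0)
  · rw [arc_mul_arc hst htz, arc_of_not hsz]
  · intro a b hab
    rw [hab, zero_mul]

theorem loop_u_ne : loop K (.u : Vert r m) ≠ 0 := loop_ne_zero .loopU
theorem loop_v_ne : loop K (.v : Vert r m) ≠ 0 := loop_ne_zero .loopV
theorem loop_w_ne : loop K (.w : Vert r m) ≠ 0 := loop_ne_zero .loopW
theorem loop_bneg_ne : loop K (.bneg : Vert r m) ≠ 0 := loop_ne_zero .loopB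
theorem loop_cneg_ne : loop K (.cneg : Vert r m) ≠ 0 := loop_ne_zero .loopC

theorem resolvesFin_u : ResolvesFin (Lam K r m) (loop K .u) (e K .u) (loop K .u)
    (arc K (.a 0 (by omega)) .u) :=
  resolvesFin_loop (by simp [Reaches]) (by simp) loop_u_ne
    (fun x hx hr => by cases x <;> simp [Reaches] at hx hr ⊢ <;> omega)

theorem resolvesFin_v : ResolvesFin (Lam K r m) (loop K .v) (e K .v) (loop K .v)
    (arc K (.b 0 (by omega)) .v) :=
  resolvesFin_loop (by simp [Reaches]) (by simp) loop_v_ne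
    (fun x hx hr => by cases x <;> simp [Reaches] at hx hr ⊢ <;> omega)

theorem resolvesFin_w : ResolvesFin (Lam K r m) (loop K .w) (e K .w) (loop K .w)
    (arc K (.c 0 (by omega) (by omega)) .w) :=
  resolvesFin_loop (by simp [Reaches]) (by simp) loop_w_ne
    (fun x hx hr => by cases x <;> simp [Reaches] at hx hr ⊢ <;> omega)

theorem resolvesFin_bneg : ResolvesFin (Lam K r m) (loop K .bneg) (e K .bneg) (loop K .bneg)
    (arc K (.b 0 (by omega)) .bneg) :=
  resolvesFin_loop (by simp [Reaches]) (by simp) loop_bneg_ne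
    (fun x hx hr => by cases x <;> simp [Reaches] at hx hr ⊢ <;> omega)

theorem resolvesFin_cneg : ResolvesFin (Lam K r m) (loop K .cneg) (e K .cneg) (loop K .cneg)
    (arc K (.c 0 (by omega) (by omega)) .cneg) :=
  resolvesFin_loop (by simp [Reaches]) (by simp) loop_cneg_ne
    (fun x hx hr => by cases x <;> simp [Reaches] at hx hr ⊢ <;> omega)

theorem resolvesFin_c0 : ResolvesFin (Lam K r m) (arc K (.c 0 (by omega) (by omega)) .w)
    (e K (.c 0 (by omega) (by omega)))
    (arc K (.a 0 (by omega)) (.c 0 (by omega) (by omega))) 0 :=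
  resolvesFin_arc_loop (by simp [Reaches]) (by simp) loop_w_ne
    (fun x hx hr => by cases x <;> simp [Reaches] at hx hr ⊢ <;> omega) (by simp [Reaches]) rfl
    (fun x hr => by cases x <;> simp [Reaches] at hr ⊢ <;> omega)

/-- A chain of equations that starts with the loop at `v` and runs against the arrows
`b_0 → v`, `b_1 → b_0`, `c_2 → b_1`, `a_2 → c_2`. -/
theorem resolvesFin_c2 (h : 2 ≤ m) :
    ResolvesFin (Lam K r m) (arc K (.c 2 h le_rfl) (.b 1 (by omega))) (e K (.c 2 h le_rfl))
      (arc K (.a 2 h) (.c 2 h le_rfl)) 0 := by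
  have h0 : ResolvesFin (Lam K r m) (arc K (.b 0 (by omega)) .v) (e K (.b 0 (by omega)))
      (arc K (.b 1 (by omega)) (.b 0 (by omega))) 0 :=
    resolvesFin_arc_loop (by simp [Reaches]) (by simp) loop_v_ne
      (fun x hx hr => by cases x <;> simp [Reaches] at hx hr ⊢ <;> omega) (by simp [Reaches]) rfl
      (fun x hr => by cases x <;> simp [Reaches] at hr ⊢ <;> omega)
  have h1 : ResolvesFin (Lam K r m) (arc K (.b 1 (by omega)) (.b 0 (by omega)))
      (e K (.b 1 (by omega))) (arc K (.c 2 h le_rfl) (.b 1 (by omega))) 0 :=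
    resolvesFin_arc_arc h0 (by simp [Reaches]) (by simp [Reaches]) (by simp [Reaches]) (by simp)
      (by simp [Reaches]) rfl
      (fun x hr => by cases x <;> simp [Reaches] at hr ⊢ <;> omega)
  exact resolvesFin_arc_arc h1 (by simp [Reaches]) (by simp [Reaches]) (by simp [Reaches])
    (by simp) (by simp [Reaches]) rfl
    (fun x hr => by cases x <;> simp [Reaches] at hr ⊢ <;> omega)

section Level

variable {M : Type u} [AddCommGroup M] [Module (Lam K r m) M] {B : Type u} {v : B → Vert r m}
  {f : ProjSum K v →ₗ[Lam K r m] M}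

theorem level_le_of_cover {l : ℕ} (hv : ∀ b, ∃ n : M, e K (v b) • n ≠ 0)
    (hl : ∀ y : Vert r m, l < y.level → ∀ n : M, e K y • n = 0) (b : B) : (v b).level ≤ l := by
  by_contra! h
  obtain ⟨n, hn⟩ := hv b
  exact hn (hl _ h n)

/-- For modules of finite projective dimension, passing to the syzygy lowers the level. -/
theorem e_smul_ker_eq_zero (hrad : ∀ F, f F = 0 → InRad F.1) {l : ℕ}
    (hv : ∀ b, (v b).level ≤ l) (hl : 1 ≤ l) {n : ℕ}
    (hpd : PdLT (Lam K r m) (LinearMap.ker f) (n + 1)) {y : Vert r m} (hy : l ≤ y.level)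
    (F : ProjSum K v) (hF : f F = 0) : e K y • F = 0 := by
  have h1 : ∀ z : Vert r m, l ≤ z.level → (∀ h h', z ≠ .c 2 h h') →
      ∀ G, f G = 0 → e K z • G = 0 := by
    intro z hz hz' G hG
    refine e_smul_eq_zero (hrad G hG) (fun b hb hr => ?_) (fun b _ => ?_)
    · have hvb := hv b
      revert hb hr hvb
      generalize v b = x
      intro hb hr hvb
      cases x <;> cases z <;> simp [Reaches, level] at hb hr hvb hz hz' <;> omega
    · cases z <;> simp [level] at hz <;> first | omega | rfl
  -- The vertex `c_2` is reached from `a_2`, which has the same level.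
  by_cases hc : ∀ h h', y ≠ .c 2 h h'
  · exact h1 y hy hc F hF
  push Not at hc
  obtain ⟨h, h', rfl⟩ := hc
  have hker : ∀ G : LinearMap.ker f,
      arc (r := r) (m := m) K (.c 2 h h') (.b 1 (by omega)) • G = 0 := by
    rintro ⟨G, hG⟩
    ext1
    refine arc_smul_eq_zero (hrad G hG) (by simp) (fun b hb hr hr' => ?_)
    have hvb := hv b
    revert hb hr hr' hvb
    generalize v b = x
    intro hb hr hr' hvb
    simp [level] at hy
    cases x <;> simp [Reaches, level] at hb hr hr' hvb <;> omega
  by_cases hl2 : l = 2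
  · obtain ⟨G, G', hG⟩ := resolvesFin_c2 h n _ hpd ⟨F, hF⟩ (hker _)
    have hG' := congrArg Subtype.val hG
    simp only [Submodule.coe_smul, zero_smul, add_zero] at hG'
    rw [hG']
    exact arc_smul_of_e _ (h1 _ (by simp [level, hl2]) (by simp) _ G.2)
  · refine e_smul_eq_zero (hrad F hF) (fun b hb hr => ?_) (fun b _ => rfl)
    have hvb := hv b
    revert hb hr hvb
    generalize v b = x
    intro hb hr hvb
    simp [level] at hy
    cases x <;> simp [Reaches, level] at hb hr hvb <;> omega

/-- Over the level zero, the syzygy of a module of finite projective dimension lives on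
`d_1, …, d_r`. -/
theorem e_smul_ker_eq_zero_of_level_zero (hrad : ∀ F, f F = 0 → InRad F.1)
    (hv : ∀ b, (v b).level = 0) {n : ℕ}
    (hpd : PdLT (Lam K r m) (LinearMap.ker f) (n + 1)) {y : Vert r m}
    (hy : ∀ j hj, 1 ≤ j → y ≠ .d j hj) (F : LinearMap.ker f) : e K y • F = 0 := by
  have h1 : ∀ z : Vert r m, (∀ x : Vert r m, x.level = 0 → x ≠ z → ¬ x.Reaches z) →
      loop K z = 0 → ∀ G : LinearMap.ker f, e K z • G = 0 := by
    rintro z hz hz' ⟨G, hG⟩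
    ext1
    exact e_smul_eq_zero (hrad G hG) (fun b hb => hz _ (hv b) hb) (fun b _ => hz')
  have h2 : ∀ t z : Vert r m,
      ResolvesFin (Lam K r m) (loop K z) (e K z) (loop K z) (arc K t z) →
      (∀ G : LinearMap.ker f, e K t • G = 0) → ∀ G : LinearMap.ker f, e K z • G = 0 := by
    intro t z hz ht G
    have hker : ∀ G : LinearMap.ker f, loop K z • G = 0 := by
      rintro ⟨G, hG⟩
      ext1
      exact loop_smul_eq_zero (hrad G hG) z
    obtain ⟨G', G'', h⟩ := hz n _ hpd G (hker G)
    rw [h, hker, arc_smul_of_e _ (ht _), add_zero]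
  have ha : ∀ G : LinearMap.ker f, e K (.a 0 (by omega)) • G = 0 := h1 (.a 0 (by omega))
    (fun x hx hne hr => by
      cases x <;> simp [Reaches, level] at hx hne hr <;> omega) rfl
  have hb : ∀ G : LinearMap.ker f, e K (.b 0 (by omega)) • G = 0 := h1 (.b 0 (by omega))
    (fun x hx hne hr => by
      cases x <;> simp [Reaches, level] at hx hne hr <;> omega) rfl
  have hc : ∀ G : LinearMap.ker f, e (r := r) (m := m) K (.c 0 (by omega) (by omega)) • G = 0 := by
    intro G
    have hker : ∀ G : LinearMap.ker f,
        arc (r := r) (m := m) K (.c 0 (by omega) (by omega)) .w • G = 0 := by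
      rintro ⟨G, hG⟩
      ext1
      refine arc_smul_eq_zero (hrad G hG) (by simp) (fun b hb hr hr' => ?_)
      have hvb := hv b
      revert hb hr hr' hvb
      generalize v b = x
      intro hb hr hr' hvb
      cases x <;> simp [Reaches, level] at hb hr hr' hvb <;> omega
    obtain ⟨G', G'', h⟩ := resolvesFin_c0 n _ hpd G (hker G)
    rw [h, arc_smul_of_e _ (ha _), zero_smul, add_zero]
  by_cases hy0 : y.level = 0
  swap
  · refine h1 y (fun x hx hne hr => ?_) ?_ F
    · cases x <;> cases y <;> simp [Reaches, level] at hx hy0 hne hr <;> omega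
    · cases y <;> simp [level] at hy0 <;> rfl
  cases y with
  | a i h => obtain rfl : i = 0 := hy0; exact ha F
  | b i h => obtain rfl : i = 0 := hy0; exact hb F
  | c i h h' => obtain rfl : i = 0 := hy0; exact hc F
  | bneg => exact h2 _ _ resolvesFin_bneg hb F
  | cneg => exact h2 _ _ resolvesFin_cneg hc F
  | u => exact h2 _ _ resolvesFin_u ha F
  | v => exact h2 _ _ resolvesFin_v hb F
  | w => exact h2 _ _ resolvesFin_w hc F
  | d i h =>
    obtain rfl : i = 0 := by
      by_contra h0
      exact hy i h (by omega) rfl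
    refine h1 _ (fun x hx hne hr => ?_) rfl F
    cases x <;> simp [Reaches, level] at hx hne hr <;> omega

end Level

/-- A module of finite projective dimension that vanishes above the level `l` has projective
dimension at most `r + l`. -/
theorem pdLT_of_level_le {N : Type u} [AddCommGroup N] [Module (Lam K r m) N] (l : ℕ) {n : ℕ}
    (hn : PdLT (Lam K r m) N n)
    (h : ∀ y : Vert r m, l < y.level → ∀ x : N, e K y • x = 0) :
    PdLT (Lam K r m) N (r + l + 1) := by
  induction l generalizing N n with
  | zero =>
    obtain ⟨B, v, f, hf, hrad, hv⟩ := exists_cover (K := K) (r := r) (m := m) N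
    refine PdLT.of_ker hf ?_
    have hk := (pdLT_ker_iff hf n).1 (hn.mono (by omega))
    refine pdLT_of_support_d r 1 (by omega) fun y hy F => ?_
    exact e_smul_ker_eq_zero_of_level_zero hrad
      (fun b => Nat.le_zero.1 (level_le_of_cover hv h b)) hk hy F
  | succ l ih =>
    obtain ⟨B, v, f, hf, hrad, hv⟩ := exists_cover (K := K) (r := r) (m := m) N
    refine PdLT.of_ker hf ?_
    have hk := (pdLT_ker_iff hf n).1 (hn.mono (by omega))
    refine ih hk fun y hy F => ?_
    ext1
    exact e_smul_ker_eq_zero hrad (level_le_of_cover hv h) (by omega) hk hy F.1 F.2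

/-! ### Lower bounds for projective dimensions -/

/-- The end of the arrow that starts in `a_k` and is not the first arrow of the word of `M_k`: it
is `d_0` for `k = 1` and `a_{k-1}` for `k ≥ 2`. The value for `k = 0` is irrelevant. -/
def trimVert : ∀ k : ℕ, k ≤ m → Vert r m
  | 0, _ => .u
  | 1, _ => .d 0 (by omega)
  | k + 2, h => .a (k + 1) (by omega)

variable (r m K) in
/-- The residue class of `α_{k+1}`, or zero if there is no such arrow. -/
def enter (k : ℕ) : Lam K r m :=
  if h : k + 1 ≤ m then arc K (.a (k + 1) h) (.a k (by omega)) else 0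

theorem resolves_enter {k : ℕ} (hk : 1 ≤ k) (h : k ≤ m) :
    Resolves (Lam K r m) (arc K (.a k h) (trimVert k h)) (e K (.a k h)) (enter r m K k) 0 := by
  unfold enter
  obtain rfl | ⟨k, rfl⟩ : k = 1 ∨ ∃ k', k = k' + 2 := by
    rcases k with _ | _ | k <;> simp at hk ⊢
  · split_ifs with h'
    · refine resolves_arc (by simp [Reaches]) (by simp [Reaches, trimVert]) (by simp [trimVert])
        rfl (fun x hr => ?_) 0
      cases x <;> simp [Reaches, trimVert] at hr ⊢ <;> omega
    · refine resolves_arc_zero (by simp [Reaches, trimVert]) (by simp [trimVert])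
        rfl (fun x hr => ?_) _ _
      cases x <;> simp [Reaches, trimVert] at hr ⊢ <;> omega
  · split_ifs with h'
    · refine resolves_arc (by simp [Reaches]) (by simp [Reaches, trimVert]) (by simp [trimVert])
        rfl (fun x hr => ?_) 0
      cases x <;> simp [Reaches, trimVert] at hr ⊢ <;> omega
    · refine resolves_arc_zero (by simp [Reaches, trimVert]) (by simp [trimVert])
        rfl (fun x hr => ?_) _ _
      cases x <;> simp [Reaches, trimVert] at hr ⊢ <;> omega

/-- The vertex from which `d_j` is entered: `a_1` for `j = 0`, and `d_{j-1}` otherwise. -/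
def prevD (h1 : 1 ≤ m) : ∀ j : ℕ, j ≤ r → Vert r m
  | 0, _ => .a 1 h1
  | j + 1, h => .d j (by omega)

theorem resolves_d (h1 : 1 ≤ m) (j : ℕ) (h : j + 1 ≤ r) :
    Resolves (Lam K r m) (arc K (.d j (by omega)) (.d (j + 1) h)) (e K (.d j (by omega)))
      (arc K (prevD h1 j (by omega)) (.d j (by omega))) 0 := by
  cases j with
  | zero =>
    refine resolves_arc (by simp [Reaches, prevD]) (by simp [Reaches]) (by simp)
      rfl (fun x hr => ?_) 0
    cases x <;> simp [Reaches, prevD] at hr ⊢ <;> omega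
  | succ j =>
    refine resolves_arc (by simp [Reaches, prevD]) (by simp [Reaches]) (by simp)
      rfl (fun x hr => ?_) 0
    cases x <;> simp [Reaches, prevD] at hr ⊢ <;> omega

theorem resolvesLT_d (h1 : 1 ≤ m) (k j : ℕ) (hkj : j + k + 1 = r) :
    ResolvesLT (Lam K r m) (k + 1)
      (arc K (.d j (by omega)) (.d (j + 1) (by omega))) (e K (.d j (by omega)))
      (arc K (prevD h1 j (by omega)) (.d j (by omega))) 0 := by
  induction k generalizing j with
  | zero => exact ResolvesLT.one (resolves_d h1 j (by omega))
  | succ k ih =>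
    refine (ih (j + 1) (by omega)).succ ?_ (e_mul_arc _ _)
      (fun a b hab => by rw [hab, zero_mul]) (resolves_d h1 j (by omega))
    rw [prevD, arc_mul_arc (by simp [Reaches]) (by simp [Reaches]),
      arc_of_not (by simp [Reaches]; omega)]

/-- In a module of projective dimension less than `r + k`, an element of `e_{a_k} N` that the arrow
from `a_k` to `trimVert k` annihilates is a multiple of `α_{k+1}`. The chain of equations starts
with the arrow `d_{r-1} → d_r` and runs against the arrows up to `a_1 → d_0`, and then through
`α_2, …, α_k`. -/
theorem resolvesLT_enter (hr : 1 ≤ r) {k : ℕ} (hk : 1 ≤ k) (h : k ≤ m) :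
    ResolvesLT (Lam K r m) (r + k) (arc K (.a k h) (trimVert k h)) (e K (.a k h))
      (enter r m K k) 0 := by
  induction k, hk using Nat.le_induction with
  | base =>
    obtain ⟨r, rfl⟩ : ∃ r', r = r' + 1 := ⟨r - 1, by omega⟩
    have h1 := resolvesLT_d (K := K) (r := r + 1) h r 0 (by omega)
    refine h1.succ ?_ (e_mul_arc _ _) (fun a b hab => by rw [hab, zero_mul])
      (resolves_enter le_rfl h)
    rw [arc_mul_arc (by simp [Reaches, prevD]) (by simp [Reaches]),
      arc_of_not (by simp [Reaches, prevD])]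
  | succ k hk ih =>
    have h1 := ih (by omega)
    obtain ⟨n, hn⟩ : ∃ n, r + k = n + 1 := ⟨r + k - 1, by omega⟩
    rw [hn] at h1
    have h2 : trimVert (r := r) (k + 1) h = .a k (by omega) := by
      obtain ⟨k, rfl⟩ : ∃ k', k = k' + 1 := ⟨k - 1, by omega⟩
      rfl
    have h3 : enter r m K k = arc K (.a (k + 1) h) (.a k (by omega)) := dif_pos h
    rw [h3] at h1
    have h4 := h1.succ ?_ (e_mul_arc _ _) (fun a b hab => by rw [hab, zero_mul])
      (h2 ▸ resolves_enter (by omega) h)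
    · rw [h2]
      rwa [show r + (k + 1) = n + 2 by omega]
    · have h5 : Reaches (.a k (by omega) : Vert r m) (trimVert k (by omega)) := by
        obtain rfl | ⟨k, rfl⟩ : k = 1 ∨ ∃ k', k = k' + 2 := by
          rcases k with _ | _ | k <;> simp at hk ⊢
        · simp [Reaches, trimVert]
        · simp [Reaches, trimVert]
      rw [arc_mul_arc (by simp [Reaches]) h5, arc_of_not]
      obtain rfl | ⟨k, rfl⟩ : k = 1 ∨ ∃ k', k = k' + 2 := by
        rcases k with _ | _ | k <;> simp at hk ⊢
      · simp [Reaches, trimVert]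
      · simp [Reaches, trimVert]

end Lam

end

/-! ### Syzygies of string modules -/

section

open Vert

variable {r m : ℕ} {K : Type u} [Field K]

namespace Lam

section Combinatorics

variable (T t b : ℕ → Vert r m) (s : Vert r m)

variable (K) in
/-- The generators of the syzygy of the string module with tops `T i`, sinks `t (i + 1)` and trim
vertex `t 0`; the first one comes from the trim relation and the others from the glueing of adjacent
generators. -/
def syzGen : ℕ → ProjSum K T
  | 0 => arc K (T 0) (t 0) • projGen K T 0
  | i + 1 => arc K (T (i + 1)) (t (i + 1)) • projGen K T (i + 1) -
      arc K (T i) (t (i + 1)) • projGen K T i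

/-- The combinatorial conditions under which the string module with tops `t i`, sinks `b i` and
trim vertex `s` is the syzygy of the one with tops `T i`, sinks `t (i + 1)` and trim vertex
`t 0`. The first five say that the paths in the two words do not vanish, the next three that
the elements `syzGen` satisfy the relations of the first module, and the last three that they
satisfy no others. -/
structure SyzygyCondition : Prop where
  left (i : ℕ) : (T i).Reaches (t (i + 1))
  right (i : ℕ) : (T i).Reaches (t i)
  bot_left (i : ℕ) : (t i).Reaches (b i)
  bot_right (i : ℕ) : (t (i + 1)).Reaches (b i)
  trim : (t 0).Reaches s
  not_left (i : ℕ) : ¬ (T (i + 1)).Reaches (b i)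
  not_right (i : ℕ) : ¬ (T i).Reaches (b (i + 1))
  not_trim : ¬ (T 0).Reaches s
  eq_bot (i : ℕ) (y : Vert r m) : (t i).Reaches y → (t (i + 1)).Reaches y → (T i).Reaches y →
    y = b i
  zero (i : ℕ) (y : Vert r m) : (t (i + 1)).Reaches y → ¬ (T i).Reaches y →
    ¬ (T (i + 1)).Reaches y → ((b i).Reaches y ∧ ¬ (t i).Reaches y) ∨
      ((b (i + 1)).Reaches y ∧ ¬ (t (i + 2)).Reaches y)
  zero_first (y : Vert r m) : (t 0).Reaches y → ¬ (T 0).Reaches y →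
    s.Reaches y ∨ ((b 0).Reaches y ∧ ¬ (t 1).Reaches y)

variable {T t b s}

theorem arc_smul_syzGen_zero (h : (T 0).Reaches (t 0)) {y : Vert r m} (hy : (t 0).Reaches y) :
    arc K (t 0) y • syzGen K T t 0 = arc K (T 0) y • projGen K T 0 := by
  rw [syzGen, smul_smul, arc_mul_arc h hy]

theorem arc_smul_syzGen_succ {i : ℕ} (h : (T i).Reaches (t (i + 1)))
    (h' : (T (i + 1)).Reaches (t (i + 1))) {y : Vert r m} (hy : (t (i + 1)).Reaches y) :
    arc K (t (i + 1)) y • syzGen K T t (i + 1) =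
      arc K (T (i + 1)) y • projGen K T (i + 1) - arc K (T i) y • projGen K T i := by
  rw [syzGen, smul_sub, smul_smul, smul_smul, arc_mul_arc h hy, arc_mul_arc h' hy]

theorem SyzygyCondition.glue (H : SyzygyCondition T t b s) (i : ℕ) :
    arc K (t i) (b i) • syzGen K T t i + arc K (t (i + 1)) (b i) • syzGen K T t (i + 1) = 0 := by
  rw [arc_smul_syzGen_succ (H.left i) (H.right _) (H.bot_right i), arc_of_not (H.not_left i),
    zero_smul, zero_sub]
  cases i with
  | zero => rw [arc_smul_syzGen_zero (H.right 0) (H.bot_left 0), add_neg_cancel]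
  | succ i =>
    rw [arc_smul_syzGen_succ (H.left i) (H.right _) (H.bot_left _), arc_of_not (H.not_right i),
      zero_smul, sub_zero, add_neg_cancel]

theorem SyzygyCondition.arc_smul_syzGen_eq_zero (H : SyzygyCondition T t b s) :
    arc K (t 0) s • syzGen K T t 0 = 0 := by
  rw [arc_smul_syzGen_zero (H.right 0) H.trim, arc_of_not H.not_trim, zero_smul]

theorem e_smul_syzGen (i : ℕ) : e K (t i) • syzGen K T t i = syzGen K T t i := by
  cases i with
  | zero => rw [syzGen, smul_smul, e_mul_arc]
  | succ i => rw [syzGen, smul_sub, smul_smul, smul_smul, e_mul_arc, e_mul_arc]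

theorem syzGen_mem_rad (h : ∀ i, T i ≠ t (i + 1)) (h' : ∀ i, T i ≠ t i) (i : ℕ) :
    syzGen K T t i ∈ rad r m K (ProjSum K T) := by
  cases i with
  | zero => exact arc_smul_mem_rad (h' 0) _
  | succ i => exact sub_mem (arc_smul_mem_rad (h' _) _) (arc_smul_mem_rad (h _) _)

/-- A linear map from the string module with tops `t i` to its presumptive copy in the projective
module is injective: a retraction over `K` sends the path from `T i` to `y` to the corresponding
path from `t i` to `y`, or from `t (i + 1)` to `y`. -/
theorem SyzygyCondition.injective (H : SyzygyCondition T t b s)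
    (hloop : ∀ i, loop K (t i) = 0) {N : Type u} [AddCommGroup N] [Module (Lam K r m) N]
    (z : ℕ → N) (hz : Submodule.span (Lam K r m) (Set.range z) = ⊤)
    (normed : ∀ i, e K (t i) • z i = z i)
    (glue : ∀ i, arc K (t i) (b i) • z i = arc K (t (i + 1)) (b i) • z (i + 1))
    (trim : arc K (t 0) s • z 0 = 0) (φ : N →ₗ[Lam K r m] ProjSum K T)
    (hφ : ∀ i, φ (z i) = (-1 : ℤ) ^ i • syzGen K T t i) : Function.Injective φ := by
  classical
  let _ : Module K N := Module.compHom N (algebraMap K (Lam K r m))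
  have _ : IsScalarTower K (Lam K r m) N := ⟨fun k a n => by
    change _ = algebraMap K (Lam K r m) k • a • n
    rw [smul_smul, Algebra.smul_def]⟩
  have sgn : ∀ (i : ℕ) (n : N), (-1 : ℤ) ^ i • (-1 : ℤ) ^ i • n = n := fun i n => by
    rw [smul_smul, ← mul_pow, neg_one_mul, neg_neg, one_pow, one_smul]
  let w : ℕ → Vert r m → N := fun i y =>
    if (t i).Reaches y then (-1 : ℤ) ^ i • arc K (t i) y • z i
    else if (t (i + 1)).Reaches y ∧ ¬ (T (i + 1)).Reaches y then
      (-1 : ℤ) ^ i • arc K (t (i + 1)) y • z (i + 1)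
    else 0
  let ψ : (ℕ →₀ Lam K r m) →ₗ[K] N :=
    Finsupp.lsum K fun i => ∑ y, (coeff K (T i) y).smulRight (w i y)
  let Ψ : ProjSum K T → N := fun F => ψ F.1
  have Ψadd : ∀ F G, Ψ (F + G) = Ψ F + Ψ G := fun F G => map_add ψ F.1 G.1
  have Ψsub : ∀ F G, Ψ (F - G) = Ψ F - Ψ G := fun F G => map_sub ψ F.1 G.1
  have Ψsmul : ∀ (c : K) F, Ψ (c • F) = c • Ψ F := fun c F => map_smul ψ c F.1
  have Ψz : ∀ (c : ℤ) F, Ψ (c • F) = c • Ψ F := fun c F => map_zsmul ψ c F.1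
  have Ψarc : ∀ j y, Ψ (arc K (T j) y • projGen K T j) =
      if (T j).Reaches y then w j y else 0 := by
    intro j y
    change ψ (arc K (T j) y • Finsupp.single j (e K (T j))) = _
    rw [Finsupp.smul_single, smul_eq_mul, arc_mul_e]
    simp only [ψ, Finsupp.lsum_single, LinearMap.sum_apply, LinearMap.smulRight_apply]
    split_ifs with hy
    · rw [Finset.sum_eq_single y, coeff_arc hy, one_smul]
      · intro y' _ hne
        rw [coeff_arc_of_ne (.inr hne.symm), zero_smul]
      · simp
    · rw [arc_of_not hy]
      simp
  have wleft : ∀ i y, (t i).Reaches y → w i y = (-1 : ℤ) ^ i • arc K (t i) y • z i :=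
    fun i y hy => if_pos hy
  have key : ∀ i y, (t i).Reaches y → Ψ (φ (arc K (t i) y • z i)) = arc K (t i) y • z i := by
    intro i y hy
    rw [map_smul, hφ, smul_comm, Ψz]
    cases i with
    | zero =>
      rw [arc_smul_syzGen_zero (H.right 0) hy, Ψarc]
      split_ifs with hT
      · rw [wleft 0 y hy, sgn]
      · rw [smul_zero]
        rcases H.zero_first y hy hT with h | ⟨h, h'⟩
        · rw [← arc_mul_arc H.trim h, mul_smul, trim, smul_zero]
        · rw [← arc_mul_arc (H.bot_left 0) h, mul_smul, glue, smul_smul,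
            arc_mul_arc (H.bot_right 0) h, arc_of_not h', zero_smul]
    | succ i =>
      rw [arc_smul_syzGen_succ (H.left i) (H.right _) hy, Ψsub, Ψarc, Ψarc]
      by_cases hT : (T (i + 1)).Reaches y
      · rw [if_pos hT, wleft (i + 1) y hy]
        have h0 : (if (T i).Reaches y then w i y else 0) = 0 := by
          split_ifs with hTi
          · by_cases hti : (t i).Reaches y
            · obtain rfl := H.eq_bot i y hti hy hTi
              exact absurd hT (H.not_left i)
            · exact (if_neg hti).trans (if_neg fun h => h.2 hT)
          · rfl
        rw [h0, sub_zero, sgn]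
      · rw [if_neg hT, zero_sub, smul_neg, pow_succ, mul_neg_one, neg_smul, neg_neg]
        split_ifs with hTi
        · by_cases hti : (t i).Reaches y
          · obtain rfl := H.eq_bot i y hti hy hTi
            rw [wleft i _ hti, sgn, glue]
          · rw [show w i y = _ from (if_neg hti).trans (if_pos ⟨hy, hT⟩), sgn]
        · rw [smul_zero]
          rcases H.zero i y hy hTi hT with ⟨h, h'⟩ | ⟨h, h'⟩
          · rw [← arc_mul_arc (H.bot_right i) h, mul_smul, ← glue, smul_smul,
              arc_mul_arc (H.bot_left i) h, arc_of_not h', zero_smul]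
          · rw [← arc_mul_arc (H.bot_left (i + 1)) h, mul_smul, glue, smul_smul,
              arc_mul_arc (H.bot_right (i + 1)) h, arc_of_not h', zero_smul]
  have φK : ∀ (c : K) (n : N), φ (c • n) = c • φ n := fun c n => by
    rw [← smul_one_smul (Lam K r m) c n, map_smul, smul_one_smul]
  have Ψzero : Ψ 0 = 0 := map_zero ψ
  have hall : ∀ (i : ℕ) (a : Lam K r m), Ψ (φ (a • z i)) = a • z i := by
    intro i a
    induction a using induction_on with
    | hadd a b ha hb => rw [add_smul, map_add, Ψadd, ha, hb]
    | hsmul c a ha => rw [smul_assoc, φK, Ψsmul, ha]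
    | harc x y =>
      by_cases hx : x = t i
      · subst hx
        by_cases hy : (t i).Reaches y
        · exact key i y hy
        · rw [arc_of_not hy, zero_smul, map_zero, Ψzero]
      · rw [← normed, smul_smul, arc_mul_e_of_ne hx, zero_smul, map_zero, Ψzero]
    | hloop y =>
      have h0 : loop K y • z i = 0 := by
        by_cases hy : y = t i
        · rw [hy, hloop, zero_smul]
        · rw [← normed, smul_smul, loop_mul_e_of_ne hy, zero_smul]
      rw [h0, map_zero, Ψzero]
    | hzero => rw [zero_smul, map_zero, Ψzero]
  have hinv : ∀ n, Ψ (φ n) = n := by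
    intro n
    have hn : n ∈ Submodule.span (Lam K r m) (Set.range z) := hz ▸ Submodule.mem_top
    obtain ⟨c, rfl⟩ := (Finsupp.mem_span_range_iff_exists_finsupp).1 hn
    rw [Finsupp.sum, map_sum]
    induction c.support using Finset.induction_on with
    | empty => simpa using Ψzero
    | insert i S hi ih => rw [Finset.sum_insert hi, Finset.sum_insert hi, Ψadd, hall, ih]
  exact Function.LeftInverse.injective hinv

end Combinatorics

end Lam

end

/-! ### String modules -/

section

open Vert

variable {r m : ℕ} {K : Type u} [Field K]

namespace RightWord

/-- A condition on right infinite words under which their string relations are expressed by the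
elements `arc`: the paths have positive length and contain no loops, and exactly one arrow
annihilates the generator `z_0` of the string module, namely one that ends in `s`. -/
structure IsLoopFree (W : RightWord (Vert r m)) (s : Vert r m) : Prop where
  q (i : ℕ) : LoopFree (W.q i)
  p (i : ℕ) : LoopFree (W.p i)
  ne_q (i : ℕ) : W.top i ≠ W.bot i
  ne_p (i : ℕ) : W.top (i + 1) ≠ W.bot i
  ne_trim : W.top 0 ≠ s
  eq_trim {y : Vert r m} (f : Arr r m (W.top 0) y) :
    (∀ s' : Quiver.Path y (W.bot 0), W.q 0 ≠ f.path.comp s') → y = s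
  exists_trim : ∃ f : Arr r m (W.top 0) s, ∀ s' : Quiver.Path s (W.bot 0), W.q 0 ≠ f.path.comp s'

variable (W : RightWord (Vert r m)) (s : Vert r m)

variable (K) in
/-- The generators of the string module. -/
def gen (i : ℕ) : W.StringModule K := Submodule.Quotient.mk (Finsupp.single i 1)

/-- The vertices of the generators of the syzygy of a string module: the trim vertex and the
sinks. -/
def nextTop : ℕ → Vert r m
  | 0 => s
  | i + 1 => W.bot i

variable {W s}

theorem mk_single (i : ℕ) (a : Lam K r m) :
    (Submodule.Quotient.mk (Finsupp.single i a) : W.StringModule K) = a • gen K W i := by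
  rw [gen, ← Submodule.Quotient.mk_smul, Finsupp.smul_single, smul_eq_mul, mul_one]

theorem span_gen : Submodule.span (Lam K r m) (Set.range (gen K W)) = ⊤ := by
  rw [eq_top_iff]
  rintro x -
  obtain ⟨F, rfl⟩ := Submodule.Quotient.mk_surjective _ x
  induction F using Finsupp.induction_linear with
  | zero => exact zero_mem _
  | add F G hF hG =>
    rw [Submodule.Quotient.mk_add]
    exact add_mem hF hG
  | single i a =>
    rw [mk_single]
    exact Submodule.smul_mem _ _ (Submodule.subset_span ⟨i, rfl⟩)

theorem mk_eq_zero {F : ℕ →₀ Lam K r m} (h : StringRelation K W F) :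
    (Submodule.Quotient.mk F : W.StringModule K) = 0 :=
  (Submodule.Quotient.mk_eq_zero _).2 (Submodule.subset_span h)

theorem e_smul_gen (i : ℕ) : Lam.e K (W.top i) • gen K W i = gen K W i := by
  have h := mk_eq_zero (StringRelation.normed (K := K) (W := W) i)
  rwa [Submodule.Quotient.mk_sub, mk_single, mk_single, one_smul, sub_eq_zero] at h

theorem IsLoopFree.glue (h : W.IsLoopFree s) (i : ℕ) :
    Lam.arc K (W.top i) (W.bot i) • gen K W i =
      Lam.arc K (W.top (i + 1)) (W.bot i) • gen K W (i + 1) := by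
  have h1 := mk_eq_zero (StringRelation.glue (K := K) (W := W) i)
  rwa [Submodule.Quotient.mk_sub, mk_single, mk_single, sub_eq_zero, Lam.path_eq_arc (h.q i),
    Lam.path_eq_arc (h.p i)] at h1

theorem IsLoopFree.trim (h : W.IsLoopFree s) : Lam.arc K (W.top 0) s • gen K W 0 = 0 := by
  obtain ⟨f, hf⟩ := h.exists_trim
  have h1 := mk_eq_zero (StringRelation.trim (K := K) (W := W) f hf)
  rwa [mk_single, Lam.path_arrow_eq_arc f h.ne_trim] at h1

theorem IsLoopFree.eq_arc_of_trim (h : W.IsLoopFree s) {y : Vert r m} (f : Arr r m (W.top 0) y)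
    (hf : ∀ s' : Quiver.Path y (W.bot 0), W.q 0 ≠ f.path.comp s') :
    Lam.path K f.path = Lam.arc K (W.top 0) s := by
  obtain rfl := h.eq_trim f hf
  exact Lam.path_arrow_eq_arc f h.ne_trim

/-- The universal property of the string module. -/
theorem IsLoopFree.exists_lift (h : W.IsLoopFree s) {N : Type*} [AddCommGroup N]
    [Module (Lam K r m) N] (z : ℕ → N) (normed : ∀ i, Lam.e K (W.top i) • z i = z i)
    (glue : ∀ i, Lam.arc K (W.top i) (W.bot i) • z i =
      Lam.arc K (W.top (i + 1)) (W.bot i) • z (i + 1))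
    (trim : Lam.arc K (W.top 0) s • z 0 = 0) :
    ∃ φ : W.StringModule K →ₗ[Lam K r m] N, ∀ i, φ (gen K W i) = z i := by
  refine ⟨Submodule.liftQ _ (Finsupp.linearCombination (Lam K r m) z) ?_, fun i => ?_⟩
  · rw [Submodule.span_le]
    intro F hF
    rw [SetLike.mem_coe, LinearMap.mem_ker]
    cases hF with
    | normed i =>
      rw [map_sub, Finsupp.linearCombination_single, Finsupp.linearCombination_single, one_smul,
        normed, sub_self]
    | glue i =>
      rw [map_sub, Finsupp.linearCombination_single, Finsupp.linearCombination_single,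
        Lam.path_eq_arc (h.q i), Lam.path_eq_arc (h.p i), glue, sub_self]
    | trim f hf =>
      rw [Finsupp.linearCombination_single, h.eq_arc_of_trim f hf, trim]
  · rw [gen, Submodule.liftQ_apply, Finsupp.linearCombination_single, one_smul]

variable (K W) in
/-- The canonical map from the direct sum of the projective modules `Λ e_{top i}` onto the string
module. -/
def cover : Lam.ProjSum K W.top →ₗ[Lam K r m] W.StringModule K :=
  (Submodule.mkQ _) ∘ₗ Lam.ProjSum.incl K W.top

theorem cover_projGen (i : ℕ) : cover K W (Lam.projGen K W.top i) = gen K W i := by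
  change Submodule.Quotient.mk (Finsupp.single i (Lam.e K (W.top i))) = _
  rw [mk_single, e_smul_gen]

theorem cover_surjective : Function.Surjective (cover K W) := by
  rw [← LinearMap.range_eq_top, eq_top_iff, ← span_gen, Submodule.span_le]
  rintro _ ⟨i, rfl⟩
  exact ⟨_, cover_projGen i⟩

/-- The kernel of the cover is generated by the images of the string relations under the projection
of the free module onto its projective summand. -/
theorem IsLoopFree.ker_cover (h : W.IsLoopFree s) :
    LinearMap.ker (cover K W) =
      Submodule.span (Lam K r m) (Set.range (Lam.syzGen K W.top (W.nextTop s))) := by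
  apply le_antisymm
  · intro F hF
    have hF' : F.1 ∈ Submodule.span (Lam K r m) {z | StringRelation K W z} :=
      (Submodule.Quotient.mk_eq_zero _).1 hF
    have h1 := Submodule.mem_map_of_mem (f := Lam.projRetract K W.top) hF'
    rw [Lam.projRetract_coe, Submodule.map_span] at h1
    refine Submodule.span_le.2 ?_ h1
    rintro _ ⟨G, hG, rfl⟩
    cases hG with
    | normed i =>
      rw [map_sub, Lam.projRetract_single, Lam.projRetract_single, one_smul]
      have h2 : Lam.e K (W.top i) • Lam.projGen K W.top i = Lam.projGen K W.top i := by
        refine Subtype.ext ?_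
        rw [Lam.ProjSum.coe_smul]
        change _ • Finsupp.single i _ = Finsupp.single i _
        rw [Finsupp.smul_single, smul_eq_mul, Lam.e_mul_e]
      rw [h2, sub_self]
      exact zero_mem _
    | glue i =>
      rw [map_sub, Lam.projRetract_single, Lam.projRetract_single, Lam.path_eq_arc (h.q i),
        Lam.path_eq_arc (h.p i), ← neg_sub]
      exact neg_mem (Submodule.subset_span ⟨i + 1, rfl⟩)
    | trim f hf =>
      rw [Lam.projRetract_single, h.eq_arc_of_trim f hf]
      exact Submodule.subset_span ⟨0, rfl⟩
  · rw [Submodule.span_le]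
    rintro _ ⟨i, rfl⟩
    rw [SetLike.mem_coe, LinearMap.mem_ker]
    cases i with
    | zero => rw [Lam.syzGen, map_smul, cover_projGen]; exact h.trim
    | succ i =>
      rw [Lam.syzGen, map_sub, map_smul, map_smul, cover_projGen, cover_projGen, sub_eq_zero]
      exact (h.glue i).symm

theorem IsLoopFree.ker_cover_le_rad (h : W.IsLoopFree s) {F : Lam.ProjSum K W.top}
    (hF : cover K W F = 0) : F ∈ Lam.rad r m K (Lam.ProjSum K W.top) := by
  have h1 : F ∈ LinearMap.ker (cover K W) := hF
  rw [h.ker_cover] at h1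
  clear hF
  induction h1 using Submodule.span_induction with
  | zero => exact zero_mem _
  | add a b _ _ ha hb => exact add_mem ha hb
  | smul c a _ ha => exact Lam.smul_rad c ha
  | mem a ha =>
    obtain ⟨i, rfl⟩ := ha
    refine Lam.syzGen_mem_rad h.ne_q (fun i => ?_) i
    cases i with
    | zero => exact h.ne_trim
    | succ i => exact h.ne_p i

theorem IsLoopFree.isProjectiveCover (h : W.IsLoopFree s) : IsProjectiveCover (cover K W) :=
  Lam.isProjectiveCover_of_le_rad cover_surjective fun _ hF => h.ker_cover_le_rad hF

theorem IsLoopFree.gen_zero_ne_zero (h : W.IsLoopFree s) : gen K W 0 ≠ 0 := by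
  intro h0
  rw [← cover_projGen] at h0
  have h1 := h.ker_cover_le_rad h0
  have h2 : ∀ F ∈ Lam.rad r m K (Lam.ProjSum K W.top),
      Lam.coeff K (W.top 0) (W.top 0) (F.1 0) = 0 := by
    intro F hF
    induction hF using Submodule.span_induction with
    | zero => exact map_zero _
    | add a b _ _ ha hb =>
      rw [Lam.ProjSum.coe_add, Finsupp.add_apply, map_add, ha, hb, add_zero]
    | smul c a _ ha =>
      rw [Lam.ProjSum.coe_ksmul, Finsupp.smul_apply, map_smul, ha, smul_zero]
    | mem a ha =>
      rcases ha with ⟨x, y, n, hxy, rfl⟩ | ⟨y, n, rfl⟩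
      · rw [Lam.ProjSum.coe_smul, Finsupp.smul_apply, smul_eq_mul]
        by_cases hy : y = W.top 0
        · subst hy
          by_cases hr : x.Reaches (W.top 0)
          · rw [Lam.coeff_arc_mul (.refl _) hr hxy, Lam.coeff_of_not]
            intro hr'
            have := hr.height_lt hxy
            have := hr'.height_lt hxy.symm
            omega
          · rw [Lam.arc_of_not hr, zero_mul, map_zero]
        · rw [← Lam.e_mul_arc, mul_assoc, Lam.coeff_e_mul_of_ne hy]
      · rw [Lam.ProjSum.coe_smul, Finsupp.smul_apply, smul_eq_mul, Lam.loop_mul_eq, map_smul,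
          Lam.coeff_loop, smul_zero]
  have h3 := h2 _ h1
  change Lam.coeff K _ _ (Finsupp.single 0 (Lam.e K (W.top 0)) 0) = 0 at h3
  rw [Finsupp.single_eq_same, ← Lam.arc_self, Lam.coeff_arc (.refl _)] at h3
  exact one_ne_zero h3

/-- If the tops of `W'` are the trim vertex and the sinks of `W`, and the combinatorial conditions
hold, then the string module of `W'` is the syzygy of the string module of `W`. -/
theorem IsLoopFree.nonempty_equiv {W' : RightWord (Vert r m)} {s' : Vert r m}
    (h : W.IsLoopFree s) (h' : W'.IsLoopFree s') (htop : W'.top = W.nextTop s)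
    (hloop : ∀ i, Lam.loop K (W'.top i) = 0)
    (H : Lam.SyzygyCondition W.top W'.top W'.bot s') :
    Nonempty (W'.StringModule K ≃ₗ[Lam K r m] LinearMap.ker (cover K W)) := by
  have htop' := fun i => congrFun htop i
  rw [htop] at H
  obtain ⟨φ, hφ⟩ := h'.exists_lift (K := K)
    -- The signs turn the sums in `SyzygyCondition.glue` into the differences in the relations.
    (fun i => (-1 : ℤ) ^ i • Lam.syzGen K W.top (W.nextTop s) i)
    (fun i => by rw [smul_comm, htop', Lam.e_smul_syzGen])
    (fun i => by
      rw [smul_comm, smul_comm (Lam.arc K (W'.top (i + 1)) (W'.bot i)), pow_succ, mul_neg_one,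
        neg_smul, ← smul_neg, htop', htop', eq_neg_of_add_eq_zero_left (H.glue i)])
    (by rw [smul_comm, htop', H.arc_smul_syzGen_eq_zero, smul_zero])
  have hinj : Function.Injective φ := by
    refine H.injective (fun i => htop' i ▸ hloop i) (gen K W') span_gen
      (fun i => by rw [← htop', e_smul_gen]) (fun i => ?_) ?_ φ hφ
    · rw [← htop', ← htop', h'.glue]
    · rw [← htop', h'.trim]
  have hrange : LinearMap.range φ = LinearMap.ker (cover K W) := by
    rw [h.ker_cover, ← Submodule.map_top, ← span_gen, Submodule.map_span, ← Set.range_comp]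
    apply le_antisymm <;> rw [Submodule.span_le] <;> rintro _ ⟨i, rfl⟩
    · rw [Function.comp_apply, hφ, SetLike.mem_coe]
      refine zsmul_mem ?_ _
      exact Submodule.subset_span ⟨i, rfl⟩
    · have h1 : Lam.syzGen K W.top (W.nextTop s) i =
          (-1 : ℤ) ^ i • (φ ∘ gen K W') i := by
        rw [Function.comp_apply, hφ, smul_smul, ← mul_pow, neg_one_mul, neg_neg, one_pow, one_smul]
      rw [h1]
      refine zsmul_mem ?_ _
      exact Submodule.subset_span ⟨i, rfl⟩
  exact ⟨(LinearEquiv.ofInjective φ hinj).trans (LinearEquiv.ofEq _ _ hrange)⟩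

end RightWord

end

/-! ### The words of the modules `M_k` -/

section

open Vert

variable {r m : ℕ} {K : Type u} [Field K]

namespace RightWord

/-- The words `M_k` have period two after their first syllable, so that conditions on them need
to be checked only at the first three places. -/
theorem forall_of_periodic {P : ℕ → Prop} (h0 : P 0) (h1 : P 1) (h2 : P 2)
    (h : ∀ n, P (n + 1) → P (n + 3)) : ∀ n, P n
  | 0 => h0
  | 1 => h1
  | 2 => h2
  | n + 3 => h n (forall_of_periodic h0 h1 h2 h (n + 1))

theorem isLoopFree_periodic {x y z f₀ f₁ f₂ s : Vert r m}
    {q₀ : Quiver.Path x f₀} {p₁ : Quiver.Path y f₀}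
    {s₁ : Quiver.Path y f₁} {t₁ : Quiver.Path z f₁}
    {s₂ : Quiver.Path z f₂} {t₂ : Quiver.Path y f₂}
    (hq₀ : LoopFree q₀) (hp₁ : LoopFree p₁) (hs₁ : LoopFree s₁) (ht₁ : LoopFree t₁)
    (hs₂ : LoopFree s₂) (ht₂ : LoopFree t₂)
    (hx₀ : x ≠ f₀) (hy₀ : y ≠ f₀) (hy₁ : y ≠ f₁) (hz₁ : z ≠ f₁) (hz₂ : z ≠ f₂) (hy₂ : y ≠ f₂)
    (f : Arr r m x s) (hxs : x ≠ s) (hx : x.Reaches f₀) (hs : ¬ s.Reaches f₀)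
    (hf : ∀ {y : Vert r m} (f : Arr r m x y),
      (∀ s' : Quiver.Path y f₀, q₀ ≠ f.path.comp s') → y = s) :
    (periodic q₀ p₁ s₁ t₁ s₂ t₂).IsLoopFree s where
  q := forall_of_periodic hq₀ hs₁ hs₂ fun _ h => h
  p := forall_of_periodic hp₁ ht₁ ht₂ fun _ h => h
  ne_q := forall_of_periodic hx₀ hy₁ hz₂ fun _ h => h
  ne_p := forall_of_periodic hy₀ hz₁ hy₂ fun _ h => h
  ne_trim := hxs
  eq_trim := hf
  exists_trim := ⟨f, fun s' h' => by
    change q₀ = _ at h'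
    rw [h'] at hq₀
    exact hs (hq₀.reaches_right hx)⟩

theorem isLoopFree_stringWord {k : ℕ} (hk : 1 ≤ k) (h : k ≤ m) :
    (stringWord r m k hk h).IsLoopFree (Lam.trimVert k h) := by
  rcases k with _ | _ | _ | _ | k
  · omega
  · refine isLoopFree_periodic ?_ ?_ ?_ ?_ ?_ ?_ ?_ ?_ ?_ ?_ ?_ ?_ (.α1' h) ?_ ?_ ?_ ?_
    any_goals simp [loopFree_comp, Arr.loopFree_path, Reaches, Lam.trimVert]
    intro y f hf
    cases f with
    | α i _ => exact absurd rfl (hf .nil)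
    | α1' _ => rfl
  · refine isLoopFree_periodic ?_ ?_ ?_ ?_ ?_ ?_ ?_ ?_ ?_ ?_ ?_ ?_ (.α 1 h) ?_ ?_ ?_ ?_
    any_goals simp [loopFree_comp, Arr.loopFree_path, Reaches, Lam.trimVert]
    intro y f hf
    cases f with
    | α i _ => rfl
    | α2' _ => exact absurd rfl (hf (Arr.γ2 h).path)
  · refine isLoopFree_periodic ?_ ?_ ?_ ?_ ?_ ?_ ?_ ?_ ?_ ?_ ?_ ?_ (.α 2 h) ?_ ?_ ?_ ?_
    any_goals simp [loopFree_comp, Arr.loopFree_path, Reaches, Lam.trimVert]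
    intro y f hf
    cases f with
    | α i _ => rfl
    | α' i _ => exact absurd rfl (hf .nil)
  · refine isLoopFree_periodic ?_ ?_ ?_ ?_ ?_ ?_ ?_ ?_ ?_ ?_ ?_ ?_ (.α (k + 3) h) ?_ ?_ ?_ ?_
    any_goals simp [Arr.loopFree_path, Reaches, Lam.trimVert]
    intro y f hf
    cases f with
    | α i _ => rfl
    | α' i _ => exact absurd rfl (hf .nil)

theorem top_eq_nextTop {x' y' z' f₀ f₁ f₂ s : Vert r m} (h0 : y' = f₀) (h1 : z' = f₁)
    (h2 : y' = f₂) (hs : x' = s) {W : RightWord (Vert r m)} (hW : W.bot = perTop f₀ f₁ f₂) :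
    perTop x' y' z' = W.nextTop s := by
  funext i
  cases i with
  | zero => exact hs
  | succ i =>
    rw [nextTop, hW]
    exact forall_of_periodic (P := fun i => perTop x' y' z' (i + 1) = perTop f₀ f₁ f₂ i)
      h0 h1 h2 (fun n h => h) i

theorem stringWord_top {k : ℕ} (hk : 1 ≤ k) (h : k + 1 ≤ m) :
    (stringWord r m k hk (by omega)).top =
      (stringWord r m (k + 1) (by omega) h).nextTop (Lam.trimVert (k + 1) h) := by
  rcases k with _ | _ | _ | _ | k
  · omega
  · refine top_eq_nextTop ?_ ?_ ?_ ?_ rfl <;> rfl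
  · refine top_eq_nextTop ?_ ?_ ?_ ?_ rfl <;> rfl
  · refine top_eq_nextTop ?_ ?_ ?_ ?_ rfl <;> rfl
  · refine top_eq_nextTop ?_ ?_ ?_ ?_ rfl <;> rfl

theorem loop_top {k : ℕ} (hk : 1 ≤ k) (h : k ≤ m) (i : ℕ) :
    Lam.loop K ((stringWord r m k hk h).top i) = 0 := by
  rcases k with _ | _ | _ | _ | k
  · omega
  all_goals
    revert i
    exact forall_of_periodic rfl rfl rfl fun _ h => h

theorem syzygyCondition_stringWord {k : ℕ} (hk : 1 ≤ k) (h : k + 1 ≤ m) :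
    Lam.SyzygyCondition (stringWord r m (k + 1) (by omega) h).top
      (stringWord r m k hk (by omega)).top (stringWord r m k hk (by omega)).bot
      (Lam.trimVert k (by omega)) := by
  rcases k with _ | _ | _ | _ | k
  · omega
  all_goals constructor
  all_goals try refine forall_of_periodic ?_ ?_ ?_ (fun _ h => h)
  all_goals try (intro (y : Vert r m); cases y)
  all_goals simp [stringWord, periodic, perTop, Reaches, Lam.trimVert]
  all_goals omega

end RightWord

end

/-! ### Projective dimensions of the modules `M_k` -/

section

open Vert

variable {r m : ℕ} {K : Type u} [Field K]

namespace Lam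

section

variable {T t : ℕ → Vert r m}

theorem linearCombination_syzGen_zero (F : ℕ →₀ Lam K r m) :
    (Finsupp.linearCombination (Lam K r m) (fun i => syzGen K T t (i + 1)) F).1 0 =
      -(F 0 * arc K (T 0) (t 1)) := by
  classical
  induction F using Finsupp.induction_linear with
  | zero => rw [LinearMap.map_zero, ProjSum.coe_zero, Finsupp.zero_apply, zero_mul, neg_zero]
  | add F G hF hG =>
    rw [LinearMap.map_add, ProjSum.coe_add, Finsupp.add_apply, hF, hG, Finsupp.add_apply,
      add_mul, neg_add]
  | single i a =>
    rw [Finsupp.linearCombination_single, ProjSum.coe_smul, Finsupp.smul_apply, syzGen,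
      ProjSum.coe_sub, ProjSum.coe_smul, ProjSum.coe_smul, projGen, projGen, Finsupp.sub_apply,
      Finsupp.smul_apply, Finsupp.smul_apply, Finsupp.single_eq_of_ne (by omega), smul_zero,
      zero_sub, smul_neg]
    by_cases hi : i = 0
    · subst hi
      rw [Finsupp.single_eq_same, Finsupp.single_eq_same, smul_eq_mul, smul_eq_mul, arc_mul_e]
    · rw [Finsupp.single_eq_of_ne (Ne.symm hi), Finsupp.single_eq_of_ne (Ne.symm hi), smul_zero,
        smul_zero, zero_mul]

theorem linearCombination_syzGen_succ (F : ℕ →₀ Lam K r m) (j : ℕ) :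
    (Finsupp.linearCombination (Lam K r m) (fun i => syzGen K T t (i + 1)) F).1 (j + 1) =
      F j * arc K (T (j + 1)) (t (j + 1)) - F (j + 1) * arc K (T (j + 1)) (t (j + 2)) := by
  classical
  induction F using Finsupp.induction_linear with
  | zero => simp [ProjSum.coe_zero]
  | add F G hF hG =>
    rw [LinearMap.map_add, ProjSum.coe_add, Finsupp.add_apply, hF, hG, Finsupp.add_apply,
      Finsupp.add_apply, add_mul, add_mul]
    abel
  | single i a =>
    rw [Finsupp.linearCombination_single, ProjSum.coe_smul, Finsupp.smul_apply, syzGen,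
      ProjSum.coe_sub, ProjSum.coe_smul, ProjSum.coe_smul, projGen, projGen, Finsupp.sub_apply,
      Finsupp.smul_apply, Finsupp.smul_apply, smul_sub]
    congr 1
    · by_cases hi : i = j
      · subst hi
        rw [Finsupp.single_eq_same, Finsupp.single_eq_same, smul_eq_mul, smul_eq_mul, arc_mul_e]
      · rw [Finsupp.single_eq_of_ne (by omega), Finsupp.single_eq_of_ne (by omega), smul_zero,
          smul_zero, zero_mul]
    · by_cases hi : i = j + 1
      · subst hi
        rw [Finsupp.single_eq_same, Finsupp.single_eq_same, smul_eq_mul, smul_eq_mul, arc_mul_e]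
      · rw [Finsupp.single_eq_of_ne (by omega), Finsupp.single_eq_of_ne (by omega), smul_zero,
          smul_zero, zero_mul]

/-- The syzygy generators with positive index generate a projective module freely. -/
theorem linearCombination_syzGen_injective (hloop : ∀ i, loop K (t (i + 1)) = 0)
    (right : ∀ i, (T (i + 1)).Reaches (t (i + 1))) (left : ∀ i, (T i).Reaches (t (i + 1)))
    (h0 : ∀ y, (t 1).Reaches y → (T 0).Reaches y ∨ ((T 1).Reaches y ∧ ¬ (t 2).Reaches y))
    (hs : ∀ i y, (t (i + 2)).Reaches y → ((T (i + 1)).Reaches y ∧ ¬ (t (i + 1)).Reaches y) ∨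
      ((T (i + 2)).Reaches y ∧ ¬ (t (i + 3)).Reaches y)) :
    Function.Injective ((Finsupp.linearCombination (Lam K r m) (fun i => syzGen K T t (i + 1))) ∘ₗ
      ProjSum.incl K (fun i => t (i + 1))) := by
  rw [← LinearMap.ker_eq_bot, LinearMap.ker_eq_bot']
  intro F hF
  have hF' : Finsupp.linearCombination (Lam K r m) (fun i => syzGen K T t (i + 1)) F.1 = 0 := hF
  have hsucc : ∀ j y, (T (j + 1)).Reaches y →
      coeff K (t (j + 1)) y (F.1 j) = coeff K (t (j + 2)) y (F.1 (j + 1)) := by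
    intro j y hy
    have h1 := linearCombination_syzGen_succ (T := T) (t := t) F.1 j
    rw [hF', ProjSum.coe_zero, Finsupp.zero_apply] at h1
    rw [← coeff_mul_arc (right j) hy, ← coeff_mul_arc (left (j + 1)) hy, ← sub_eq_zero,
      ← map_sub, ← h1, map_zero]
  refine ProjSum.ext fun j => ?_
  rw [ProjSum.coe_zero, Finsupp.zero_apply]
  refine eq_zero_of_coeff (F.2 j) (hloop j) fun y hy => ?_
  cases j with
  | zero =>
    rcases h0 y hy with h | ⟨h, h'⟩
    · have h1 := linearCombination_syzGen_zero (T := T) (t := t) F.1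
      rw [hF', ProjSum.coe_zero, Finsupp.zero_apply, eq_comm, neg_eq_zero] at h1
      rw [← coeff_mul_arc (left 0) h, h1, map_zero]
    · exact (hsucc 0 y h).trans (coeff_of_not h' _)
  | succ j =>
    rcases hs j y hy with ⟨h, h'⟩ | ⟨h, h'⟩
    · exact (hsucc j y h).symm.trans (coeff_of_not h' _)
    · exact (hsucc (j + 1) y h).trans (coeff_of_not h' _)

end

end Lam

namespace RightWord

/-- If the trim vertex is `d_0` and the glueing relations generate a free part of the syzygy, the
rest of the syzygy lives on the vertices `d_i`. -/
theorem IsLoopFree.pdLT_succ {W : RightWord (Vert r m)} {s : Vert r m} (h : W.IsLoopFree s)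
    (hinj : Function.Injective
      ((Finsupp.linearCombination (Lam K r m)
        (fun i => Lam.syzGen K W.top (W.nextTop s) (i + 1))) ∘ₗ Lam.ProjSum.incl K W.bot))
    (hs : ∃ hs, s = .d 0 hs) : PdLT (Lam K r m) (W.StringModule K) (r + 2) := by
  refine PdLT.of_ker cover_surjective ?_
  obtain ⟨χ, hχ⟩ : ∃ χ : Lam.ProjSum K W.bot →ₗ[Lam K r m] LinearMap.ker (cover K W),
      ∀ F, (χ F).1 = Finsupp.linearCombination (Lam K r m)
        (fun i => Lam.syzGen K W.top (W.nextTop s) (i + 1)) F.1 := by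
    refine ⟨LinearMap.codRestrict _ ((Finsupp.linearCombination (Lam K r m)
        (fun i => Lam.syzGen K W.top (W.nextTop s) (i + 1))) ∘ₗ Lam.ProjSum.incl K W.bot) ?_,
        fun F => rfl⟩
    intro F
    rw [h.ker_cover]
    change Finsupp.linearCombination (Lam K r m) _ F.1 ∈ _
    rw [Finsupp.linearCombination_apply]
    exact Submodule.sum_mem _ fun i _ => Submodule.smul_mem _ _ (Submodule.subset_span ⟨_, rfl⟩)
  have hχinj : Function.Injective χ := fun F G hFG => hinj (by
    change Finsupp.linearCombination (Lam K r m) _ F.1 =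
      Finsupp.linearCombination (Lam K r m) _ G.1
    rw [← hχ, ← hχ, hFG])
  refine PdLT.of_quotient (LinearMap.range χ) ?_ ?_
  · refine PdLT.mono (n := 1) ?_ (by omega)
    exact PdLT.of_equiv (LinearEquiv.ofInjective χ hχinj) (pdLT_one_iff.2 inferInstance)
  · refine Lam.pdLT_of_support_d (r + 1) 0 (by omega) fun y hy n => ?_
    obtain ⟨⟨x, hx⟩, rfl⟩ := Submodule.Quotient.mk_surjective _ n
    rw [← Submodule.Quotient.mk_smul, Submodule.Quotient.mk_eq_zero]
    obtain ⟨F, hF⟩ : ∃ F, (χ F).1 = Lam.e K y • x := by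
      suffices H : Lam.e K y • x ∈
          Submodule.map (LinearMap.ker (cover K W)).subtype (LinearMap.range χ) by
        obtain ⟨_, ⟨F, rfl⟩, hF⟩ := H
        exact ⟨F, hF⟩
      rw [h.ker_cover] at hx
      obtain ⟨c, rfl⟩ := Finsupp.mem_span_range_iff_exists_finsupp.1 hx
      rw [Finsupp.sum, Finset.smul_sum]
      refine Submodule.sum_mem _ fun i _ => ?_
      cases i with
      | zero =>
        obtain ⟨h0, rfl⟩ := hs
        have hne : ¬ Reaches (.d 0 h0) y := by
          intro hr
          cases y <;> simp [Reaches] at hr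
          exact hy _ _ (Nat.zero_le _) rfl
        have h1 := Lam.e_smul_syzGen (K := K) (T := W.top) (t := W.nextTop (.d 0 h0)) 0
        rw [← h1, nextTop, smul_smul, smul_smul, Lam.e_mul_mul_e hne, zero_smul]
        exact zero_mem _
      | succ i =>
        refine Submodule.smul_mem _ _ (Submodule.smul_mem _ _ ⟨_, ⟨Lam.projGen K W.bot i, rfl⟩, ?_⟩)
        rw [Submodule.subtype_apply, hχ]
        change Finsupp.linearCombination (Lam K r m) _ (Finsupp.single i _) = _
        rw [Finsupp.linearCombination_single]
        exact Lam.e_smul_syzGen (K := K) (T := W.top) (t := W.nextTop s) (i + 1)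
    exact ⟨F, Subtype.ext hF⟩

theorem e_smul_eq_zero_of_not_reaches {W : RightWord (Vert r m)} {y : Vert r m}
    (h : ∀ i, ¬ (W.top i).Reaches y) (n : W.StringModule K) : Lam.e K y • n = 0 := by
  have hn : n ∈ Submodule.span (Lam K r m) (Set.range (gen K W)) := by
    rw [span_gen]
    exact Submodule.mem_top
  obtain ⟨c, rfl⟩ := Finsupp.mem_span_range_iff_exists_finsupp.1 hn
  rw [Finsupp.sum, Finset.smul_sum]
  refine Finset.sum_eq_zero fun i _ => ?_
  rw [← e_smul_gen, smul_smul, smul_smul, Lam.e_mul_mul_e (h i), zero_smul]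

/-- For `k = 1`, the syzygy of `M_k` is nearly projective; for larger `k`, it is `M_{k-1}`. -/
theorem pdLT_stringWord {k : ℕ} (hk : 1 ≤ k) (h : k ≤ m) :
    PdLT (Lam K r m) ((stringWord r m k hk h).StringModule K) (r + k + 1) := by
  induction k, hk using Nat.le_induction with
  | base =>
    refine (isLoopFree_stringWord le_rfl h).pdLT_succ ?_ ⟨_, rfl⟩
    refine Lam.linearCombination_syzGen_injective
      (T := (stringWord r m 1 le_rfl h).top)
      (t := (stringWord r m 1 le_rfl h).nextTop (Lam.trimVert 1 h)) ?_ ?_ ?_ ?_ ?_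
    · exact forall_of_periodic rfl rfl rfl fun _ h => h
    · refine forall_of_periodic ?_ ?_ ?_ fun _ h => h
      all_goals simp [stringWord, periodic, perTop, nextTop, Reaches]
    · refine forall_of_periodic ?_ ?_ ?_ fun _ h => h
      all_goals simp [stringWord, periodic, perTop, nextTop, Reaches]
    · intro y
      cases y <;> simp [stringWord, periodic, perTop, nextTop, Reaches] <;> omega
    · refine forall_of_periodic ?_ ?_ ?_ fun _ h => h
      all_goals
        intro y
        cases y <;> simp [stringWord, periodic, perTop, nextTop, Reaches] <;> omega
  | succ k hk ih =>
    obtain ⟨φ⟩ := (isLoopFree_stringWord (r := r) (by omega) h).nonempty_equiv (K := K)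
      (isLoopFree_stringWord hk (by omega)) (stringWord_top hk h) (loop_top hk (by omega))
      (syzygyCondition_stringWord hk h)
    exact PdLT.of_ker cover_surjective (PdLT.of_equiv φ (ih (by omega)))

/-- The generator `z_0` of `M_k` is annihilated by the arrow from `a_k` to `trimVert k`, but it is
not a multiple of `α_{k+1}`, since `M_k` vanishes at `a_{k+1}`. -/
theorem not_pdLT_stringWord (hr : 1 ≤ r) {k : ℕ} (hk : 1 ≤ k) (h : k ≤ m) :
    ¬ PdLT (Lam K r m) ((stringWord r m k hk h).StringModule K) (r + k) := by
  intro hpd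
  have hW := isLoopFree_stringWord (r := r) hk h
  have htop : (stringWord r m k hk h).top 0 = .a k h := by
    rcases k with _ | _ | _ | _ | k
    · omega
    all_goals rfl
  have htrim := hW.trim (K := K)
  rw [htop] at htrim
  obtain ⟨n, n', hn⟩ := Lam.resolvesLT_enter hr hk h _ hpd _ htrim
  refine hW.gen_zero_ne_zero (K := K) ?_
  rw [← e_smul_gen, htop, hn, zero_smul, add_zero, Lam.enter]
  split_ifs with hm
  · refine Lam.arc_smul_of_e _ (e_smul_eq_zero_of_not_reaches ?_ n)
    rcases k with _ | _ | _ | _ | k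
    · omega
    all_goals
      refine forall_of_periodic ?_ ?_ ?_ fun _ h => h
      all_goals simp [stringWord, periodic, perTop, Reaches]
    all_goals omega
  · exact zero_smul _ _

end RightWord

theorem projectiveDimension_stringM (K : Type u) [Field K] {r m k : ℕ} (hr : 1 ≤ r) (hk : 1 ≤ k)
    (h : k ≤ m) :
    projectiveDimension (ModuleCat.of (Lam K r m) (StringM K r m k hk h)) =
      ((r + k : ℕ) : WithBot ℕ∞) :=
  le_antisymm ((projectiveDimension_le_iff _ _).2 (RightWord.pdLT_stringWord hk h))
    ((projectiveDimension_ge_iff _ _).2 (RightWord.not_pdLT_stringWord hr hk h))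

theorem bigFinitisticDim_eq (K : Type u) [Field K] {r m : ℕ} (hr : 1 ≤ r) (hm : 1 ≤ m) :
    bigFinitisticDim (Lam K r m) = ((r + m : ℕ) : WithBot ℕ∞) := by
  refine le_antisymm (iSup₂_le fun M hM => ?_) ?_
  · obtain ⟨n, hn⟩ := (projectiveDimension_ne_top_iff M).1 hM
    refine (projectiveDimension_le_iff _ _).2 (Lam.pdLT_of_level_le (N := M) m hn ?_)
    intro y hy
    cases y <;> simp [Vert.level] at hy <;> omega
  · rw [← projectiveDimension_stringM K hr hm le_rfl]
    refine le_iSup₂_of_le (ModuleCat.of (Lam K r m) (StringM K r m m hm le_rfl)) ?_ le_rfl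
    rw [projectiveDimension_stringM K hr hm le_rfl]
    exact WithBot.coe_injective.ne (ENat.natCast_ne_top _)

theorem isFirstSyzygy_stringM (K : Type u) [Field K] {r m k : ℕ} (hk : 2 ≤ k) (h : k ≤ m) :
    IsFirstSyzygy (Lam K r m) (StringM K r m (k - 1) (by omega) (by omega))
      (StringM K r m k (by omega) h) := by
  obtain ⟨k, rfl⟩ : ∃ k', k = k' + 1 := ⟨k - 1, by omega⟩
  have hW := RightWord.isLoopFree_stringWord (r := r) (k := k + 1) (by omega) h
  exact ⟨ModuleCat.of _ (Lam.ProjSum K _), RightWord.cover K _, hW.isProjectiveCover,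
    hW.nonempty_equiv (RightWord.isLoopFree_stringWord (by omega) (by omega))
      (RightWord.stringWord_top (by omega) h) (RightWord.loop_top (by omega) (by omega))
      (RightWord.syzygyCondition_stringWord (by omega) h)⟩

theorem exists_isFirstSyzygy (K : Type u) [Field K] {r m : ℕ} (hm : 1 ≤ m)
    (M : ModuleCat.{u} (Lam K r m)) (hM : projectiveDimension M ≠ ⊤) :
    ∃ N : ModuleCat.{u} (Lam K r m), IsFirstSyzygy (Lam K r m) N M ∧
      ∀ x : Vert r m, x.level = m → ∀ n : N, Lam.e K x • n = 0 := by
  obtain ⟨n, hn⟩ := (projectiveDimension_ne_top_iff M).1 hM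
  obtain ⟨B, v, f, hf, hrad, hv⟩ := Lam.exists_cover (K := K) (r := r) (m := m) M
  refine ⟨ModuleCat.of _ (LinearMap.ker f), ⟨ModuleCat.of _ (Lam.ProjSum K v), f,
    Lam.isProjectiveCover_of_le_rad hf fun F hF => Lam.mem_rad_of_inRad (hrad F hF),
    ⟨LinearEquiv.refl _ _⟩⟩, ?_⟩
  rintro x hx ⟨F, hF⟩
  refine Subtype.ext (Lam.e_smul_ker_eq_zero hrad (fun b => ?_) hm
    ((pdLT_ker_iff hf n).1 (PdLT.mono hn (by omega))) hx.ge F hF)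
  generalize v b = y
  cases y <;> simp [Vert.level] <;> omega

end

end

theorem claim4 (K : Type u) [Field K] (r : ℕ) (hr : 1 ≤ r) :
    -- the big finitistic dimensions
    (∀ m : ℕ, 1 ≤ m → m ≤ r + 1 →
      bigFinitisticDim (Lam K r m) = ((r + m : ℕ) : WithBot ℕ∞)) ∧
    bigFinitisticDim (Lam K r (r + 1)) = ((2 * r + 1 : ℕ) : WithBot ℕ∞) ∧
    -- the string modules `M_k`
    (∀ (m k : ℕ) (hk : 1 ≤ k) (hkm : k ≤ m),
      projectiveDimension (ModuleCat.of (Lam K r m) (StringM K r m k hk hkm)) =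
        ((r + k : ℕ) : WithBot ℕ∞)) ∧
    (∀ (m k : ℕ) (hk : 2 ≤ k) (hkm : k ≤ m),
      IsFirstSyzygy (Lam K r m) (StringM K r m (k - 1) (by omega) (by omega))
        (StringM K r m k (by omega) hkm)) ∧
    -- first syzygies of modules of finite projective dimension
    (∀ m : ℕ, 2 ≤ m → ∀ M : ModuleCat.{u} (Lam K r m), projectiveDimension M ≠ ⊤ →
      ∃ N : ModuleCat.{u} (Lam K r m), IsFirstSyzygy (Lam K r m) N M ∧
        ∀ x : Vert r m, x.level = m → ∀ n : N, Lam.e K x • n = 0) := by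
  refine ⟨fun m hm _ => bigFinitisticDim_eq K hr hm, ?_,
    fun m k hk hkm => projectiveDimension_stringM K hr hk hkm,
    fun m k hk hkm => isFirstSyzygy_stringM K hk hkm,
    fun m hm M hM => exists_isFirstSyzygy K (by omega) M hM⟩
  rw [bigFinitisticDim_eq K hr (by omega), two_mul, add_assoc]
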